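/- **Theorem (verification of stable decomposition).** Let $\Omega\subset\mathbb R^d$ be a bounded open convex polytopal domain, and let either $d=2$, $k\ge 3$ or $d=3$, $k\ge 5$. Let $\mathcal T_h$ be a conforming simplicial triangulation of $\overline\Omega$ that is shape regular with constant $\rho$ (every $T\in\mathcal T_h$ contains a ball of radius $h_T/\rho$, $h_T=\operatorname{diam}T$), and let $\lambda>0$. *Spaces.* $V_h$ is the space of all $v\in H^1_0(\Omega)$ (taken as continuous functions on $\overline\Omega$ vanishing on $\partial\Omega$) with $v|_T\in\mathcal P_k(T)$ for all $T\in\mathcal T_h$ which are $C^1$ at all vertices if $d=2$ (Hermite), and $C^1$ on all edges and $C^2$ at all vertices if $d=3$ (Argyris). $V_0\subset H^1_0(\Omega)$ is the continuous piecewise linear space on $\mathcal T_h$. On $V_h$ put $$(w,v)_{\lambda,h}=\sum_{T}(D^2w,D^2v)_T+2\lambda(\nabla w,\nabla v)_\Omega+\lambda^2(w,v)_\Omega,\qquad \|v\|_{\lambda,h}^2=(v,v)_{\lambda,h},$$ and let $A_{\lambda,h}:V_h\to V_h'$ be the operator of this inner product. $I_hv\in V_0$ denotes the nodal interpolant of $v\in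 V_h$. *Degrees of freedom.* $V_h$ is equipped with degrees of freedom $\mathcal N_\alpha(\varphi)=\frac{1}{|D_\alpha|}\int_{D_\alpha}\nabla^{k_\alpha}\varphi(\boldsymbol t_1,\dots,\boldsymbol t_{k_\alpha})$ (the value if $D_\alpha$ is a point), $k_\alpha\in\{0,1,2\}$, which are attached to subsimplices $\sigma$ of the triangulation: values on all subsimplices, first derivatives at vertices and (if $d=3$) on edges, second derivatives at vertices (if $d=3$). Here $D_\alpha$ is $\sigma$ or a point in its relative interior, and in barycentric coordinates, with the vertices ordered by a numbering of the nodes, the domains $D_\alpha$ form a fixed unisolvent layout $L$ (a finite set for each order $m$ and each dimension $j$ of $\sigma$ occurring above): for polynomials of degree $\le k-m$ on the reference $j$-simplex whose derivatives of order $\le d-m-j$ vanish on its relative boundary, the averages over the domains may be prescribed arbitrarily and determine the polynomial uniquely. The $\boldsymbol t_i$ are unit vectors orthogonal to $\sigma$, well-conditioned with a constant $\kappa>0$: for each subsimplex $\sigma$, order $m$ and domain in the layout, the degrees of freedom with these data contain a family for which $\kappa\|S\|^2\le\sum_\alpha S(\boldsymbol t_1,\dots,\boldsymbol t_m)^2$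 for all symmetric $m$-linear forms $S$ on $\mathbb R^d$ that vanish if an argument is tangential to $\sigma$ and vanish on the tangent vectors of each boundary face ($(d-1)$-dimensional, contained in $\partial\Omega$) containing $\sigma$ (for $m=0$: $S\in\mathbb R$, with $S=0$ if there is such a face). Let $\{\varphi_\alpha\}$ be the nodal basis of $V_h$ dual to $\{\mathcal N_\alpha\}$, in an arbitrary order, and let $\omega_\alpha$ be the union of the $\#\omega_\alpha$ simplices $T$ whose interior meets $\operatorname{supp}\varphi_\alpha$. *Transfer operator.* $\Pi_0:V_0\to V_h$ is given by $$\mathcal N_\alpha(\Pi_0p)=\frac1{\#\omega_\alpha}\sum_{T\subset\omega_\alpha}\frac{1}{|D_\alpha|}\int_{D_\alpha}\partial_{\boldsymbol n}(p|_T)\,(\boldsymbol n\cdot\boldsymbol t_\alpha)\quad\text{if }D_\alpha\subset\partial\Omega,\ k_\alpha=1,$$ with $\boldsymbol n$ the unit outer normal of $\partial\Omega$, and $\mathcal N_\alpha(\Pi_0p)=\frac1{\#\omega_\alpha}\sum_{T\subset\omega_\alpha}\mathcal N_\alpha(p|_T)$ otherwise. *Smoothers.* $\Delta_h:V_0\to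 V_0$ is defined by $(-\Delta_hw,v)_\Omega=(\nabla w,\nabla v)_\Omega$ for all $w,v\in V_0$, and $\|v_0\|^2_{R_0^{-1}}=\|\lambda v_0-\Delta_hv_0\|^2_{L^2(\Omega)}$ for $v_0\in V_0$. $R_h$ is the Gauss–Seidel smoother for $A_{\lambda,h}$ in the basis $\{\varphi_\alpha\}$, $\bar R_h$ is the symmetric Gauss–Seidel smoother, $I-\bar R_hA_{\lambda,h}=(I-R_h'A_{\lambda,h})(I-R_hA_{\lambda,h})$, and $\|v_h\|^2_{\bar R_h^{-1}}=\langle\bar R_h^{-1}v_h,v_h\rangle$. *Claim.* There is a constant $c_0>0$, depending only on $\Omega$, $d$, $k$, the shape regularity constant $\rho$ and the choice of the element ($L$, $\kappa$), and in particular independent of $\lambda$, $h$ and the triangulation, such that every $v\in V_h$ can be written as $$v=v_h+\Pi_0v_0,\qquad v_h\in V_h,\quad v_0=I_hv\in V_0,\qquad\text{with}\qquad \|v_h\|^2_{\bar R_h^{-1}}+\|v_0\|^2_{R_0^{-1}}\le c_0^2\,\|v\|^2_{\lambda,h}.$$ -/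

import Mathlib

open MeasureTheory Set

noncomputable section

namespace FEM

/-- `ℝ^d` with the Euclidean norm. -/
abbrev E (d : ℕ) : Type := EuclideanSpace ℝ (Fin d)

/-- The closed simplex with the given vertex set. -/
abbrev hull {d : ℕ} (s : Finset (E d)) : Set (E d) := convexHull ℝ (s : Set (E d))

/-- Bounded open convex polytopal domains. -/
structure IsConvexPolytopalDomain {d : ℕ} (Ω : Set (E d)) : Prop where
  isOpen : IsOpen Ω
  convex : Convex ℝ Ω
  nonempty : Ω.Nonempty
  polytope : ∃ s : Finset (E d), closure Ω = hull s

/-! ### Triangulations -/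

/-- Conforming simplicial triangulations of (the closure of) `Ω`: finite geometric simplicial
complexes whose underlying space is `closure Ω` and all of whose simplices are faces of
`d`-dimensional ones. -/
structure Mesh {d : ℕ} (Ω : Set (E d)) where
  complex : Geometry.SimplicialComplex ℝ (E d)
  finite : complex.faces.Finite
  space_eq : complex.space = closure Ω
  pure : ∀ s ∈ complex.faces, ∃ T ∈ complex.faces, s ⊆ T ∧ T.card = d + 1

variable {d : ℕ} {Ω : Set (E d)}

namespace Mesh

open Classical in
/-- The set `𝒯_h` of `d`-dimensional simplices (given by their vertex sets). -/
def cells (M : Mesh Ω) : Finset (Finset (E d)) :=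
  M.finite.toFinset.filter fun T => T.card = d + 1

/-- The set `𝒩_h` of nodes. -/
def nodes (M : Mesh Ω) : Set (E d) := {x | {x} ∈ M.complex.faces}

/-- The faces (of dimension `d - 1`) on the boundary. -/
def boundaryFacets (M : Mesh Ω) : Set (Finset (E d)) :=
  {F | F ∈ M.complex.faces ∧ F.card = d ∧ hull F ⊆ frontier Ω}

/-- Shape regularity with constant `ρ`: every `T` contains a ball of radius `h_T / ρ`, where `h_T`
is the diameter of `T`. -/
def IsShapeRegular (M : Mesh Ω) (ρ : ℝ) : Prop :=
  ∀ T ∈ M.cells, ∃ x, Metric.closedBall x (Metric.diam (hull T) / ρ) ⊆ hull T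

end Mesh

/-- On the set `s`, the function `v` is a polynomial of degree at most `k`. -/
def IsPolyOn (k : ℕ) (s : Set (E d)) (v : E d → ℝ) : Prop :=
  ∃ q : MvPolynomial (Fin d) ℝ, q.totalDegree ≤ k ∧ ∀ x ∈ s, v x = MvPolynomial.eval (fun i => x i) q

/-- `v` is `C^m` at the point `x`: the derivatives up to order `m` at `x` of the restrictions of `v`
to the cells containing `x` coincide. -/
def Mesh.IsCmAt (M : Mesh Ω) (m : ℕ) (v : E d → ℝ) (x : E d) : Prop :=
  ∀ T ∈ M.cells, ∀ T' ∈ M.cells, x ∈ hull T → x ∈ hull T' → ∀ i ≤ m,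
    iteratedFDerivWithin ℝ i v (hull T) x = iteratedFDerivWithin ℝ i v (hull T') x

/-! ### Auxiliary facts on piecewise polynomials -/

theorem contDiff_evalPoly (q : MvPolynomial (Fin d) ℝ) :
    ContDiff ℝ (⊤ : ℕ∞) (fun x : E d => MvPolynomial.eval (fun i => x i) q) := by
  induction q using MvPolynomial.induction_on with
  | C a => simpa using contDiff_const
  | add p q hp hq => simpa using hp.add hq
  | mul_X p i hp =>
    have : ContDiff ℝ (⊤ : ℕ∞) (fun x : E d => x i) := by fun_prop
    simpa using hp.mul this

theorem IsPolyOn.contDiffOn {k : ℕ} {s : Set (E d)} {v : E d → ℝ} (h : IsPolyOn k s v) :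
    ContDiffOn ℝ (⊤ : ℕ∞) v s := by
  obtain ⟨q, -, hq⟩ := h
  exact (contDiff_evalPoly q).contDiffOn.congr hq

theorem IsPolyOn.add {k : ℕ} {s : Set (E d)} {v w : E d → ℝ} (hv : IsPolyOn k s v)
    (hw : IsPolyOn k s w) : IsPolyOn k s (v + w) := by
  obtain ⟨p, hp, hp'⟩ := hv
  obtain ⟨q, hq, hq'⟩ := hw
  exact ⟨p + q, (MvPolynomial.totalDegree_add p q).trans (max_le hp hq), fun x hx => by
    simp [hp' x hx, hq' x hx]⟩

theorem IsPolyOn.smul {k : ℕ} {s : Set (E d)} {v : E d → ℝ} (c : ℝ) (hv : IsPolyOn k s v) :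
    IsPolyOn k s (c • v) := by
  obtain ⟨p, hp, hp'⟩ := hv
  exact ⟨c • p, (MvPolynomial.totalDegree_smul_le c p).trans hp, fun x hx => by
    simp [hp' x hx]⟩

namespace Mesh

variable (M : Mesh Ω)

theorem mem_cells {T : Finset (E d)} :
    T ∈ M.cells ↔ T ∈ M.complex.faces ∧ T.card = d + 1 := by
  classical
  simp [cells]

theorem interior_hull_nonempty {T : Finset (E d)} (hT : T ∈ M.cells) :
    (interior (hull T)).Nonempty := by
  rw [interior_convexHull_nonempty_iff_affineSpan_eq_top]
  obtain ⟨hT, hc⟩ := M.mem_cells.1 hT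
  have h := (M.complex.indep hT).affineSpan_eq_top_iff_card_eq_finrank_add_one.2 (by simp [hc])
  simpa using h

theorem uniqueDiffOn_hull {T : Finset (E d)} (hT : T ∈ M.cells) : UniqueDiffOn ℝ (hull T) :=
  uniqueDiffOn_convex (convex_convexHull ℝ _) (M.interior_hull_nonempty hT)

/-- Continuous piecewise polynomials of degree at most `k` on the mesh which vanish on `∂Ω`
(extended by zero to `ℝ^d`). Since the polynomial pieces live on the closed cells, such a function
is continuous; these are exactly the continuous representatives of the functions `v ∈ H_0^1(Ω)`
with `v|_T ∈ 𝒫_k(T)` for every `T`. -/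
def piecewisePoly (k : ℕ) : Submodule ℝ (E d → ℝ) where
  carrier := {v | (∀ T ∈ M.cells, IsPolyOn k (hull T) v) ∧ ∀ x ∉ Ω, v x = 0}
  add_mem' := fun {v w} hv hw => ⟨fun T hT => (hv.1 T hT).add (hw.1 T hT), fun x hx => by
    simp [hv.2 x hx, hw.2 x hx]⟩
  zero_mem' := ⟨fun T _ => ⟨0, by simp, by simp⟩, by simp⟩
  smul_mem' := fun c v hv => ⟨fun T hT => (hv.1 T hT).smul c, fun x hx => by simp [hv.2 x hx]⟩

variable {M} in
theorem IsCmAt.add {m k : ℕ} {v w : E d → ℝ} {x : E d} (hv : v ∈ M.piecewisePoly k)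
    (hw : w ∈ M.piecewisePoly k) (h : M.IsCmAt m v x) (h' : M.IsCmAt m w x) :
    M.IsCmAt m (v + w) x := by
  have key : ∀ T ∈ M.cells, x ∈ hull T → ∀ i : ℕ,
      iteratedFDerivWithin ℝ i (v + w) (hull T) x =
        iteratedFDerivWithin ℝ i v (hull T) x + iteratedFDerivWithin ℝ i w (hull T) x := by
    intro T hT hx i
    have hle : ((i : ℕ∞) : WithTop ℕ∞) ≤ ((⊤ : ℕ∞) : WithTop ℕ∞) := by exact_mod_cast le_top
    exact iteratedFDerivWithin_add_apply
      (((hv.1 T hT).contDiffOn x hx).of_le hle)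
      (((hw.1 T hT).contDiffOn x hx).of_le hle) (M.uniqueDiffOn_hull hT) hx
  intro T hT T' hT' hx hx' i hi
  rw [key T hT hx, key T' hT' hx', h T hT T' hT' hx hx' i hi, h' T hT T' hT' hx hx' i hi]

variable {M} in
theorem IsCmAt.smul {m k : ℕ} {v : E d → ℝ} {x : E d} (c : ℝ) (hv : v ∈ M.piecewisePoly k)
    (h : M.IsCmAt m v x) : M.IsCmAt m (c • v) x := by
  have key : ∀ T ∈ M.cells, x ∈ hull T → ∀ i : ℕ,
      iteratedFDerivWithin ℝ i (c • v) (hull T) x =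
        c • iteratedFDerivWithin ℝ i v (hull T) x := by
    intro T hT hx i
    have hle : ((i : ℕ∞) : WithTop ℕ∞) ≤ ((⊤ : ℕ∞) : WithTop ℕ∞) := by exact_mod_cast le_top
    exact iteratedFDerivWithin_const_smul_apply
      (((hv.1 T hT).contDiffOn x hx).of_le hle) (M.uniqueDiffOn_hull hT) hx
  intro T hT T' hT' hx hx' i hi
  rw [key T hT hx, key T' hT' hx', h T hT T' hT' hx hx' i hi]

theorem isCmAt_zero (m : ℕ) (x : E d) : M.IsCmAt m 0 x := by
  intro T _ T' _ _ _ i _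
  simp [Pi.zero_def]

/-! ### The finite element spaces -/

/-- The space `V_h`: for `d = 2` the `𝒫_k`-Hermite space (`C^1` at the vertices), for `d = 3` the
`𝒫_k`-Argyris space (`C^1` on the edges and `C^2` at the vertices). -/
def Vh (k : ℕ) : Submodule ℝ (E d → ℝ) where
  carrier := {v | v ∈ M.piecewisePoly k ∧
    (d = 2 → ∀ x ∈ M.nodes, M.IsCmAt 1 v x) ∧
    (d = 3 → (∀ e ∈ M.complex.faces, e.card = 2 → ∀ x ∈ hull e, M.IsCmAt 1 v x) ∧
      ∀ x ∈ M.nodes, M.IsCmAt 2 v x)}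
  add_mem' := fun hv hw => ⟨add_mem hv.1 hw.1,
    fun h x hx => (hv.2.1 h x hx).add hv.1 hw.1 (hw.2.1 h x hx),
    fun h => ⟨fun e he hc x hx =>
      ((hv.2.2 h).1 e he hc x hx).add hv.1 hw.1 ((hw.2.2 h).1 e he hc x hx),
      fun x hx => ((hv.2.2 h).2 x hx).add hv.1 hw.1 ((hw.2.2 h).2 x hx)⟩⟩
  zero_mem' := ⟨zero_mem _, fun _ _ _ => M.isCmAt_zero _ _,
    fun _ => ⟨fun _ _ _ _ _ => M.isCmAt_zero _ _, fun _ _ => M.isCmAt_zero _ _⟩⟩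
  smul_mem' := fun c _ hv => ⟨Submodule.smul_mem _ c hv.1,
    fun h x hx => (hv.2.1 h x hx).smul c hv.1,
    fun h => ⟨fun e he hc x hx => ((hv.2.2 h).1 e he hc x hx).smul c hv.1,
      fun x hx => ((hv.2.2 h).2 x hx).smul c hv.1⟩⟩

/-- The auxiliary space `V_0` of continuous piecewise linear functions vanishing on `∂Ω`. -/
abbrev V0 : Submodule ℝ (E d → ℝ) := M.piecewisePoly 1

/-- The `L²(Ω)` inner product. -/
def l2 (Ω : Set (E d)) (w v : E d → ℝ) : ℝ := ∫ x in Ω, w x * v x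

/-- The `L²(Ω)` inner product of the gradients. -/
def gradInner (Ω : Set (E d)) (w v : E d → ℝ) : ℝ :=
  ∫ x in Ω, inner ℝ (gradient w x) (gradient v x)

/-- The Frobenius inner product of the Hessians at `x`. -/
def hessInner (w v : E d → ℝ) (x : E d) : ℝ :=
  ∑ i : Fin d, ∑ j : Fin d,
    iteratedFDeriv ℝ 2 w x ![EuclideanSpace.single i 1, EuclideanSpace.single j 1] *
      iteratedFDeriv ℝ 2 v x ![EuclideanSpace.single i 1, EuclideanSpace.single j 1]

/-- The inner product `(w, v)_{λ,h}`. -/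
def inner_lam (lam : ℝ) (w v : E d → ℝ) : ℝ :=
  (∑ T ∈ M.cells, ∫ x in hull T, hessInner w v x) +
    2 * lam * gradInner Ω w v + lam ^ 2 * l2 Ω w v

/-! ### The discrete Laplacian -/

theorem isCompact_hull (s : Finset (E d)) : IsCompact (hull s) :=
  Set.Finite.isCompact_convexHull (𝕜 := ℝ) s.finite_toSet

theorem closure_eq : closure Ω = ⋃ T ∈ M.cells, hull T := by
  rw [← M.space_eq]
  ext x
  simp only [Geometry.SimplicialComplex.mem_space_iff, mem_iUnion, exists_prop]
  constructor
  · rintro ⟨s, hs, hx⟩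
    obtain ⟨T, hT, hsT, hc⟩ := M.pure s hs
    exact ⟨T, M.mem_cells.2 ⟨hT, hc⟩, convexHull_mono (by exact_mod_cast hsT) hx⟩
  · rintro ⟨T, hT, hx⟩
    exact ⟨T, (M.mem_cells.1 hT).1, hx⟩

theorem measure_domain_lt_top (M : Mesh Ω) : volume Ω < ⊤ := by
  have : IsCompact (closure Ω) := by
    rw [M.closure_eq]
    exact M.cells.isCompact_biUnion fun T _ => isCompact_hull T
  exact (measure_mono subset_closure).trans_lt this.measure_lt_top

theorem ae_mem_interior : ∀ᵐ x ∂(volume.restrict Ω), ∃ T ∈ M.cells, x ∈ interior (hull T) := by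
  have h : volume (⋃ T ∈ M.cells, frontier (hull T)) = 0 :=
    (measure_biUnion_null_iff M.cells.countable_toSet).2 fun T _ =>
      (convex_convexHull ℝ _).addHaar_frontier volume
  have h1 : ∀ᵐ x ∂(volume : Measure (E d)), x ∉ ⋃ T ∈ M.cells, frontier (hull T) :=
    measure_eq_zero_iff_ae_notMem.1 h
  have h3 : ∀ᵐ x ∂(volume.restrict Ω), x ∈ closure Ω := by
    have hsub : Ω ⊆ closure Ω := subset_closure
    have := ae_restrict_mem (μ := (volume : Measure (E d))) (s := closure Ω) isClosed_closure.measurableSet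
    exact ae_mono (Measure.restrict_mono hsub le_rfl) this
  have h4 : ∀ᵐ x ∂(volume.restrict Ω), x ∉ ⋃ T ∈ M.cells, frontier (hull T) :=
    ae_restrict_of_ae h1
  filter_upwards [h3, h4] with x hx' hx
  rw [M.closure_eq] at hx'
  simp only [mem_iUnion, exists_prop] at hx' hx
  obtain ⟨T, hT, hxT⟩ := hx'
  refine ⟨T, hT, ?_⟩
  by_contra hn
  exact hx ⟨T, hT, subset_closure hxT, hn⟩

variable {M} in
theorem contDiffAt_of_mem_interior {k : ℕ} {v : E d → ℝ} (hv : v ∈ M.piecewisePoly k)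
    {T : Finset (E d)} (hT : T ∈ M.cells) {x : E d} (hx : x ∈ interior (hull T)) :
    ContDiffAt ℝ (⊤ : ℕ∞) v x :=
  (hv.1 T hT).contDiffOn.contDiffAt (mem_interior_iff_mem_nhds.1 hx)

variable {M} in
theorem exists_bound {k : ℕ} {v : E d → ℝ} (hv : v ∈ M.piecewisePoly k) :
    ∃ C : ℝ, ∀ᵐ x ∂(volume.restrict Ω), |v x| ≤ C ∧ ‖gradient v x‖ ≤ C := by
  have h : ∀ T ∈ M.cells, ∃ C : ℝ, ∀ x ∈ interior (hull T), |v x| ≤ C ∧ ‖gradient v x‖ ≤ C := by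
    intro T hT
    obtain ⟨q, -, hq⟩ := hv.1 T hT
    have hc := contDiff_evalPoly q
    have hc' : Continuous (fun x : E d => fderiv ℝ (fun x : E d =>
        MvPolynomial.eval (fun i => x i) q) x) := hc.continuous_fderiv (by simp)
    obtain ⟨C, hC⟩ := (isCompact_hull T).exists_bound_of_continuousOn hc'.continuousOn
    obtain ⟨C', hC'⟩ := (isCompact_hull T).exists_bound_of_continuousOn hc.continuous.continuousOn
    refine ⟨max C C', fun x hx => ?_⟩
    have hev : v =ᶠ[nhds x] fun x => MvPolynomial.eval (fun i => x i) q :=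
      Filter.eventuallyEq_of_mem (mem_interior_iff_mem_nhds.1 hx) hq
    refine ⟨?_, ?_⟩
    · rw [hq x (interior_subset hx)]
      exact (hC' x (interior_subset hx)).trans (le_max_right _ _)
    · rw [gradient, LinearIsometryEquiv.norm_map, hev.fderiv_eq]
      exact (hC x (interior_subset hx)).trans (le_max_left _ _)
  choose! C hC using h
  refine ⟨∑ T ∈ M.cells, |C T|, ?_⟩
  filter_upwards [M.ae_mem_interior] with x ⟨T, hT, hx⟩
  have hle : C T ≤ ∑ T ∈ M.cells, |C T| :=
    (le_abs_self _).trans (Finset.single_le_sum (f := fun T => |C T|) (fun _ _ => abs_nonneg _) hT)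
  exact ⟨(hC T hT x hx).1.trans hle, (hC T hT x hx).2.trans hle⟩

variable {M} in
theorem gradient_add_smul {k : ℕ} {v w : E d → ℝ} (hv : v ∈ M.piecewisePoly k)
    (hw : w ∈ M.piecewisePoly k) (c : ℝ) :
    ∀ᵐ x ∂(volume.restrict Ω), gradient (v + c • w) x = gradient v x + c • gradient w x := by
  filter_upwards [M.ae_mem_interior] with x ⟨T, hT, hx⟩
  have h1 := (contDiffAt_of_mem_interior hv hT hx).differentiableAt (by simp)
  have h2 := (contDiffAt_of_mem_interior hw hT hx).differentiableAt (by simp)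
  simp only [gradient]
  rw [fderiv_add h1 (h2.const_smul c), fderiv_const_smul h2, map_add, map_smulₛₗ]
  rfl

theorem measurable_grad (v : E d → ℝ) : Measurable (gradient v) :=
  (InnerProductSpace.toDual ℝ (E d)).symm.continuous.measurable.comp (measurable_fderiv ℝ v)

variable {M} in
theorem integrable_gradInner {k : ℕ} {v w : E d → ℝ} (hv : v ∈ M.piecewisePoly k)
    (hw : w ∈ M.piecewisePoly k) :
    Integrable (fun x => inner ℝ (gradient w x) (gradient v x)) (volume.restrict Ω) := by
  have : IsFiniteMeasure (volume.restrict Ω) := ⟨by simpa using M.measure_domain_lt_top⟩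
  obtain ⟨C, hC⟩ := exists_bound hv
  obtain ⟨C', hC'⟩ := exists_bound hw
  refine Integrable.of_bound (C := C' * C)
    ((measurable_grad w).inner (measurable_grad v)).aestronglyMeasurable ?_
  filter_upwards [hC, hC'] with x hx hx'
  exact (norm_inner_le_norm _ _).trans
    (mul_le_mul hx'.2 hx.2 (norm_nonneg _) ((norm_nonneg _).trans hx'.2))

variable {M} in
theorem continuousOn_closure {k : ℕ} {v : E d → ℝ} (hv : v ∈ M.piecewisePoly k) :
    ContinuousOn v (closure Ω) := by
  rw [M.closure_eq]
  have : (⋃ T ∈ M.cells, hull T) = ⋃ T : M.cells, hull (T : Finset (E d)) := by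
    ext; simp
  rw [this]
  exact (locallyFinite_of_finite _).continuousOn_iUnion (fun T => (isCompact_hull _).isClosed)
    fun T => (hv.1 T T.2).contDiffOn.continuousOn

variable {M} in
theorem integrable_l2 {k : ℕ} {v w : E d → ℝ} (hv : v ∈ M.piecewisePoly k)
    (hw : w ∈ M.piecewisePoly k) : Integrable (fun x => w x * v x) (volume.restrict Ω) := by
  have hc : IsCompact (closure Ω) := by
    rw [M.closure_eq]
    exact M.cells.isCompact_biUnion fun T _ => isCompact_hull T
  exact (((continuousOn_closure hw).mul (continuousOn_closure hv)).integrableOn_compact hc).mono_set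
    subset_closure

variable {M} in
theorem eq_zero_of_l2_self {k : ℕ} {v : E d → ℝ} (hv : v ∈ M.piecewisePoly k)
    (h : l2 Ω v v = 0) : v = 0 := by
  have h0 : ∀ᵐ x ∂(volume.restrict Ω), v x = 0 := by
    have := (integral_eq_zero_iff_of_nonneg (fun x => mul_self_nonneg (v x))
      (integrable_l2 hv hv)).1 h
    filter_upwards [this] with x hx
    simpa using hx
  have hin : ∀ T ∈ M.cells, ∀ x ∈ hull T, v x = 0 := by
    intro T hT
    have hae : ∀ᵐ x ∂(volume : Measure (E d)), v x = 0 := by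
      filter_upwards [ae_imp_of_ae_restrict h0] with x hx
      by_cases hxΩ : x ∈ Ω
      · exact hx hxΩ
      · exact hv.2 x hxΩ
    have hcont : ContinuousOn v (hull T) := (hv.1 T hT).contDiffOn.continuousOn
    have hint : EqOn v (fun _ => (0 : ℝ)) (interior (hull T)) :=
      Measure.eqOn_open_of_ae_eq (ae_restrict_of_ae hae) isOpen_interior
        (hcont.mono interior_subset) continuousOn_const
    have hcl := (convex_convexHull ℝ (T : Set (E d))).closure_interior_eq_closure_of_nonempty_interior
      (M.interior_hull_nonempty hT)
    exact hint.of_subset_closure hcont continuousOn_const interior_subset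
      (by rw [hcl]; exact subset_closure)
  funext x
  by_cases hx : x ∈ Ω
  · have hx' : x ∈ closure Ω := subset_closure hx
    rw [M.closure_eq] at hx'
    simp only [mem_iUnion, exists_prop] at hx'
    obtain ⟨T, hT, hxT⟩ := hx'
    exact hin T hT x hxT
  · exact hv.2 x hx

instance (k : ℕ) : FiniteDimensional ℝ (M.piecewisePoly k) := by
  classical
  let P := MvPolynomial.restrictTotalDegree (Fin d) ℝ k
  let cell : E d → Option M.cells := fun x =>
    if h : ∃ T : M.cells, x ∈ hull (T : Finset (E d)) then some h.choose else none
  let Φ : (M.cells → P) →ₗ[ℝ] (E d → ℝ) :=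
    { toFun := fun q x => (cell x).elim 0 fun T => MvPolynomial.eval (fun i => x i) (q T).1
      map_add' := fun p q => by
        funext x
        simp only [Pi.add_apply]
        rcases cell x with _ | T <;> simp
      map_smul' := fun c q => by
        funext x
        simp only [Pi.smul_apply, RingHom.id_apply]
        rcases cell x with _ | T <;> simp }
  refine Submodule.finiteDimensional_of_le (S₂ := LinearMap.range Φ) ?_
  intro v hv
  have h1 := hv.1
  choose! q hq hq' using h1
  refine ⟨fun T => ⟨q T, (MvPolynomial.mem_restrictTotalDegree _ _ _).2 (hq T T.2)⟩, ?_⟩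
  funext x
  by_cases h : ∃ T : M.cells, x ∈ hull (T : Finset (E d))
  · have hc : cell x = some h.choose := dif_pos h
    change (cell x).elim 0 _ = _
    rw [hc]
    exact (hq' _ h.choose.2 x h.choose_spec).symm
  · have hc : cell x = none := dif_neg h
    change (cell x).elim 0 _ = _
    rw [hc]
    refine (hv.2 x fun hx => h ?_).symm
    have hx' : x ∈ closure Ω := subset_closure hx
    rw [M.closure_eq] at hx'
    simp only [mem_iUnion, exists_prop] at hx'
    obtain ⟨T, hT, hxT⟩ := hx'
    exact ⟨⟨T, hT⟩, hxT⟩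

theorem exists_laplacian (w : M.V0) :
    ∃ z : M.V0, ∀ v : M.V0, l2 Ω (-z : M.V0) v = gradInner Ω w v := by
  let B : M.V0 →ₗ[ℝ] M.V0 →ₗ[ℝ] ℝ := LinearMap.mk₂ ℝ (fun z v => l2 Ω z v)
    (fun a b c => by
      simp only [l2, Submodule.coe_add, Pi.add_apply, add_mul]
      exact integral_add (integrable_l2 c.2 a.2) (integrable_l2 c.2 b.2))
    (fun r a c => by
      simp only [l2, Submodule.coe_smul, Pi.smul_apply, smul_eq_mul, mul_assoc]
      exact integral_const_mul _ _)
    (fun a b c => by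
      simp only [l2, Submodule.coe_add, Pi.add_apply, mul_add]
      exact integral_add (integrable_l2 b.2 a.2) (integrable_l2 c.2 a.2))
    (fun r a c => by
      simp only [l2, Submodule.coe_smul, Pi.smul_apply, smul_eq_mul, mul_left_comm _ r]
      exact integral_const_mul _ _)
  have hadd : ∀ (a b : M.V0) (r : ℝ),
      gradInner Ω w (a + r • b : M.V0) = gradInner Ω w a + r * gradInner Ω w b := by
    intro a b r
    simp only [gradInner]
    rw [← integral_const_mul, ← integral_add (integrable_gradInner a.2 w.2)
      ((integrable_gradInner b.2 w.2).const_mul r)]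
    refine integral_congr_ae ?_
    filter_upwards [gradient_add_smul a.2 b.2 r] with x hx
    change inner ℝ _ (gradient ((a : E d → ℝ) + r • (b : E d → ℝ)) x) = _
    rw [hx, inner_add_right, inner_smul_right]
  have h0 : gradInner Ω w (0 : M.V0) = 0 := by
    have := hadd 0 0 1
    simp only [smul_zero, add_zero, one_mul] at this
    linarith
  let f : M.V0 →ₗ[ℝ] ℝ :=
    { toFun := fun v => gradInner Ω w v
      map_add' := fun a b => by simpa using hadd a b 1
      map_smul' := fun r a => by
        have := hadd 0 a r
        rw [h0] at this
        simpa using this }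
  have hinj : Function.Injective B := by
    rw [← LinearMap.ker_eq_bot, LinearMap.ker_eq_bot']
    intro z hz
    have : l2 Ω z z = 0 := by
      have := congrArg (fun g => g z) hz
      simpa [B] using this
    exact Subtype.ext (eq_zero_of_l2_self z.2 this)
  have hsurj : Function.Surjective B :=
    (LinearMap.injective_iff_surjective_of_finrank_eq_finrank
      (Subspace.dual_finrank_eq (K := ℝ) (V := M.V0)).symm).1 hinj
  obtain ⟨z, hz⟩ := hsurj f
  refine ⟨-z, fun v => ?_⟩
  rw [neg_neg]
  exact congrArg (fun g => g v) hz

/-- The discrete Laplacian `Δ_h : V_0 → V_0`, `(-Δ_h w, v)_Ω = (∇w, ∇v)_Ω` for all `v ∈ V_0`. -/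
def laplacian (w : M.V0) : M.V0 := (M.exists_laplacian w).choose

theorem laplacian_spec (w v : M.V0) : l2 Ω (-M.laplacian w : M.V0) v = gradInner Ω w v :=
  (M.exists_laplacian w).choose_spec v

/-- `‖v‖²_{R_0^{-1}} = ⟨R_0^{-1} v, v⟩`, where
`⟨R_0^{-1} u, v⟩ = (λ u - Δ_h u, λ v - Δ_h v)_Ω` for `u, v ∈ V_0`. -/
def normSqR0 (lam : ℝ) (v : M.V0) : ℝ :=
  l2 Ω (lam • v - M.laplacian v : M.V0) (lam • v - M.laplacian v : M.V0)

/-- `p = I_h v` is the nodal interpolant of `v`. -/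
def IsNodalInterpolant (v : E d → ℝ) (p : M.V0) : Prop :=
  ∀ x ∈ M.nodes, (p : E d → ℝ) x = v x

end Mesh

/-! ### Domains of averaging and layouts of the nodes -/

/-- The domains of averaging attached to a `j`-dimensional simplex: a point, given by its
barycentric coordinates, or the whole simplex. -/
inductive RefDomain (j : ℕ) where
  | point (w : Fin (j + 1) → ℝ) : RefDomain j
  | whole : RefDomain j

namespace RefDomain

variable {j : ℕ} {F : Type*} [AddCommGroup F] [Module ℝ F]

/-- The domain in the simplex with vertices `p 0, …, p j`. -/
def carrier (r : RefDomain j) (p : Fin (j + 1) → F) : Set F :=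
  match r with
  | point w => {∑ i, w i • p i}
  | whole => convexHull ℝ (range p)

/-- The integral average of `f` over the domain, taken in the simplex with vertices
`p 0, …, p j`. (The average over a nondegenerate simplex is computed in the affine parametrization
by `{s | 0 ≤ s, s_1 + … + s_j ≤ 1}`, which has constant Jacobian; the average over a point is the
value.) -/
def average (r : RefDomain j) (p : Fin (j + 1) → F) (f : F → ℝ) : ℝ :=
  match r with
  | point w => f (∑ i, w i • p i)
  | whole => ⨍ s in {s : Fin j → ℝ | (∀ i, 0 ≤ s i) ∧ ∑ i, s i ≤ 1},
      f (p 0 + ∑ i, s i • (p i.succ - p 0))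

end RefDomain

/-- The vertices `0, e_1, …, e_j` of the reference simplex in `ℝ^j`. -/
def refVertex (j : ℕ) : Fin (j + 1) → (Fin j → ℝ) := Fin.cons 0 fun i => Pi.single i 1

/-- The (relative) boundary of the reference simplex. -/
def refBoundary (j : ℕ) : Set (Fin j → ℝ) :=
  {x | (∀ i, 0 ≤ x i) ∧ ∑ i, x i ≤ 1 ∧ ((∃ i, x i = 0) ∨ ∑ i, x i = 1)}

/-- The element carries degrees of freedom of derivative order `m` on its `j`-dimensional
subsimplices: values (`m = 0`) on all subsimplices; first derivatives (`m = 1`) at the vertices and,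
if `d = 3`, on the edges; second derivatives (`m = 2`) at the vertices if `d = 3`. -/
def IsDofDim (d m j : ℕ) : Prop := (m = 0 ∧ j ≤ d) ∨ (1 ≤ m ∧ m + j + 1 ≤ d)

/-- A node layout for the `𝒫_k`-Hermite (`d = 2`) or `𝒫_k`-Argyris (`d = 3`) element: the finite
sets `nodes m j` of domains of the degrees of freedom of derivative order `m` attached to a
`j`-dimensional subsimplex, in barycentric coordinates. The layout is unisolvent: after the degrees
of freedom on lower dimensional subsimplices, which fix the derivatives of order `≤ d - m - j` on
the boundary of the subsimplex, those in `nodes m j` fix exactly the remaining freedom. -/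
structure NodeLayout (d k : ℕ) where
  nodes : (m j : ℕ) → Finset (RefDomain j)
  point_mem : ∀ (m j : ℕ) (w : Fin (j + 1) → ℝ), RefDomain.point w ∈ nodes m j →
    (∀ i, 0 < w i) ∧ ∑ i, w i = 1
  unisolvent : ∀ m j : ℕ, IsDofDim d m j → ∀ c : RefDomain j → ℝ,
    ∃! q : MvPolynomial (Fin j) ℝ, q.totalDegree ≤ k - m ∧
      (∀ i : ℕ, i + m + j ≤ d → ∀ x ∈ refBoundary j,
        iteratedFDeriv ℝ i (fun y : Fin j → ℝ => MvPolynomial.eval y q) x = 0) ∧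
      ∀ r ∈ nodes m j, r.average (refVertex j) (fun y => MvPolynomial.eval y q) = c r

/-! ### Degrees of freedom -/

/-- A degree of freedom `N(φ) = ⨍_D ∇^m φ (t_1, …, t_m)`: the (ordered) vertices of the subsimplex
to which it is attached, the domain `D`, the order `m` and the directions `t_1, …, t_m`. -/
structure Dof (d : ℕ) where
  dim : ℕ
  vtx : Fin (dim + 1) → E d
  dom : RefDomain dim
  order : ℕ
  dir : Fin order → E d

namespace Dof

open Classical in
/-- The subsimplex to which the degree of freedom is attached. -/
def cell (a : Dof d) : Finset (E d) := Finset.univ.image a.vtx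

/-- The domain `D`. -/
def domain (a : Dof d) : Set (E d) := a.dom.carrier a.vtx

/-- `N(v|_T) = ⨍_D ∇^m (v|_T) (t_1, …, t_m)`. -/
def evalOn (a : Dof d) (T : Finset (E d)) (v : E d → ℝ) : ℝ :=
  a.dom.average a.vtx fun y => iteratedFDerivWithin ℝ a.order v (hull T) y a.dir

end Dof

/-- The values that the (normal) derivative `∇^m v` of a function `v` vanishing on `∂Ω` can take on
the subsimplex `s`: symmetric `m`-linear forms which vanish as soon as one argument is tangential to
`s`, and which vanish on the tangent vectors of every boundary face containing `s`. -/
def Mesh.admissible (M : Mesh Ω) (s : Finset (E d)) (m : ℕ) :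
    Set (ContinuousMultilinearMap ℝ (fun _ : Fin m => E d) ℝ) :=
  {S | (∀ (e : Equiv.Perm (Fin m)) (t : Fin m → E d), S (t ∘ e) = S t) ∧
    (∀ t : Fin m → E d, (∃ i, t i ∈ vectorSpan ℝ (s : Set (E d))) → S t = 0) ∧
    ∀ F ∈ M.boundaryFacets, s ⊆ F →
      ∀ t : Fin m → E d, (∀ i, t i ∈ vectorSpan ℝ (F : Set (E d))) → S t = 0}

open Classical in
/-- The degrees of freedom of `V_h` with node layout `L`, in an arbitrary order, and the nodal basis
of `V_h`. The vertices of each subsimplex are ordered by a numbering of the nodes. The directions of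
the derivatives are unit vectors normal to the subsimplex; on each domain they are well-conditioned
with constant `κ` on the derivatives which are compatible with the boundary condition (e.g. the
derivatives in the directions of an orthonormal frame, in the interior). -/
structure DofSystem (M : Mesh Ω) {k : ℕ} (L : NodeLayout d k) (κ : ℝ) where
  N : ℕ
  dof : Fin N → Dof d
  num : E d → ℕ
  num_inj : InjOn num M.nodes
  valid : ∀ a, (dof a).cell ∈ M.complex.faces ∧ StrictMono (num ∘ (dof a).vtx) ∧
    IsDofDim d (dof a).order (dof a).dim ∧
    (dof a).dom ∈ L.nodes (dof a).order (dof a).dim ∧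
    ∀ i, ‖(dof a).dir i‖ = 1 ∧
      ∀ y ∈ vectorSpan ℝ ((dof a).cell : Set (E d)), inner ℝ ((dof a).dir i) y = 0
  complete : ∀ m j : ℕ, IsDofDim d m j → ∀ p : Fin (j + 1) → E d, StrictMono (num ∘ p) →
    Finset.univ.image p ∈ M.complex.faces → ∀ r ∈ L.nodes m j,
      ∃ A : Finset (Fin m → E d), (∀ t ∈ A, ∃ a, dof a = ⟨j, p, r, m, t⟩) ∧
        ∀ S ∈ M.admissible (Finset.univ.image p) m, κ * ‖S‖ ^ 2 ≤ ∑ t ∈ A, (S t) ^ 2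
  basis : Module.Basis (Fin N) ℝ (M.Vh k)
  dual : ∀ a b, ∀ T ∈ M.cells, (dof b).cell ⊆ T →
    (dof b).evalOn T (basis a : E d → ℝ) = if a = b then 1 else 0

/-- The unit outer normal vector of the convex set `Ω` on the part `D` of its boundary. -/
def outerNormal (Ω D : Set (E d)) : E d :=
  Classical.epsilon fun n => ‖n‖ = 1 ∧ ∀ x ∈ D, ∀ y ∈ Ω, inner ℝ (y - x) n ≤ 0

namespace DofSystem

variable {M : Mesh Ω} {k : ℕ} {L : NodeLayout d k} {κ : ℝ} (S : DofSystem M L κ)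

open Classical in
/-- The cells constituting `ω_α`, i.e. those whose interior meets the support of `φ_α`. -/
def omega (a : Fin S.N) : Finset (Finset (E d)) :=
  M.cells.filter fun T => (interior (hull T) ∩ tsupport (S.basis a : E d → ℝ)).Nonempty

open Classical in
/-- The contribution of the cell `T` to `N_α(Π_0 p)`: if `D_α ⊂ ∂Ω` and `k_α = 1`, this is
`⨍_{D_α} ∂_n(p|_T) (n · t_α)`, and `N_α(p|_T)` otherwise. -/
def localValue (p : E d → ℝ) (a : Fin S.N) (T : Finset (E d)) : ℝ :=
  if h : (S.dof a).domain ⊆ frontier Ω ∧ (S.dof a).order = 1 then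
    (S.dof a).dom.average (S.dof a).vtx fun y =>
      fderivWithin ℝ p (hull T) y (outerNormal Ω (S.dof a).domain) *
        inner ℝ (outerNormal Ω (S.dof a).domain) ((S.dof a).dir ⟨0, by omega⟩)
  else (S.dof a).evalOn T p

/-- The transfer operator `Π_0 : V_0 → V_h`, given by the values
`N_α(Π_0 p) = (#ω_α)⁻¹ ∑_{T ⊂ ω_α} …` of the degrees of freedom. -/
def transfer (p : M.V0) : M.Vh k :=
  ∑ a, (((S.omega a).card : ℝ)⁻¹ * ∑ T ∈ S.omega a, S.localValue p a T) • S.basis a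

/-- The matrix of `A_{λ,h}` in the nodal basis. -/
def stiffness (lam : ℝ) : Matrix (Fin S.N) (Fin S.N) ℝ :=
  Matrix.of fun i j => M.inner_lam lam (S.basis j) (S.basis i)

end DofSystem

/-! ### The symmetric Gauss-Seidel smoother -/

/-- The Gauss-Seidel smoother `R = (D + L)⁻¹` of a matrix `A` with diagonal part `D` and strictly
lower triangular part `L`. -/
def gaussSeidel {N : ℕ} (A : Matrix (Fin N) (Fin N) ℝ) : Matrix (Fin N) (Fin N) ℝ :=
  (Matrix.of fun i j => if j ≤ i then A i j else 0)⁻¹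

/-- The symmetric Gauss-Seidel smoother `R̄`, determined by `I - R̄ A = (I - Rᵀ A) (I - R A)`. -/
def symGaussSeidel {N : ℕ} (A : Matrix (Fin N) (Fin N) ℝ) : Matrix (Fin N) (Fin N) ℝ :=
  (gaussSeidel A).transpose + gaussSeidel A - (gaussSeidel A).transpose * A * gaussSeidel A

theorem one_sub_symGaussSeidel_mul {N : ℕ} (A : Matrix (Fin N) (Fin N) ℝ) :
    1 - symGaussSeidel A * A =
      (1 - (gaussSeidel A).transpose * A) * (1 - gaussSeidel A * A) := by
  unfold symGaussSeidel
  noncomm_ring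

/-- `‖v‖²_{R̄_h^{-1}} = ⟨R̄_h^{-1} v, v⟩`, where `R̄_h` is the symmetric Gauss-Seidel smoother for
`A_{λ,h}` in the nodal basis. -/
def DofSystem.normSqRbar {M : Mesh Ω} {k : ℕ} {L : NodeLayout d k} {κ : ℝ} (S : DofSystem M L κ)
    (lam : ℝ) (v : M.Vh k) : ℝ :=
  S.basis.repr v ⬝ᵥ ((symGaussSeidel (S.stiffness lam))⁻¹.mulVec (S.basis.repr v))

end FEM
end

noncomputable section

namespace FEM

/-! ### Separating families of functionals -/

/-! Let v0 be the nodal interpolant of v, and let the fine part be v - Π_0 v0. Both norms are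
estimated cell by cell through a bound e_T for |v - v0| on the cell T. Since v - v0 vanishes at the
vertices, it is controlled by h_T² times the second derivatives of v, and also by twice the sup norm
of v. Norm equivalence on polynomials turns this into h_T^d (h_T^{-4} + λ²) e_T² ≤ C · (energy of v
on T); see `exists_interpolation_le`.

Fine part. If B is the lower triangle of A including its diagonal D, then R̄⁻¹ = B D⁻¹ Bᵀ. The
smoother norm is therefore the sum over i of (v_{≥i}, φ_i)² / (φ_i, φ_i), where v_{≥i} is the tail
of the basis expansion (`dotProduct_inv_symGaussSeidel`). As φ_i lives only on the cells containing
its subsimplex, a local Cauchy–Schwarz inequality leaves energies of tails on single cells, and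
these are bounded by the degrees of freedom there. Passing to a tail only deletes degrees of
freedom, so the ordering is immaterial (`exists_normSqRbar_le`). The degrees of freedom of v - Π_0
v0 are averages of derivatives of v - v0, also on the boundary, because the gradient of v is normal
there. Inverse estimates bound them by e_T on neighboring cells (`exists_dofBound_transfer`), whose
sizes are comparable because the cells around a vertex are connected through shared edges
(`Mesh.exists_hdiam_comparable`).

The bound of a function by its degrees of freedom (`exists_stableOn`) must be uniform although the
directions t_i vary from mesh to mesh. It is proved by induction on the dimension of the
subsimplices. A normal derivative on a j-simplex pulls back to a polynomial on the reference
simplex, which unisolvence controls by its averages over the layout and by boundary derivatives. The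
latter are derivatives of v on (j - 1)-faces, already bounded. Tangential derivatives follow from
lower order by a Markov inequality.

Coarse part (`exists_normSqR0_le`). The term λ v0 is covered by the interpolation estimate. For z =
Δ_h v0 one has ‖z‖² = -(∇v0, ∇z), and no elliptic regularity is needed: from ∇v0 · ∇w subtract the
divergence of the piecewise linear interpolant of w ∇v. This interpolant is well defined because v
is C¹ at the vertices, and its divergence has zero integral because w vanishes on the boundary. What
remains on T is the sum over the vertices x of w(x) ∇λ_x · (∇v0 - ∇v(x)), with λ_x the barycentric
coordinates (`Mesh.exists_flux`). It is of size h_T^{-2} e_T max |w|, and Young's inequality absorbs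
‖w‖² (`exists_gradInner_le`). -/

theorem exists_bound_of_separating {V ι : Type*} [AddCommGroup V] [Module ℝ V]
    [FiniteDimensional ℝ V] (l : ι → Module.Dual ℝ V) (B : ι → ℝ)
    (hsep : ∀ v, (∀ s, l s v = 0) → v = 0) (φ : Module.Dual ℝ V) :
    ∃ C : ℝ, 0 ≤ C ∧ ∀ v ε, 0 ≤ ε → (∀ s, |l s v| ≤ B s * ε) → |φ v| ≤ C * ε := by
  -- Functionals without a common zero span the dual, so `φ` is a finite combination of them. The
  -- family may be infinite and `B` unbounded, since only finitely many members enter.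
  have htop : Submodule.span ℝ (range l) = ⊤ := by
    have h1 : (Submodule.span ℝ (range l)).dualCoannihilator = ⊥ := by
      rw [eq_bot_iff]
      intro v hv
      rw [Submodule.mem_dualCoannihilator] at hv
      exact hsep v fun s => hv _ (Submodule.subset_span ⟨s, rfl⟩)
    rw [← Subspace.dualCoannihilator_dualAnnihilator_eq (W := Submodule.span ℝ (range l)), h1]
    simp
  have hφ : φ ∈ Submodule.span ℝ (range l) := htop ▸ Submodule.mem_top
  induction hφ using Submodule.span_induction with
  | mem x hx =>
    obtain ⟨s, rfl⟩ := hx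
    refine ⟨|B s|, abs_nonneg _, fun v ε hε h => (h s).trans ?_⟩
    gcongr
    exact le_abs_self _
  | zero => exact ⟨0, le_rfl, fun v ε hε _ => by simp⟩
  | add x y _ _ hx hy =>
    obtain ⟨C, hC, h⟩ := hx
    obtain ⟨C', hC', h'⟩ := hy
    refine ⟨C + C', by positivity, fun v ε hε hv => ?_⟩
    have := abs_add_le (x v) (y v)
    have h1 := h v ε hε hv
    have h2 := h' v ε hε hv
    simp only [LinearMap.add_apply]
    linarith [add_mul C C' ε]
  | smul a x _ hx =>
    obtain ⟨C, hC, h⟩ := hx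
    refine ⟨|a| * C, by positivity, fun v ε hε hv => ?_⟩
    simp only [LinearMap.smul_apply, smul_eq_mul, abs_mul, mul_assoc]
    exact mul_le_mul_of_nonneg_left (h v ε hε hv) (abs_nonneg _)

/-! ### Iterated directional derivatives -/

section DirDeriv

set_option linter.unusedSectionVars false

variable {F F' : Type*} [NormedAddCommGroup F] [NormedSpace ℝ F] [NormedAddCommGroup F']
  [NormedSpace ℝ F']

/-- The iterated directional derivative along a list of directions. -/
def dirDeriv : List F → (F → ℝ) → F → ℝ
  | [], f => f
  | t :: l, f => fun x => fderiv ℝ (dirDeriv l f) x t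

/-- The product of the norms of the entries of a list. -/
def normProd (l : List F) : ℝ := (l.map norm).prod

@[simp] theorem normProd_nil : normProd ([] : List F) = 1 := rfl

@[simp] theorem normProd_cons (t : F) (l : List F) : normProd (t :: l) = ‖t‖ * normProd l := by
  simp [normProd]

theorem normProd_append (l l' : List F) : normProd (l ++ l') = normProd l * normProd l' := by
  simp [normProd]

theorem normProd_nonneg (l : List F) : 0 ≤ normProd l := by
  induction l with
  | nil => simp
  | cons t l ih => rw [normProd_cons]; positivity

theorem dirDeriv_append (l l' : List F) (f : F → ℝ) :
    dirDeriv (l ++ l') f = dirDeriv l (dirDeriv l' f) := by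
  induction l with
  | nil => rfl
  | cons t l ih => simp only [List.cons_append, dirDeriv, ih]

theorem contDiff_dirDeriv {f : F → ℝ} (hf : ContDiff ℝ (⊤ : ℕ∞) f) (l : List F) :
    ContDiff ℝ (⊤ : ℕ∞) (dirDeriv l f) := by
  induction l with
  | nil => exact hf
  | cons t l ih =>
    have : ContDiff ℝ (⊤ : ℕ∞) (fderiv ℝ (dirDeriv l f)) := ih.fderiv_right (by simp)
    exact this.clm_apply contDiff_const

/-- Lists of directions can be appended, permuted and split one entry at a time, which is awkward
for multilinear forms whose arity is part of the type. This is the bridge between the two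
descriptions. -/
theorem iteratedFDeriv_eq_dirDeriv {f : F → ℝ} (hf : ContDiff ℝ (⊤ : ℕ∞) f) (m : ℕ) (x : F)
    (t : Fin m → F) : iteratedFDeriv ℝ m f x t = dirDeriv (List.ofFn t) f x := by
  induction m generalizing x with
  | zero => simp [dirDeriv]
  | succ m ih =>
    rw [iteratedFDeriv_succ_apply_left, List.ofFn_succ]
    simp only [dirDeriv]
    have hd : DifferentiableAt ℝ (iteratedFDeriv ℝ m f) x :=
      (hf.differentiable_iteratedFDeriv (by exact_mod_cast WithTop.coe_lt_top m)) x
    have : dirDeriv (List.ofFn fun i => t i.succ) f =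
        fun y => iteratedFDeriv ℝ m f y (Fin.tail t) := by
      funext y
      rw [ih]
      rfl
    rw [this, fderiv_continuousMultilinear_apply_const_apply hd]

theorem dirDeriv_eq_iteratedFDeriv {f : F → ℝ} (hf : ContDiff ℝ (⊤ : ℕ∞) f) (l : List F) (x : F) :
    dirDeriv l f x = iteratedFDeriv ℝ l.length f x l.get := by
  rw [iteratedFDeriv_eq_dirDeriv hf, List.ofFn_get]

theorem normProd_eq (l : List F) : normProd l = ∏ i : Fin l.length, ‖l.get i‖ := by
  rw [normProd, ← List.prod_ofFn (f := fun i => ‖l.get i‖)]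
  congr 1
  conv_lhs => rw [← List.ofFn_get l]
  rw [List.map_ofFn]
  rfl

theorem abs_dirDeriv_le {f : F → ℝ} (hf : ContDiff ℝ (⊤ : ℕ∞) f) (l : List F) (x : F) :
    |dirDeriv l f x| ≤ ‖iteratedFDeriv ℝ l.length f x‖ * normProd l := by
  rw [dirDeriv_eq_iteratedFDeriv hf, normProd_eq, ← Real.norm_eq_abs]
  exact (iteratedFDeriv ℝ l.length f x).le_opNorm l.get

/-- Adjacent transpositions suffice, and each of them is the symmetry of a second derivative. -/
theorem dirDeriv_perm {f : F → ℝ} (hf : ContDiff ℝ (⊤ : ℕ∞) f) {l l' : List F} (h : l.Perm l')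
    (x : F) : dirDeriv l f x = dirDeriv l' f x := by
  induction h generalizing x with
  | nil => rfl
  | cons t _ ih =>
    simp only [dirDeriv]
    rw [show dirDeriv _ f = dirDeriv _ f from funext ih]
  | swap s t l =>
    have hg := contDiff_dirDeriv hf l
    set g := dirDeriv l f with hgdef
    have hd : ∀ u : F, fderiv ℝ (fun y => fderiv ℝ g y u) x =
        (fderiv ℝ (fderiv ℝ g) x).flip u := by
      intro u
      have hd : DifferentiableAt ℝ (fderiv ℝ g) x :=
        ((hg.fderiv_right (m := 1)
        (by rw [one_add_one_eq_two]; exact WithTop.coe_le_coe.2 (le_top : (2 : ℕ∞) ≤ ⊤))).differentiable (by simp)) x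
      ext s
      rw [fderiv_clm_apply hd (differentiableAt_const _)]
      simp
    have hs : IsSymmSndFDerivAt ℝ g x :=
      (hg.contDiffAt).isSymmSndFDerivAt (by simp; exact WithTop.coe_le_coe.2 (le_top : (2 : ℕ∞) ≤ ⊤))
    change fderiv ℝ (fun y => fderiv ℝ g y s) x t = fderiv ℝ (fun y => fderiv ℝ g y t) x s
    rw [hd, hd]
    exact hs _ _
  | trans _ _ ih ih' => exact (ih x).trans (ih' x)

theorem dirDeriv_add {f g : F → ℝ} (hf : ContDiff ℝ (⊤ : ℕ∞) f) (hg : ContDiff ℝ (⊤ : ℕ∞) g)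
    (l : List F) : dirDeriv l (f + g) = dirDeriv l f + dirDeriv l g := by
  induction l with
  | nil => rfl
  | cons t l ih =>
    funext x
    simp only [dirDeriv, ih, Pi.add_apply]
    rw [fderiv_add ((contDiff_dirDeriv hf l).differentiable (by simp) x)
      ((contDiff_dirDeriv hg l).differentiable (by simp) x)]
    rfl

theorem dirDeriv_smul {f : F → ℝ} (hf : ContDiff ℝ (⊤ : ℕ∞) f) (c : ℝ)
    (l : List F) : dirDeriv l (c • f) = c • dirDeriv l f := by
  induction l with
  | nil => rfl
  | cons t l ih =>
    funext x
    simp only [dirDeriv, ih, Pi.smul_apply]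
    rw [fderiv_const_smul ((contDiff_dirDeriv hf l).differentiable (by simp) x)]
    rfl

theorem dirDeriv_comp_affine {f : F → ℝ} (hf : ContDiff ℝ (⊤ : ℕ∞) f) (A : F' →L[ℝ] F) (b : F)
    (l : List F') :
    dirDeriv l (fun x => f (A x + b)) = fun x => dirDeriv (l.map A) f (A x + b) := by
  induction l with
  | nil => rfl
  | cons t l ih =>
    funext x
    simp only [dirDeriv, ih, List.map_cons]
    have h1 : HasFDerivAt (fun x => A x + b) A x := A.hasFDerivAt.add_const b
    have h2 : HasFDerivAt (dirDeriv (l.map A) f) (fderiv ℝ (dirDeriv (l.map A) f) (A x + b))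
        (A x + b) := ((contDiff_dirDeriv hf _).differentiable (by simp) _).hasFDerivAt
    have := (h2.comp x h1).fderiv
    simp only [Function.comp_def] at this
    rw [this]
    rfl

end DirDeriv

/-! ### Polynomial functions -/

section Poly

variable {F F' : Type*} [NormedAddCommGroup F] [NormedSpace ℝ F] [NormedAddCommGroup F']
  [NormedSpace ℝ F'] {n n' : ℕ}

/-- The polynomials of total degree at most `k`. -/
abbrev PolyLe (n k : ℕ) : Submodule ℝ (MvPolynomial (Fin n) ℝ) :=
  MvPolynomial.restrictTotalDegree (Fin n) ℝ k

theorem mem_polyLe {k : ℕ} {q : MvPolynomial (Fin n) ℝ} :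
    q ∈ PolyLe n k ↔ q.totalDegree ≤ k :=
  MvPolynomial.mem_restrictTotalDegree _ _ _

/-- The polynomial function on a normed space with linear coordinates `c`. -/
def polyFun (c : F →L[ℝ] (Fin n → ℝ)) : MvPolynomial (Fin n) ℝ →ₗ[ℝ] (F → ℝ) where
  toFun q x := MvPolynomial.eval (c x) q
  map_add' p q := by ext; simp
  map_smul' a q := by ext; simp

theorem polyFun_apply (c : F →L[ℝ] (Fin n → ℝ)) (q : MvPolynomial (Fin n) ℝ) (x : F) :
    polyFun c q x = MvPolynomial.eval (c x) q := rfl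

theorem contDiff_polyFun (c : F →L[ℝ] (Fin n → ℝ)) (q : MvPolynomial (Fin n) ℝ) :
    ContDiff ℝ (⊤ : ℕ∞) (polyFun c q) := by
  induction q using MvPolynomial.induction_on with
  | C a =>
    have : polyFun c (MvPolynomial.C a) = fun _ => a := by ext; simp [polyFun_apply]
    rw [this]; exact contDiff_const
  | add p q hp hq => rw [map_add]; exact hp.add hq
  | mul_X p i hp =>
    have h : polyFun c (p * MvPolynomial.X i) = fun x => polyFun c p x * c x i := by
      ext; simp [polyFun_apply]
    rw [h]
    exact hp.mul ((ContinuousLinearMap.proj (R := ℝ) i).comp c).contDiff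

theorem fderiv_polyFun (c : F →L[ℝ] (Fin n → ℝ)) (q : MvPolynomial (Fin n) ℝ) (x t : F) :
    fderiv ℝ (polyFun c q) x t =
      polyFun c (∑ i, c t i • MvPolynomial.pderiv i q) x := by
  induction q using MvPolynomial.induction_on with
  | C a =>
    have : polyFun c (MvPolynomial.C a) = fun _ => a := by ext; simp [polyFun_apply]
    rw [this]; simp [polyFun_apply]
  | add p q hp hq =>
    rw [map_add, fderiv_add ((contDiff_polyFun c p).differentiable (by simp) x)
      ((contDiff_polyFun c q).differentiable (by simp) x)]
    simp only [_root_.add_apply, hp, hq, map_add, smul_add,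
      Finset.sum_add_distrib, Pi.add_apply]
  | mul_X p i hp =>
    have h : polyFun c (p * MvPolynomial.X i) =
        fun x => polyFun c p x * ((ContinuousLinearMap.proj (R := ℝ) i).comp c) x := by
      ext; simp [polyFun_apply]
    rw [h, fderiv_fun_mul ((contDiff_polyFun c p).differentiable (by simp) x)
      (ContinuousLinearMap.differentiableAt _), ContinuousLinearMap.fderiv]
    simp only [_root_.add_apply, _root_.smul_apply, hp,
      ContinuousLinearMap.comp_apply, ContinuousLinearMap.proj_apply, smul_eq_mul,
      MvPolynomial.pderiv_mul, MvPolynomial.pderiv_X, polyFun_apply, map_sum, map_add,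
      MvPolynomial.smul_eval, map_mul, MvPolynomial.eval_X, mul_add, Finset.sum_add_distrib]
    rw [add_comm, Finset.mul_sum]
    congr 1
    · exact Finset.sum_congr rfl fun j _ => by ring
    · rw [Finset.sum_eq_single i]
      · simp; ring
      · intro j _ hj; simp [hj]
      · simp

theorem polyLe_map_mem {W : Type*} [AddCommGroup W] [Module ℝ W] {k : ℕ}
    (Φ : MvPolynomial (Fin n) ℝ →ₗ[ℝ] W) (U : Submodule ℝ W)
    (h : ∀ s : Fin n →₀ ℕ, (s.sum fun _ e => e) ≤ k → Φ (MvPolynomial.monomial s 1) ∈ U)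
    {q : MvPolynomial (Fin n) ℝ} (hq : q ∈ PolyLe n k) : Φ q ∈ U := by
  rw [q.as_sum, map_sum]
  refine Submodule.sum_mem _ fun s hs => ?_
  have h1 : MvPolynomial.monomial s (q.coeff s) = q.coeff s • MvPolynomial.monomial s (1 : ℝ) := by
    simp [MvPolynomial.smul_monomial]
  rw [h1, map_smul]
  exact U.smul_mem _ (h s ((MvPolynomial.le_totalDegree hs).trans (mem_polyLe.1 hq)))

theorem pderiv_mem_polyLe {k : ℕ} {q : MvPolynomial (Fin n) ℝ} (hq : q ∈ PolyLe n k) (i : Fin n) :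
    MvPolynomial.pderiv i q ∈ PolyLe n (k - 1) := by
  refine polyLe_map_mem (MvPolynomial.pderiv i : Derivation ℝ _ _).toLinearMap _ (fun s hs => ?_) hq
  change MvPolynomial.pderiv i (MvPolynomial.monomial s 1) ∈ _
  rw [MvPolynomial.pderiv_monomial, mem_polyLe]
  by_cases h0 : s i = 0
  · simp [h0]
  refine (MvPolynomial.totalDegree_monomial_le _ _).trans ?_
  have h1 : s = (s - Finsupp.single i 1) + Finsupp.single i 1 := by
    ext j
    by_cases hj : j = i
    · subst hj; simp; omega
    · simp [Ne.symm hj]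
  have h2 := congrArg (fun u : Fin n →₀ ℕ => u.sum fun _ e => e) h1
  rw [Finsupp.sum_add_index' (by simp) (by simp), Finsupp.sum_single_index rfl] at h2
  change (Finsupp.sum _ fun _ e => e) ≤ _
  omega

theorem dirDeriv_polyFun (c : F →L[ℝ] (Fin n → ℝ)) {k : ℕ} {q : MvPolynomial (Fin n) ℝ}
    (hq : q ∈ PolyLe n k) (l : List F) :
    ∃ p ∈ PolyLe n (k - l.length), dirDeriv l (polyFun c q) = polyFun c p := by
  induction l with
  | nil => exact ⟨q, hq, rfl⟩
  | cons t l ih =>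
    obtain ⟨p, hp, h⟩ := ih
    refine ⟨∑ i, c t i • MvPolynomial.pderiv i p, Submodule.sum_mem _ fun i _ =>
      Submodule.smul_mem _ _ ?_, ?_⟩
    · have := pderiv_mem_polyLe hp i
      rwa [Nat.sub_sub] at this
    · funext x
      simp only [dirDeriv, h]
      exact fderiv_polyFun c p x t

theorem polyLe_mono {k k' : ℕ} (h : k ≤ k') : PolyLe n k ≤ PolyLe n k' := fun q hq => by
  rw [mem_polyLe] at *
  omega

theorem affine_coord_poly (c : F →L[ℝ] (Fin n → ℝ)) (e : (Fin n → ℝ) →L[ℝ] F)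
    (he : ∀ x, e (c x) = x) (α : F →L[ℝ] ℝ) (b : ℝ) :
    ∃ p ∈ PolyLe n 1, ∀ x, polyFun c p x = α x + b := by
  refine ⟨∑ i, α (e (Pi.single i 1)) • MvPolynomial.X i + MvPolynomial.C b, ?_, fun x => ?_⟩
  · refine Submodule.add_mem _ (Submodule.sum_mem _ fun i _ => Submodule.smul_mem _ _ ?_) ?_
    · rw [mem_polyLe, MvPolynomial.totalDegree_X]
    · rw [mem_polyLe, MvPolynomial.totalDegree_C]; omega
  · have hx : x = ∑ i, c x i • e (Pi.single i 1) := by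
      conv_lhs => rw [← he x, ← Finset.univ_sum_single (c x), map_sum]
      refine Finset.sum_congr rfl fun i _ => ?_
      rw [← map_smul, ← Pi.single_smul]
      simp
    have : α x = ∑ i, c x i * α (e (Pi.single i 1)) := by
      conv_lhs => rw [hx, map_sum]
      simp
    simp [polyFun_apply, this, mul_comm]

/-- Because `e` recovers a point from its coordinates `c'`, every affine function is a polynomial of
degree at most one in `c'`. Substituting such polynomials does not raise the degree. -/
theorem polyFun_comp_affine (c : F →L[ℝ] (Fin n → ℝ)) (c' : F' →L[ℝ] (Fin n' → ℝ))
    (e : (Fin n' → ℝ) →L[ℝ] F') (he : ∀ x, e (c' x) = x) (A : F' →L[ℝ] F) (b : F) {k : ℕ}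
    {q : MvPolynomial (Fin n) ℝ} (hq : q ∈ PolyLe n k) :
    ∃ p ∈ PolyLe n' k, ∀ x, polyFun c q (A x + b) = polyFun c' p x := by
  have h : ∀ i, ∃ p ∈ PolyLe n' 1, ∀ x, polyFun c' p x = c (A x + b) i := by
    intro i
    obtain ⟨p, hp, h⟩ := affine_coord_poly c' e he
      ((ContinuousLinearMap.proj (R := ℝ) i).comp (c.comp A)) (c b i)
    exact ⟨p, hp, fun x => by rw [h]; simp⟩
  choose a ha ha' using h
  refine ⟨MvPolynomial.bind₁ a q, ?_, fun x => ?_⟩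
  · refine polyLe_map_mem (MvPolynomial.bind₁ a).toLinearMap _ (fun s hs => ?_) hq
    change MvPolynomial.bind₁ a (MvPolynomial.monomial s 1) ∈ _
    rw [MvPolynomial.bind₁_monomial, mem_polyLe, map_one, one_mul]
    refine (MvPolynomial.totalDegree_finsetProd _ _).trans (le_trans ?_ hs)
    refine Finset.sum_le_sum fun i _ => (MvPolynomial.totalDegree_pow _ _).trans ?_
    have := mem_polyLe.1 (ha i)
    nlinarith
  · simp only [polyFun_apply] at ha' ⊢
    rw [show MvPolynomial.eval (c' x) = MvPolynomial.eval₂Hom (RingHom.id ℝ) (c' x) from rfl,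
      MvPolynomial.eval₂Hom_bind₁]
    change MvPolynomial.eval _ q = MvPolynomial.eval _ q
    congr 2
    funext i
    exact (ha' i x).symm

end Poly

/-! ### Estimates for polynomials on shape regular sets -/

/-- The coefficients in a fixed basis are functionals to which `exists_bound_of_separating` applies,
and the finitely many basis polynomials have bounded derivatives on a compact set. The inverse,
L²-to-sup, Markov and unisolvence estimates below are all obtained from this. -/
theorem polyLe_bound {F ι : Type*} [NormedAddCommGroup F] [NormedSpace ℝ F] {n k : ℕ}
    (c : F →L[ℝ] (Fin n → ℝ)) (l : ι → Module.Dual ℝ (PolyLe n k)) (B : ι → ℝ)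
    (hsep : ∀ v, (∀ s, l s v = 0) → v = 0) {K : Set F} (hK : IsCompact K) (m : ℕ) :
    ∃ C : ℝ, 0 ≤ C ∧ ∀ (q : PolyLe n k) (ε : ℝ), 0 ≤ ε → (∀ s, |l s q| ≤ B s * ε) →
      ∀ x ∈ K, ‖iteratedFDeriv ℝ m (polyFun c q) x‖ ≤ C * ε := by
  let b := Module.finBasis ℝ (PolyLe n k)
  have h1 := fun i => exists_bound_of_separating l B hsep (b.coord i)
  choose C hC hC' using h1
  have h2 : ∀ i, ∃ D : ℝ, 0 ≤ D ∧ ∀ x ∈ K, ‖iteratedFDeriv ℝ m (polyFun c (b i)) x‖ ≤ D := by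
    intro i
    have hc : Continuous (iteratedFDeriv ℝ m (polyFun c (b i))) :=
      (contDiff_polyFun c _).continuous_iteratedFDeriv (by exact_mod_cast le_top)
    obtain ⟨D, hD⟩ := hK.exists_bound_of_continuousOn hc.continuousOn
    exact ⟨|D|, abs_nonneg _, fun x hx => (hD x hx).trans (le_abs_self _)⟩
  choose D hD hD' using h2
  refine ⟨∑ i, C i * D i, Finset.sum_nonneg fun i _ => mul_nonneg (hC i) (hD i),
    fun q ε hε hq x hx => ?_⟩
  have h3 : polyFun c q = ∑ i, fun y => b.repr q i • polyFun c (b i) y := by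
    have : (q : MvPolynomial (Fin n) ℝ) = ∑ i, b.repr q i • (b i : MvPolynomial (Fin n) ℝ) := by
      conv_lhs => rw [← b.sum_repr q]
      rw [Submodule.coe_sum]
      rfl
    conv_lhs => rw [this, map_sum]
    refine Finset.sum_congr rfl fun i _ => ?_
    rw [map_smul]; rfl
  have hs : ∀ i, ContDiff ℝ (m : ℕ∞) (fun y => b.repr q i • polyFun c (b i) y) := fun i =>
    ((contDiff_polyFun c _).const_smul _).of_le (by exact_mod_cast le_top)
  rw [h3]
  have h4 : iteratedFDeriv ℝ m (∑ i, fun y => b.repr q i • polyFun c (b i) y) x =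
      ∑ i, b.repr q i • iteratedFDeriv ℝ m (polyFun c (b i)) x := by
    rw [iteratedFDeriv_sum_apply fun i _ => (hs i).contDiffAt]
    refine Finset.sum_congr rfl fun i _ => ?_
    exact iteratedFDeriv_const_smul_apply' (a := b.repr q i)
      ((contDiff_polyFun c (b i)).of_le (by exact_mod_cast le_top)).contDiffAt
  rw [h4, Finset.sum_mul]
  refine (norm_sum_le _ _).trans (Finset.sum_le_sum fun i _ => ?_)
  rw [norm_smul, mul_right_comm]
  exact mul_le_mul (hC' i q ε hε hq) (hD' i x hx) (norm_nonneg _) (mul_nonneg (hC i) hε)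

/-! ### Polynomial functions on Euclidean space and their scaling -/

variable {d : ℕ}

/-- The coordinates of `ℝ^d`. -/
abbrev crd (d : ℕ) : E d →L[ℝ] (Fin d → ℝ) :=
  (EuclideanSpace.equiv (Fin d) ℝ).toContinuousLinearMap

abbrev crdInv (d : ℕ) : (Fin d → ℝ) →L[ℝ] E d :=
  (EuclideanSpace.equiv (Fin d) ℝ).symm.toContinuousLinearMap

theorem crdInv_crd (x : E d) : crdInv d (crd d x) = x :=
  (EuclideanSpace.equiv (Fin d) ℝ).symm_apply_apply x

/-- Polynomial functions of degree at most `k` on `ℝ^d`. -/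
def IsPoly (k : ℕ) (f : E d → ℝ) : Prop := ∃ q ∈ PolyLe d k, f = polyFun (crd d) q

namespace IsPoly

theorem contDiff {k : ℕ} {f : E d → ℝ} (hf : IsPoly k f) : ContDiff ℝ (⊤ : ℕ∞) f := by
  obtain ⟨q, -, rfl⟩ := hf
  exact contDiff_polyFun _ _

theorem continuous {k : ℕ} {f : E d → ℝ} (hf : IsPoly k f) : Continuous f := hf.contDiff.continuous

theorem add {k : ℕ} {f g : E d → ℝ} (hf : IsPoly k f) (hg : IsPoly k g) : IsPoly k (f + g) := by
  obtain ⟨q, hq, rfl⟩ := hf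
  obtain ⟨p, hp, rfl⟩ := hg
  exact ⟨q + p, add_mem hq hp, by simp⟩

theorem smul {k : ℕ} {f : E d → ℝ} (hf : IsPoly k f) (a : ℝ) : IsPoly k (a • f) := by
  obtain ⟨q, hq, rfl⟩ := hf
  exact ⟨a • q, Submodule.smul_mem _ _ hq, by simp⟩

theorem sub {k : ℕ} {f g : E d → ℝ} (hf : IsPoly k f) (hg : IsPoly k g) : IsPoly k (f - g) := by
  have := hf.add (hg.smul (-1))
  simpa [sub_eq_add_neg] using this

theorem mono {k k' : ℕ} (h : k ≤ k') {f : E d → ℝ} (hf : IsPoly k f) : IsPoly k' f := by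
  obtain ⟨q, hq, rfl⟩ := hf
  exact ⟨q, polyLe_mono h hq, rfl⟩

theorem dirDeriv {k : ℕ} {f : E d → ℝ} (hf : IsPoly k f) (l : List (E d)) :
    IsPoly (k - l.length) (dirDeriv l f) := by
  obtain ⟨q, hq, rfl⟩ := hf
  exact dirDeriv_polyFun _ hq l

theorem of_affine (α : E d →L[ℝ] ℝ) (b : ℝ) : IsPoly 1 fun x => α x + b := by
  obtain ⟨p, hp, h⟩ := affine_coord_poly (crd d) (crdInv d) crdInv_crd α b
  exact ⟨p, hp, funext fun x => (h x).symm⟩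

theorem comp_affine {k : ℕ} {f : E d → ℝ} (hf : IsPoly k f) (A : E d →L[ℝ] E d) (b : E d) :
    IsPoly k fun x => f (A x + b) := by
  obtain ⟨q, hq, rfl⟩ := hf
  obtain ⟨p, hp, h⟩ := polyFun_comp_affine (crd d) (crd d) (crdInv d) crdInv_crd A b hq
  exact ⟨p, hp, funext h⟩

theorem eq_const {f : E d → ℝ} (hf : IsPoly 0 f) (x y : E d) : f x = f y := by
  obtain ⟨q, hq, rfl⟩ := hf
  rw [mem_polyLe, Nat.le_zero, MvPolynomial.totalDegree_eq_zero_iff_eq_C] at hq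
  rw [hq, polyFun_apply, polyFun_apply]
  simp

theorem exists_affine {f : E d → ℝ} (hf : IsPoly 1 f) :
    ∃ (α : E d →L[ℝ] ℝ) (b : ℝ), ∀ x, f x = α x + b := by
  have hc : ∀ x, fderiv ℝ f x = fderiv ℝ f 0 := by
    intro x
    ext t
    exact (hf.dirDeriv [t]).eq_const x 0
  refine ⟨fderiv ℝ f 0, f 0, fun x => ?_⟩
  have hd := hf.contDiff.differentiable (by simp)
  have hd2 : Differentiable ℝ fun x => f x - fderiv ℝ f 0 x :=
    hd.sub (fderiv ℝ f 0).differentiable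
  have := is_const_of_fderiv_eq_zero (𝕜 := ℝ) hd2 (fun y => by
    rw [fderiv_fun_sub (hd y) (fderiv ℝ f 0).differentiableAt, hc y,
      ContinuousLinearMap.fderiv, sub_self]) x 0
  simp only [map_zero, sub_zero] at this
  linarith

end IsPoly

theorem isPolyOn_iff {k : ℕ} {s : Set (E d)} {v : E d → ℝ} :
    IsPolyOn k s v ↔ ∃ f, IsPoly k f ∧ EqOn v f s := by
  constructor
  · rintro ⟨q, hq, h⟩
    exact ⟨_, ⟨q, mem_polyLe.2 hq, rfl⟩, h⟩
  · rintro ⟨_, ⟨q, hq, rfl⟩, h⟩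
    exact ⟨q, mem_polyLe.1 hq, h⟩

/-- The open set contains a box in coordinates, and a polynomial that vanishes on a product of
infinite sets is zero. -/
theorem polyFun_crd_eq_zero {q : MvPolynomial (Fin d) ℝ} {U : Set (E d)} (hU : IsOpen U)
    (hne : U.Nonempty) (h : ∀ x ∈ U, polyFun (crd d) q x = 0) : q = 0 := by
  obtain ⟨x0, hx0⟩ := hne
  have hc : Continuous (crdInv d) := (crdInv d).continuous
  have hV : IsOpen (crdInv d ⁻¹' U) := hU.preimage hc
  obtain ⟨ε, hε, hb⟩ := Metric.isOpen_iff.1 hV (crd d x0) (by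
    simpa only [mem_preimage, crdInv_crd] using hx0)
  rw [ball_pi _ hε] at hb
  have hinf : ∀ i, (Metric.ball (crd d x0 i) ε : Set ℝ).Infinite := fun i => by
    rw [Real.ball_eq_Ioo]
    exact Ioo_infinite (by linarith)
  refine MvPolynomial.funext_set (s := fun i => (Metric.ball (crd d x0 i) ε : Set ℝ))
    hinf fun x hx => ?_
  rw [map_zero]
  exact h _ (hb hx)

/-- Normalization of a shape regular set: scaling by `h / ρ` about `x₀` takes the unit ball to the
inscribed ball, and the ball of radius `ρ` covers `K`. Comparing two fixed balls keeps the constants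
independent of `K` and `h`. -/
theorem exists_scaled_ball {ρ h : ℝ} (hρ : 0 < ρ) (hh : 0 < h) {K : Set (E d)} {x₀ : E d}
    (hK' : K ⊆ Metric.closedBall x₀ h) {y : E d} (hy : y ∈ K) :
    (h / ρ)⁻¹ • (y - x₀) ∈ Metric.closedBall (0 : E d) ρ ∧
      (h / ρ) • ((h / ρ)⁻¹ • (y - x₀)) + x₀ = y := by
  have hr : 0 < h / ρ := div_pos hh hρ
  refine ⟨?_, by rw [smul_inv_smul₀ hr.ne', sub_add_cancel]⟩
  have := hK' hy
  rw [Metric.mem_closedBall, dist_eq_norm] at this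
  rw [mem_closedBall_zero_iff, norm_smul, norm_inv, Real.norm_of_nonneg hr.le,
    inv_mul_le_iff₀ hr, div_mul_cancel₀ _ hρ.ne']
  exact this

/-- Point values in the unit ball separate polynomials, hence bound all derivatives on the ball of
radius `ρ`. The factor `h ^ m` comes from rescaling. -/
theorem exists_inverse_estimate (d k m : ℕ) {ρ : ℝ} (hρ : 0 < ρ) :
    ∃ C : ℝ, 0 ≤ C ∧ ∀ (K : Set (E d)) (x₀ : E d) (h : ℝ), 0 < h →
      Metric.closedBall x₀ (h / ρ) ⊆ K → K ⊆ Metric.closedBall x₀ h →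
      ∀ f : E d → ℝ, IsPoly k f → ∀ B : ℝ, 0 ≤ B → (∀ y ∈ K, |f y| ≤ B) →
      ∀ y ∈ K, ∀ l : List (E d), l.length = m →
        h ^ m * |dirDeriv l f y| ≤ C * B * normProd l := by
  let ev : Metric.closedBall (0 : E d) 1 → Module.Dual ℝ (PolyLe d k) := fun z =>
    ((LinearMap.proj (z : E d)).comp (polyFun (crd d))).comp (PolyLe d k).subtype
  have hsep : ∀ v, (∀ s, ev s v = 0) → v = 0 := by
    intro v hv
    refine Subtype.ext (polyFun_crd_eq_zero Metric.isOpen_ball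
      (⟨0, Metric.mem_ball_self one_pos⟩ : (Metric.ball (0 : E d) 1).Nonempty) fun x hx => ?_)
    exact hv ⟨x, Metric.ball_subset_closedBall hx⟩
  obtain ⟨C, hC, hC'⟩ := polyLe_bound (crd d) ev (fun _ => 1) hsep
    (isCompact_closedBall (0 : E d) ρ) m
  refine ⟨C * ρ ^ m, by positivity, fun K x₀ h hh hK hK' f hf B hB hfB y hy l hl => ?_⟩
  have hr : 0 < h / ρ := div_pos hh hρ
  set r := h / ρ with hrdef
  obtain ⟨q, hq, hqg⟩ := hf.comp_affine (r • ContinuousLinearMap.id ℝ (E d)) x₀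
  simp only [_root_.smul_apply, ContinuousLinearMap.id_apply] at hqg
  obtain ⟨hz, hzy⟩ := exists_scaled_ball hρ hh hK' hy
  rw [← hrdef] at hz hzy
  set z := r⁻¹ • (y - x₀) with hzdef
  have hb := hC' ⟨q, hq⟩ B hB (fun s => by
    rw [one_mul]
    change |polyFun (crd d) q s| ≤ B
    rw [← hqg]
    refine hfB _ (hK ?_)
    have := s.2
    rw [mem_closedBall_zero_iff] at this
    rw [Metric.mem_closedBall, dist_eq_norm, add_sub_cancel_right, norm_smul,
      Real.norm_of_nonneg hr.le]
    nlinarith) z hz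
  -- The directions are divided by `r` so that the chain rule for the scaling returns exactly `l`.
  have h1 := abs_dirDeriv_le (contDiff_polyFun (crd d) q) (l.map (r⁻¹ • ·)) z
  rw [List.length_map, hl] at h1
  have h2 := dirDeriv_comp_affine hf.contDiff (r • ContinuousLinearMap.id ℝ (E d)) x₀
    (l.map (r⁻¹ • ·))
  simp only [_root_.smul_apply, ContinuousLinearMap.id_apply, List.map_map] at h2
  have hid : ((⇑(r • ContinuousLinearMap.id ℝ (E d))) ∘ fun x => r⁻¹ • x) = id := by
    funext t
    simp [hr.ne']
  rw [hid, List.map_id, hqg] at h2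
  rw [h2] at h1
  simp only [hzy] at h1
  have h3 : normProd (l.map (r⁻¹ • ·)) = (r⁻¹) ^ m * normProd l := by
    rw [← hl]
    clear * - hr
    induction l with
    | nil => simp
    | cons t l ih =>
      simp only [List.map_cons, normProd_cons, ih, norm_smul, norm_inv,
        Real.norm_of_nonneg hr.le, List.length_cons, pow_succ]
      ring
  rw [h3] at h1
  have h4 : |dirDeriv l f y| ≤ C * B * (r⁻¹ ^ m * normProd l) :=
    h1.trans (mul_le_mul_of_nonneg_right hb (mul_nonneg (by positivity) (normProd_nonneg _)))
  have h5 : h ^ m * r⁻¹ ^ m = ρ ^ m := by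
    rw [← mul_pow, hrdef]
    congr 1
    field_simp
  calc h ^ m * |dirDeriv l f y| ≤ h ^ m * (C * B * (r⁻¹ ^ m * normProd l)) := by gcongr
    _ = C * (h ^ m * r⁻¹ ^ m) * B * normProd l := by ring
    _ = _ := by rw [h5]

theorem integrableOn_of_isCompact {K : Set (E d)} (hK : IsCompact K) {f : E d → ℝ}
    (hf : Continuous f) : IntegrableOn f K :=
  hf.continuousOn.integrableOn_compact hK

open Pointwise in
theorem integral_scaled_ball (g : E d → ℝ) (x₀ : E d) {r : ℝ} (hr : 0 < r) :
    r ^ d * ∫ x in Metric.closedBall (0 : E d) 1, g (r • x + x₀) =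
      ∫ x in Metric.closedBall x₀ r, g x := by
  have h6 := Measure.setIntegral_comp_smul_of_pos (volume : Measure (E d))
    (fun y => g (y + x₀)) (Metric.closedBall (0 : E d) 1) hr
  have hs : r • Metric.closedBall (0 : E d) 1 = Metric.closedBall (0 : E d) r := by
    rw [smul_closedBall _ _ zero_le_one]
    simp [abs_of_pos hr]
  rw [h6, hs, smul_eq_mul, ← mul_assoc, finrank_euclideanSpace_fin,
    mul_inv_cancel₀ (pow_pos hr d).ne', one_mul,
    ← integral_indicator Metric.isClosed_closedBall.measurableSet,
    ← integral_indicator Metric.isClosed_closedBall.measurableSet,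
    ← integral_add_right_eq_self (indicator (Metric.closedBall x₀ r) g) x₀]
  congr 1
  funext x
  simp only [indicator, Metric.mem_closedBall, dist_eq_norm, sub_zero, add_sub_cancel_right]

/-- The functionals given by integration against polynomials `b` separate: testing `v` with itself
gives its L² norm on the ball. -/
theorem exists_sq_le_integral_ball (d k : ℕ) (ρ : ℝ) :
    ∃ C : ℝ, 0 ≤ C ∧ ∀ q ∈ PolyLe d k, ∀ z ∈ Metric.closedBall (0 : E d) ρ,
      polyFun (crd d) q z ^ 2 ≤
        C * ∫ x in Metric.closedBall (0 : E d) 1, polyFun (crd d) q x * polyFun (crd d) q x := by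
  set U := Metric.closedBall (0 : E d) 1 with hU
  have hUc : IsCompact U := isCompact_closedBall _ _
  have hint : ∀ p q : MvPolynomial (Fin d) ℝ,
      IntegrableOn (fun x => polyFun (crd d) p x * polyFun (crd d) q x) U := fun p q =>
    integrableOn_of_isCompact hUc
      ((contDiff_polyFun _ p).continuous.mul (contDiff_polyFun _ q).continuous)
  let ev : PolyLe d k → Module.Dual ℝ (PolyLe d k) := fun b =>
    { toFun := fun q => ∫ x in U, polyFun (crd d) q x * polyFun (crd d) b x
      map_add' := fun p q => by
        rw [← integral_add (hint _ _) (hint _ _)]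
        simp [add_mul]
      map_smul' := fun a p => by
        simp only [Submodule.coe_smul, map_smul, Pi.smul_apply, smul_eq_mul, mul_assoc,
          RingHom.id_apply]
        exact integral_const_mul _ _ }
  have hsep : ∀ v, (∀ s, ev s v = 0) → v = 0 := by
    intro v hv
    refine Subtype.ext (polyFun_crd_eq_zero Metric.isOpen_ball
      (⟨0, Metric.mem_ball_self one_pos⟩ : (Metric.ball (0 : E d) 1).Nonempty) ?_)
    have h0 : ∫ x in U, polyFun (crd d) v x * polyFun (crd d) v x = 0 := hv v
    have h1 := (setIntegral_eq_zero_iff_of_nonneg_ae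
      (Filter.Eventually.of_forall fun x => mul_self_nonneg _) (hint v v)).1 h0
    have h2 : polyFun (crd d) v =ᵐ[volume.restrict (Metric.ball (0 : E d) 1)] fun _ => 0 := by
      have := ae_mono (Measure.restrict_mono Metric.ball_subset_closedBall le_rfl) h1
      filter_upwards [this] with x hx
      simpa using hx
    exact Measure.eqOn_open_of_ae_eq h2 Metric.isOpen_ball
      (contDiff_polyFun _ _).continuous.continuousOn continuousOn_const
  obtain ⟨C, hC, hC'⟩ := polyLe_bound (crd d) ev
    (fun b => (1 + ∫ x in U, polyFun (crd d) b x * polyFun (crd d) b x) / 2) hsep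
    (isCompact_closedBall (0 : E d) ρ) 0
  refine ⟨C ^ 2, by positivity, fun q hq z hz => ?_⟩
  set I := ∫ x in U, polyFun (crd d) q x * polyFun (crd d) q x with hI
  have hI0 : 0 ≤ I := integral_nonneg fun x => mul_self_nonneg _
  -- Young's inequality with weight `ε` bounds the integral against `b` by `(1 + ∫ b²) / 2 * ε` once
  -- `I ≤ ε ^ 2`. It requires `ε > 0`, so the value `√I` is reached only in the limit.
  have key : ∀ ε : ℝ, 0 < ε → I ≤ ε ^ 2 → |polyFun (crd d) q z| ≤ C * ε := by
    intro ε hε hIε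
    have hb := hC' ⟨q, hq⟩ ε hε.le (fun b => by
      change |∫ x in U, polyFun (crd d) q x * polyFun (crd d) b x| ≤ _
      have h1 : |∫ x in U, polyFun (crd d) q x * polyFun (crd d) b x| ≤
          ∫ x in U, ((polyFun (crd d) q x * polyFun (crd d) q x) * (1 / (2 * ε)) +
            (polyFun (crd d) b x * polyFun (crd d) b x) * (ε / 2)) := by
        rw [← Real.norm_eq_abs]
        refine norm_integral_le_of_norm_le
          (((hint q q).mul_const _).add ((hint b b).mul_const _))
          (Filter.Eventually.of_forall fun x => ?_)
        rw [Real.norm_eq_abs]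
        set u := polyFun (crd d) q x
        set w := polyFun (crd d) b x
        have : u * u * (1 / (2 * ε)) + w * w * (ε / 2) = (u ^ 2 + (ε * w) ^ 2) / (2 * ε) := by
          field_simp
        rw [this, le_div_iff₀ (by positivity)]
        rcases abs_cases (u * w) with ⟨h, _⟩ | ⟨h, _⟩ <;> rw [h]
        · nlinarith [sq_nonneg (u - ε * w)]
        · nlinarith [sq_nonneg (u + ε * w)]
      rw [integral_add ((hint q q).mul_const _) ((hint b b).mul_const _), integral_mul_const,
        integral_mul_const, ← hI] at h1
      refine h1.trans ?_
      have : I * (1 / (2 * ε)) ≤ ε / 2 := by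
        rw [mul_one_div, div_le_iff₀ (by positivity)]
        nlinarith
      linarith) z hz
    rwa [norm_iteratedFDeriv_zero, Real.norm_eq_abs] at hb
  have h2 : |polyFun (crd d) q z| ≤ C * Real.sqrt I := by
    refine le_of_forall_pos_le_add fun δ hδ => ?_
    -- The denominator is `C + 1` because `C` may be zero.
    have h3 := key (Real.sqrt I + δ / (C + 1)) (by positivity) (by
      have := Real.sq_sqrt hI0
      have h4 : 0 < δ / (C + 1) := by positivity
      nlinarith [Real.sqrt_nonneg I])
    refine h3.trans ?_
    rw [mul_add]
    have : C * (δ / (C + 1)) ≤ δ := by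
      rw [mul_div_assoc', div_le_iff₀ (by positivity)]
      nlinarith
    linarith
  calc polyFun (crd d) q z ^ 2 = |polyFun (crd d) q z| ^ 2 := (sq_abs _).symm
    _ ≤ (C * Real.sqrt I) ^ 2 := by gcongr
    _ = C ^ 2 * I := by rw [mul_pow, Real.sq_sqrt hI0]

theorem exists_sq_le_integral (d k : ℕ) {ρ : ℝ} (hρ : 0 < ρ) :
    ∃ C : ℝ, 0 ≤ C ∧ ∀ (K : Set (E d)) (x₀ : E d) (h : ℝ), IsCompact K → 0 < h →
      Metric.closedBall x₀ (h / ρ) ⊆ K → K ⊆ Metric.closedBall x₀ h →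
      ∀ f : E d → ℝ, IsPoly k f → ∀ y ∈ K, h ^ d * f y ^ 2 ≤ C * ∫ x in K, f x ^ 2 := by
  obtain ⟨C, hC, hC'⟩ := exists_sq_le_integral_ball d k ρ
  refine ⟨C * ρ ^ d, by positivity, fun K x₀ h hKc hh hK hK' f hf y hy => ?_⟩
  have hr : 0 < h / ρ := div_pos hh hρ
  obtain ⟨q, hq, hqg⟩ := hf.comp_affine ((h / ρ) • ContinuousLinearMap.id ℝ (E d)) x₀
  simp only [_root_.smul_apply, ContinuousLinearMap.id_apply] at hqg
  obtain ⟨hz, hzy⟩ := exists_scaled_ball hρ hh hK' hy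
  have h1 := hC' q hq _ hz
  rw [← hqg] at h1
  simp only [hzy, ← sq] at h1
  have h2 := integral_scaled_ball (fun x => f x ^ 2) x₀ hr
  set I := ∫ x in Metric.closedBall (0 : E d) 1, f ((h / ρ) • x + x₀) ^ 2
  have h3 : ∫ x in Metric.closedBall x₀ (h / ρ), f x ^ 2 ≤ ∫ x in K, f x ^ 2 :=
    setIntegral_mono_set (integrableOn_of_isCompact hKc (hf.continuous.pow 2))
      (Filter.Eventually.of_forall fun x => sq_nonneg _) hK.eventuallyLE
  have h9 : h ^ d = ρ ^ d * (h / ρ) ^ d := by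
    rw [← mul_pow]
    congr 1
    field_simp
  calc h ^ d * f y ^ 2 ≤ h ^ d * (C * I) := mul_le_mul_of_nonneg_left h1 (by positivity)
    _ = C * ρ ^ d * ((h / ρ) ^ d * I) := by rw [h9]; ring
    _ ≤ _ := by rw [h2]; gcongr

variable {d : ℕ} {Ω : Set (E d)}

/-! ### Geometry of the cells -/

/-- The diameter `h_T` of a simplex. -/
abbrev hdiam (T : Finset (E d)) : ℝ := Metric.diam (hull T)

theorem isBounded_hull (T : Finset (E d)) : Bornology.IsBounded (hull T) :=
  (Mesh.isCompact_hull T).isBounded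

theorem subset_hull (T : Finset (E d)) : (T : Set (E d)) ⊆ hull T := subset_convexHull ℝ _

theorem hull_mono {s T : Finset (E d)} (h : s ⊆ T) : hull s ⊆ hull T :=
  convexHull_mono (by exact_mod_cast h)

theorem dist_le_hdiam {T : Finset (E d)} {x y : E d} (hx : x ∈ hull T) (hy : y ∈ hull T) :
    ‖x - y‖ ≤ hdiam T := by
  rw [← dist_eq_norm]
  exact Metric.dist_le_diam_of_mem (isBounded_hull T) hx hy

theorem hull_subset_of_convex {T : Finset (E d)} {s : Set (E d)} (hs : Convex ℝ s)
    (h : ∀ x ∈ T, x ∈ s) : hull T ⊆ s := convexHull_min (fun x hx => h x hx) hs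

theorem affine_le_on_hull {T : Finset (E d)} (α : E d →L[ℝ] ℝ) {b : ℝ}
    (h : ∀ x ∈ T, α x ≤ b) : ∀ x ∈ hull T, α x ≤ b :=
  hull_subset_of_convex (convex_halfSpace_le α.isLinear b) h

/-- The barycentric coordinates of a simplex. -/
structure IsBary (T : Finset (E d)) (α : E d → E d →L[ℝ] ℝ) (b : E d → ℝ) : Prop where
  vertex : ∀ x ∈ T, ∀ y ∈ T, α x y + b x = if x = y then 1 else 0
  nonneg : ∀ y ∈ hull T, ∀ x ∈ T, 0 ≤ α x y + b x
  sum_one : ∀ y, ∑ x ∈ T, (α x y + b x) = 1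
  sum_smul : ∀ y, ∑ x ∈ T, (α x y + b x) • x = y

namespace Mesh

variable (M : Mesh Ω)

theorem exists_bary {T : Finset (E d)} (hT : T ∈ M.cells) : ∃ α b, IsBary T α b := by
  classical
  obtain ⟨hT, hc⟩ := M.mem_cells.1 hT
  have hind := M.complex.indep hT
  have htop := hind.affineSpan_eq_top_iff_card_eq_finrank_add_one.2 (by simp [hc])
  let B : AffineBasis T ℝ (E d) := ⟨fun x => (x : E d), hind, htop⟩
  have hB : ∀ x : T, B x = x := fun x => rfl
  -- Each affine coordinate is split into its linear part and its value at the origin. At points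
  -- that are not vertices both are set to zero; `IsBary` never reads these values.
  let α : E d → E d →L[ℝ] ℝ := fun x =>
    if h : x ∈ T then (B.coord ⟨x, h⟩).linear.toContinuousLinearMap else 0
  let b : E d → ℝ := fun x => if h : x ∈ T then B.coord ⟨x, h⟩ 0 else 0
  have key : ∀ x (h : x ∈ T) y, α x y + b x = B.coord ⟨x, h⟩ y := by
    intro x h y
    simp only [α, b, h, dif_pos, LinearMap.coe_toContinuousLinearMap']
    have := (B.coord ⟨x, h⟩).map_vadd 0 y
    simp only [vadd_eq_add, add_zero] at this
    exact this.symm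
  have hsum : ∀ {W : Type} [AddCommMonoid W] (g : E d → W), ∑ x ∈ T, g x = ∑ x : T, g x :=
    fun g => (Finset.sum_coe_sort T g).symm
  refine ⟨α, b, fun x hx y hy => ?_, fun y hy x hx => ?_, fun y => ?_, fun y => ?_⟩
  · rw [key x hx, show y = B ⟨y, hy⟩ from rfl, B.coord_apply]
    simp [hB]
  · rw [key x hx]
    have : y ∈ convexHull ℝ (range B) := by
      have hr : range B = (T : Set (E d)) := by
        ext z
        simp [hB]
      rw [hr]; exact hy
    rw [B.convexHull_eq_nonneg_coord] at this
    exact this _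
  · rw [hsum]
    simp only [key _ (Subtype.coe_prop _)]
    exact B.sum_coord_apply_eq_one y
  · rw [hsum (W := E d)]
    simp only [key _ (Subtype.coe_prop _)]
    exact B.linear_combination_coord_eq_self y

theorem cells_subset_closure {T : Finset (E d)} (hT : T ∈ M.cells) : hull T ⊆ closure Ω := by
  rw [M.closure_eq]
  exact subset_biUnion_of_mem (u := fun T : Finset (E d) => hull T) hT

theorem exists_cell_of_mem {x : E d} (hx : x ∈ closure Ω) : ∃ T ∈ M.cells, x ∈ hull T := by
  rw [M.closure_eq] at hx
  simpa using hx

theorem hdiam_pos (hd : 0 < d) {T : Finset (E d)} (hT : T ∈ M.cells) : 0 < hdiam T := by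
  have hc := (M.mem_cells.1 hT).2
  obtain ⟨x, hx, y, hy, hxy⟩ := Finset.one_lt_card.1 (show 1 < T.card by omega)
  exact (norm_pos_iff.2 (sub_ne_zero.2 hxy)).trans_le
    (dist_le_hdiam (subset_hull T hx) (subset_hull T hy))

variable {M} in
theorem IsShapeRegular.exists_ball {ρ : ℝ} (hM : M.IsShapeRegular ρ) (hρ : 0 < ρ)
    {T : Finset (E d)} (hT : T ∈ M.cells) :
    ∃ x₀, x₀ ∈ hull T ∧ Metric.closedBall x₀ (hdiam T / ρ) ⊆ hull T ∧
      hull T ⊆ Metric.closedBall x₀ (hdiam T) := by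
  obtain ⟨x₀, h⟩ := hM T hT
  have hx : x₀ ∈ hull T := h (Metric.mem_closedBall_self
    (div_nonneg Metric.diam_nonneg hρ.le))
  exact ⟨x₀, hx, h, fun y hy => Metric.dist_le_diam_of_mem (isBounded_hull T) hy hx⟩

-- On the cell the coordinate takes values in [0, 1], so moving from the center of the inscribed
-- ball by its radius in direction `t` changes it by at most one.
variable {M} in
theorem IsShapeRegular.norm_bary_le {ρ : ℝ} (hM : M.IsShapeRegular ρ) (hρ : 0 < ρ) (hd : 0 < d)
    {T : Finset (E d)} (hT : T ∈ M.cells) {α : E d → E d →L[ℝ] ℝ} {b : E d → ℝ}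
    (hα : IsBary T α b) {x : E d} (hx : x ∈ T) (t : E d) :
    |α x t| ≤ ρ / hdiam T * ‖t‖ := by
  obtain ⟨x₀, hx₀, hb, -⟩ := hM.exists_ball hρ hT
  have hh := M.hdiam_pos hd hT
  rcases eq_or_ne t 0 with rfl | ht
  · simp
  have ht' := norm_pos_iff.2 ht
  have hr : 0 < hdiam T / ρ := div_pos hh hρ
  have hle : ∀ y ∈ hull T, α x y + b x ≤ 1 := by
    intro y hy
    rw [← hα.sum_one y]
    exact Finset.single_le_sum (f := fun x => α x y + b x) (fun z hz => hα.nonneg y hy z hz) hx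
  have h1 : x₀ + (hdiam T / ρ / ‖t‖) • t ∈ hull T := by
    refine hb ?_
    rw [Metric.mem_closedBall, dist_eq_norm, add_sub_cancel_left, norm_smul, Real.norm_eq_abs,
      abs_of_pos (by positivity), div_mul_cancel₀ _ ht'.ne']
  have h2 := hle _ h1
  have h3 := hα.nonneg _ h1 x hx
  have h4 := hle _ hx₀
  have h5 := hα.nonneg _ hx₀ x hx
  rw [map_add, map_smul, smul_eq_mul] at h2 h3
  have h6 : |hdiam T / ρ / ‖t‖ * α x t| ≤ 1 := abs_le.2 ⟨by linarith, by linarith⟩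
  rw [abs_mul, abs_of_pos (by positivity)] at h6
  have h7 : |α x t| = ρ / hdiam T * ‖t‖ * (hdiam T / ρ / ‖t‖ * |α x t|) := by
    field_simp
  rw [h7]
  exact mul_le_of_le_one_right (by positivity) h6

-- The coordinate of `x` drops from one to zero along the edge, and its slope is at most `ρ / hdiam
-- T`.
variable {M} in
theorem IsShapeRegular.hdiam_le_edge {ρ : ℝ} (hM : M.IsShapeRegular ρ) (hρ : 0 < ρ) (hd : 0 < d)
    {T : Finset (E d)} (hT : T ∈ M.cells) {x y : E d} (hx : x ∈ T) (hy : y ∈ T) (hxy : x ≠ y) :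
    hdiam T ≤ ρ * ‖x - y‖ := by
  obtain ⟨α, b, hα⟩ := M.exists_bary hT
  have h1 := hα.vertex x hx x hx
  have h2 := hα.vertex x hx y hy
  rw [if_pos rfl] at h1
  rw [if_neg hxy] at h2
  have h3 := hM.norm_bary_le hρ hd hT hα hx (x - y)
  have hh := M.hdiam_pos hd hT
  rw [map_sub, show α x x - α x y = 1 by linarith, abs_one, div_mul_eq_mul_div,
    le_div_iff₀ hh] at h3
  linarith

theorem mem_hull_inter [DecidableEq (E d)] {T T' : Finset (E d)} (hT : T ∈ M.cells)
    (hT' : T' ∈ M.cells) {y : E d} (hy : y ∈ hull T) (hy' : y ∈ hull T') : y ∈ hull (T ∩ T') := by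
  have := M.complex.inter_subset_convexHull (M.mem_cells.1 hT).1 (M.mem_cells.1 hT').1 ⟨hy, hy'⟩
  simpa only [hull, Finset.coe_inter] using this

/-- By conformity the intersection of the interiors lies in the hull of the common vertices. If it
is nonempty, these span the space, so there are `d + 1` of them and the cells coincide. -/
theorem disjoint_interior {T T' : Finset (E d)} (hT : T ∈ M.cells) (hT' : T' ∈ M.cells)
    (hne : T ≠ T') : Disjoint (interior (hull T)) (interior (hull T')) := by
  classical
  rw [Set.disjoint_left]
  intro y hy hy'
  have hsub : interior (hull T) ∩ interior (hull T') ⊆ hull (T ∩ T') := fun z hz =>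
    M.mem_hull_inter hT hT' (interior_subset hz.1) (interior_subset hz.2)
  have hint : (interior (hull (T ∩ T'))).Nonempty :=
    ⟨y, interior_maximal hsub (isOpen_interior.inter isOpen_interior) ⟨hy, hy'⟩⟩
  rw [interior_convexHull_nonempty_iff_affineSpan_eq_top] at hint
  have hcard : d + 1 ≤ (T ∩ T').card := by
    have h1 : vectorSpan ℝ ((T ∩ T' : Finset (E d)) : Set (E d)) = ⊤ := by
      rw [← direction_affineSpan, hint, AffineSubspace.direction_top]
    have hne : (T ∩ T').Nonempty := by
      by_contra h
      rw [Finset.not_nonempty_iff_eq_empty] at h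
      have := M.mem_hull_inter hT hT' (interior_subset hy) (interior_subset hy')
      rw [h] at this
      simp [hull] at this
    have h2 := finrank_vectorSpan_image_finset_le ℝ (id : E d → E d) (T ∩ T')
      (n := (T ∩ T').card - 1) (by have := hne.card_pos; omega)
    rw [Finset.image_id, h1, finrank_top, finrank_euclideanSpace_fin] at h2
    have := hne.card_pos
    omega
  have c1 := (M.mem_cells.1 hT).2
  have c2 := (M.mem_cells.1 hT').2
  have e1 : T ∩ T' = T := Finset.eq_of_subset_of_card_le Finset.inter_subset_left (by omega)
  have e2 : T ∩ T' = T' := Finset.eq_of_subset_of_card_le Finset.inter_subset_right (by omega)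
  exact hne (e1.symm.trans e2)

theorem interior_hull_ae_eq (T : Finset (E d)) :
    (interior (hull T) : Set (E d)) =ᵐ[volume] hull T :=
  interior_ae_eq_of_null_frontier ((convex_convexHull ℝ _).addHaar_frontier volume)

theorem interior_hull_subset_domain (hΩ : IsConvexPolytopalDomain Ω) {T : Finset (E d)}
    (hT : T ∈ M.cells) : interior (hull T) ⊆ Ω := by
  have h : interior (closure Ω) = Ω := by
    rw [hΩ.convex.interior_closure_eq_interior_of_nonempty_interior
      (by rw [hΩ.isOpen.interior_eq]; exact hΩ.nonempty), hΩ.isOpen.interior_eq]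
  rw [← h]
  exact interior_mono (M.cells_subset_closure hT)

theorem setIntegral_domain (hΩ : IsConvexPolytopalDomain Ω) {g : E d → ℝ}
    (hg : IntegrableOn g Ω) : ∫ x in Ω, g x = ∑ T ∈ M.cells, ∫ x in hull T, g x := by
  have h1 : (Ω : Set (E d)) =ᵐ[volume] ⋃ T ∈ M.cells, interior (hull T) := by
    refine Filter.EventuallyLE.antisymm ?_ ?_
    · have := ae_imp_of_ae_restrict M.ae_mem_interior
      filter_upwards [this] with x hx hxΩ
      obtain ⟨T, hT, hxT⟩ := hx hxΩ
      exact mem_biUnion hT hxT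
    · refine LE.le.eventuallyLE (iUnion₂_subset fun T hT => ?_)
      exact M.interior_hull_subset_domain hΩ hT
  rw [setIntegral_congr_set h1, integral_biUnion_finset]
  · exact Finset.sum_congr rfl fun T _ => setIntegral_congr_set (interior_hull_ae_eq T)
  · exact fun T _ => isOpen_interior.measurableSet
  · exact fun T hT T' hT' hne => M.disjoint_interior hT hT' hne
  · exact fun T hT => hg.mono_set (M.interior_hull_subset_domain hΩ hT)

end Mesh

/-! ### Volume, Taylor and convexity bounds on one cell -/

theorem volume_hull_le {T : Finset (E d)} (hT : T.Nonempty) :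
    volume.real (hull T) ≤
      hdiam T ^ d * volume.real (Metric.ball (0 : E d) 1) := by
  obtain ⟨x, hx⟩ := hT
  have h1 : hull T ⊆ Metric.closedBall x (hdiam T) := fun y hy =>
    Metric.dist_le_diam_of_mem (isBounded_hull T) hy (subset_hull T hx)
  refine (measureReal_mono h1 (isCompact_closedBall _ _).measure_ne_top).trans_eq ?_
  rw [Measure.addHaar_real_closedBall volume x Metric.diam_nonneg, finrank_euclideanSpace_fin]

/-- A function which vanishes at the vertices of a simplex is bounded by its second derivatives. -/
theorem abs_le_of_vanish_vertices {T : Finset (E d)} {e : E d → ℝ}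
    (he : ContDiff ℝ (⊤ : ℕ∞) e) (h0 : ∀ x ∈ T, e x = 0) {B : ℝ} (hB : 0 ≤ B)
    (h2 : ∀ y ∈ hull T, ∀ s t : E d, |dirDeriv [s, t] e y| ≤ B * (‖s‖ * ‖t‖)) :
    ∀ y ∈ hull T, |e y| ≤ B * hdiam T ^ 2 := by
  intro y hy
  have hconv : Convex ℝ (hull T) := convex_convexHull ℝ _
  have hd : Differentiable ℝ e := he.differentiable (by simp)
  have hd2 : Differentiable ℝ (fderiv ℝ e) :=
    (he.fderiv_right (m := (⊤ : ℕ∞)) (by simp)).differentiable (by simp)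
  have h3 : ∀ z ∈ hull T, ‖fderiv ℝ e z - fderiv ℝ e y‖ ≤ B * hdiam T := by
    intro z hz
    have hbd : ∀ w ∈ hull T, ‖fderiv ℝ (fderiv ℝ e) w‖ ≤ B := by
      intro w hw
      refine ContinuousLinearMap.opNorm_le_bound _ hB fun s =>
        ContinuousLinearMap.opNorm_le_bound _ (by positivity) fun t => ?_
      have := h2 w hw s t
      have hdir : dirDeriv [s, t] e w = fderiv ℝ (fderiv ℝ e) w s t := by
        simp only [dirDeriv]
        rw [fderiv_clm_apply (hd2 w) (differentiableAt_const _)]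
        simp
      rw [hdir] at this
      rw [Real.norm_eq_abs]
      linarith
    have := hconv.norm_image_sub_le_of_norm_fderiv_le (fun w _ => hd2 w) hbd hy hz
    exact this.trans (mul_le_mul_of_nonneg_left (dist_le_hdiam hz hy) hB)
  have h4 : ∀ z ∈ hull T, |e z - e y - fderiv ℝ e y (z - y)| ≤ B * hdiam T ^ 2 := by
    intro z hz
    have := hconv.norm_image_sub_le_of_norm_fderiv_le' (φ := fderiv ℝ e y)
      (fun w _ => hd w) h3 hy hz
    rw [Real.norm_eq_abs] at this
    refine this.trans ?_
    rw [sq, ← mul_assoc]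
    exact mul_le_mul_of_nonneg_left (dist_le_hdiam hz hy) (by positivity)
  -- The first order Taylor polynomial at `y` is affine and at most `B * hdiam T ^ 2` at the
  -- vertices, where `e` vanishes. By convexity the bound extends to the point `y` itself, where the
  -- polynomial has the value `e y`. `hlo` is the mirror image.
  have hup : ∀ z ∈ hull T, fderiv ℝ e y z ≤ B * hdiam T ^ 2 - e y + fderiv ℝ e y y := by
    refine affine_le_on_hull _ fun x hx => ?_
    have := (abs_le.1 (h4 x (subset_hull T hx))).1
    rw [h0 x hx, map_sub] at this
    linarith
  have hlo : ∀ z ∈ hull T, (-fderiv ℝ e y) z ≤ B * hdiam T ^ 2 + e y - fderiv ℝ e y y := by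
    refine affine_le_on_hull _ fun x hx => ?_
    have := (abs_le.1 (h4 x (subset_hull T hx))).2
    rw [h0 x hx, map_sub] at this
    simp only [_root_.neg_apply]
    linarith
  have a1 := hup y hy
  have a2 := hlo y hy
  simp only [_root_.neg_apply] at a2
  exact abs_le.2 ⟨by linarith, by linarith⟩

theorem abs_affine_le {T : Finset (E d)} {f : E d → ℝ} (hf : IsPoly 1 f) {B : ℝ}
    (h : ∀ x ∈ T, |f x| ≤ B) : ∀ y ∈ hull T, |f y| ≤ B := by
  obtain ⟨α, b, hα⟩ := hf.exists_affine
  intro y hy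
  have h1 := affine_le_on_hull (T := T) α (b := B - b) (fun x hx => by
    have := (abs_le.1 (h x hx)).2
    rw [hα] at this
    linarith) y hy
  have h2 := affine_le_on_hull (T := T) (-α) (b := B + b) (fun x hx => by
    have := (abs_le.1 (h x hx)).1
    rw [hα] at this
    simp only [_root_.neg_apply]
    linarith) y hy
  simp only [_root_.neg_apply] at h2
  rw [hα]
  exact abs_le.2 ⟨by linarith, by linarith⟩

/-! ### Piecewise linear functions -/

-- Along the segment from `x` to `y`, finiteness of the cover gives, at every time, a member that
-- contains points arbitrarily close on the right; being closed, it contains the current point too.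
-- So the right slopes are frequently at most `K * ‖y - x‖`, which is enough for the mean value
-- inequality.
open Filter Topology in
theorem lipschitz_of_closed_cover {F ι : Type*} [NormedAddCommGroup F] [NormedSpace ℝ F] [Finite ι]
    (s : ι → Set F) (hs : ∀ i, IsClosed (s i)) (hcov : ∀ x, ∃ i, x ∈ s i) (f : F → ℝ) {K : ℝ}
    (hK : 0 ≤ K) (hf : ∀ i, ∀ x ∈ s i, ∀ y ∈ s i, |f x - f y| ≤ K * ‖x - y‖) (x y : F) :
    f y ≤ f x + K * ‖y - x‖ := by
  have hcont : Continuous f := by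
    refine (locallyFinite_of_finite s).continuous (iUnion_eq_univ_iff.2 hcov) hs fun i => ?_
    have : LipschitzOnWith ⟨K, hK⟩ f (s i) := LipschitzOnWith.of_dist_le_mul fun x hx y hy => by
      rw [Real.dist_eq, dist_eq_norm]
      exact hf i x hx y hy
    exact this.continuousOn
  set g : ℝ → F := fun t => x + t • (y - x) with hg
  have hgc : Continuous g := by fun_prop
  have h := image_le_of_liminf_slope_right_le_deriv_boundary (f := fun t => f (g t)) (a := 0) (b := 1)
    (hcont.comp hgc).continuousOn (B := fun t => f x + t * (K * ‖y - x‖))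
    (B' := fun _ => K * ‖y - x‖) (by simp [hg])
    (by fun_prop)
    (fun t _ => by
      simpa using (((hasDerivAt_id t).mul_const (K * ‖y - x‖)).const_add (f x)).hasDerivWithinAt)
    (fun t _ r hr => by
      have h1 : ∃ i, ∃ᶠ z in 𝓝[>] t, g z ∈ s i := by
        by_contra hcon
        simp only [not_exists, not_frequently] at hcon
        have h2 := eventually_all.2 hcon
        obtain ⟨z, hz⟩ := h2.exists
        obtain ⟨i, hi⟩ := hcov (g z)
        exact hz i hi
      obtain ⟨i, hi⟩ := h1
      have ht : g t ∈ s i := by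
        have h3 : Tendsto g (𝓝[>] t) (𝓝 (g t)) := hgc.continuousAt.mono_left nhdsWithin_le_nhds
        exact (hs i).mem_of_frequently_of_tendsto hi h3
      refine (hi.and_eventually self_mem_nhdsWithin).mono fun z hz => ?_
      have hzt : 0 < z - t := sub_pos.2 hz.2
      refine lt_of_le_of_lt ?_ hr
      rw [slope_def_field, div_le_iff₀ hzt]
      refine (le_abs_self _).trans ((hf i _ hz.1 _ ht).trans_eq ?_)
      have : g z - g t = (z - t) • (y - x) := by
        simp only [hg, sub_smul]
        abel
      rw [this, norm_smul, Real.norm_of_nonneg hzt.le]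
      ring)
  have := h (right_mem_Icc.2 zero_le_one)
  simpa [hg] using this

namespace Mesh

variable (M : Mesh Ω)

theorem mem_nodes_of_mem_cell {T : Finset (E d)} (hT : T ∈ M.cells) {x : E d} (hx : x ∈ T) :
    x ∈ M.nodes :=
  M.complex.down_closed (M.mem_cells.1 hT).1 (Finset.singleton_subset_iff.2 hx)
    (Finset.singleton_nonempty x)

theorem exists_cell_of_mem_nodes {x : E d} (hx : x ∈ M.nodes) : ∃ T ∈ M.cells, x ∈ T := by
  obtain ⟨T, hT, hxT, hc⟩ := M.pure _ hx
  exact ⟨T, M.mem_cells.2 ⟨hT, hc⟩, Finset.singleton_subset_iff.1 hxT⟩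

variable {M} in
theorem exists_piece {k : ℕ} {v : E d → ℝ} (hv : v ∈ M.piecewisePoly k) {T : Finset (E d)}
    (hT : T ∈ M.cells) : ∃ f, IsPoly k f ∧ EqOn v f (hull T) := isPolyOn_iff.1 (hv.1 T hT)

/-- For a supporting functional `n` at `y`, the barycentric mean of `n y - n z` over the vertices
`z` is zero and has nonnegative terms. At a vertex inside `Ω` the gap is strict, so its weight must
vanish. -/
theorem bary_eq_zero {T : Finset (E d)} (hΩ : IsConvexPolytopalDomain Ω) (hT : T ∈ M.cells)
    {α : E d → E d →L[ℝ] ℝ} {b : E d → ℝ} (hα : IsBary T α b) {y : E d} (hy : y ∈ hull T)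
    (hyΩ : y ∉ Ω) {x : E d} (hx : x ∈ T) (hxΩ : x ∈ Ω) : α x y + b x = 0 := by
  obtain ⟨n, hn⟩ := geometric_hahn_banach_open_point hΩ.convex hΩ.isOpen hyΩ
  have hcl : ∀ z ∈ closure Ω, n z ≤ n y := by
    intro z hz
    have : closure Ω ⊆ {z | n z ≤ n y} :=
      closure_minimal (fun z hz => (hn z hz).le) (isClosed_le n.continuous continuous_const)
    exact this hz
  have h1 : ∑ z ∈ T, (α z y + b z) * (n y - n z) = 0 := by
    have e1 := hα.sum_one y
    have e2 := congrArg n (hα.sum_smul y)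
    rw [map_sum] at e2
    simp only [map_smul, smul_eq_mul] at e2
    simp only [mul_sub, Finset.sum_sub_distrib, ← Finset.sum_mul, e1, e2]
    ring
  have h2 := (Finset.sum_eq_zero_iff_of_nonneg fun z hz => mul_nonneg (hα.nonneg y hy z hz)
    (sub_nonneg.2 (hcl z (M.cells_subset_closure hT (subset_hull T hz))))).1 h1 x hx
  have h3 := hn x hxΩ
  rcases mul_eq_zero.1 h2 with h | h
  · exact h
  · linarith

/-- The affine pieces with the prescribed vertex values agree on the hull of the common vertices of
two cells, and they vanish off `Ω` by `bary_eq_zero`; so they glue. -/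
theorem exists_interpolant (hΩ : IsConvexPolytopalDomain Ω) (c : E d → ℝ)
    (hc : ∀ x, x ∉ Ω → c x = 0) : ∃ u : M.V0, ∀ x ∈ M.nodes, (u : E d → ℝ) x = c x := by
  classical
  have hb := fun T (hT : T ∈ M.cells) => M.exists_bary hT
  choose! α b hα using hb
  let A : Finset (E d) → E d → ℝ := fun T y => ∑ x ∈ T, c x * (α T x y + b T x)
  have hA : ∀ T, IsPoly 1 (A T) := by
    intro T
    have : A T = fun y => (∑ x ∈ T, c x • α T x) y + ∑ x ∈ T, c x * b T x := by
      funext y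
      simp [A, mul_add, Finset.sum_add_distrib]
    rw [this]
    exact IsPoly.of_affine _ _
  have hAv : ∀ T ∈ M.cells, ∀ x ∈ T, A T x = c x := by
    intro T hT x hx
    simp only [A]
    rw [Finset.sum_eq_single_of_mem x hx fun z hz hzx => by
      rw [(hα T hT).vertex z hz x hx, if_neg hzx, mul_zero]]
    rw [(hα T hT).vertex x hx x hx, if_pos rfl, mul_one]
  have hAA : ∀ T ∈ M.cells, ∀ T' ∈ M.cells, ∀ y ∈ hull T, y ∈ hull T' → A T y = A T' y := by
    intro T hT T' hT' y hy hy'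
    have := abs_affine_le (T := T ∩ T') ((hA T).sub (hA T')) (B := 0) (fun x hx => by
      rw [Finset.mem_inter] at hx
      simp [hAv T hT x hx.1, hAv T' hT' x hx.2]) y (M.mem_hull_inter hT hT' hy hy')
    have := abs_nonpos_iff.1 this
    simp only [Pi.sub_apply] at this
    linarith
  have hA0 : ∀ T ∈ M.cells, ∀ y ∈ hull T, y ∉ Ω → A T y = 0 := by
    intro T hT y hy hyΩ
    refine Finset.sum_eq_zero fun x hx => ?_
    by_cases hxΩ : x ∈ Ω
    · rw [M.bary_eq_zero hΩ hT (hα T hT) hy hyΩ hx hxΩ, mul_zero]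
    · rw [hc x hxΩ, zero_mul]
  let u : E d → ℝ := fun y =>
    if h : ∃ T ∈ M.cells, y ∈ hull T then A h.choose y else 0
  have hu : ∀ T ∈ M.cells, ∀ y ∈ hull T, u y = A T y := by
    intro T hT y hy
    have h : ∃ T ∈ M.cells, y ∈ hull T := ⟨T, hT, hy⟩
    simp only [u, dif_pos h]
    exact hAA _ h.choose_spec.1 _ hT y h.choose_spec.2 hy
  refine ⟨⟨u, fun T hT => isPolyOn_iff.2 ⟨A T, hA T, hu T hT⟩, fun y hy => ?_⟩, fun x hx => ?_⟩
  · by_cases h : ∃ T ∈ M.cells, y ∈ hull T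
    · obtain ⟨T, hT, hyT⟩ := h
      rw [hu T hT y hyT, hA0 T hT y hyT hy]
    · simp only [u, dif_neg h]
  · obtain ⟨T, hT, hxT⟩ := M.exists_cell_of_mem_nodes hx
    exact (hu T hT x (subset_hull T hxT)).trans (hAv T hT x hxT)

-- The cells and the complement of `Ω` form a finite closed cover on whose members `u` is affine or
-- zero. Lipschitz continuity makes integration by parts available.
variable {M} in
theorem exists_lipschitz (hΩ : IsConvexPolytopalDomain Ω) {u : E d → ℝ} (hu : u ∈ M.V0) :
    ∃ K, LipschitzWith K u := by
  have h1 := fun T (hT : T ∈ M.cells) => exists_piece hu hT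
  choose! f hf hfu using h1
  have h2 := fun T (hT : T ∈ M.cells) => (hf T hT).exists_affine
  choose! α b hα using h2
  let K : ℝ := ∑ T ∈ M.cells, ‖α T‖
  have hK : 0 ≤ K := Finset.sum_nonneg fun _ _ => norm_nonneg _
  have key := lipschitz_of_closed_cover (ι := Option M.cells)
    (fun o => o.elim Ωᶜ fun T => hull (T : Finset (E d)))
    (fun o => by
      rcases o with _ | T
      · exact hΩ.isOpen.isClosed_compl
      · exact (isCompact_hull _).isClosed)
    (fun x => by
      by_cases hx : x ∈ Ω
      · obtain ⟨T, hT, hxT⟩ := M.exists_cell_of_mem (subset_closure hx)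
        exact ⟨some ⟨T, hT⟩, hxT⟩
      · exact ⟨none, hx⟩) u hK
    (fun o x hx y hy => by
      rcases o with _ | T
      · rw [hu.2 x hx, hu.2 y hy, sub_self, abs_zero]
        positivity
      · have hT := T.2
        rw [hfu T hT hx, hfu T hT hy, hα T hT, hα T hT, add_sub_add_right_eq_sub, ← map_sub]
        refine ((α T).le_opNorm _).trans ?_
        gcongr
        exact Finset.single_le_sum (f := fun T => ‖α T‖) (fun _ _ => norm_nonneg _) hT)
  refine ⟨K.toNNReal, LipschitzWith.of_dist_le_mul fun x y => ?_⟩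
  rw [Real.dist_eq, dist_eq_norm, Real.coe_toNNReal _ hK]
  have a1 := key x y
  have a2 := key y x
  rw [norm_sub_rev] at a1
  exact abs_le.2 ⟨by linarith, by linarith⟩

-- Integration by parts against the constant one: `u` is Lipschitz with compact support, its
-- derivative vanishes outside `closure Ω`, and the boundary of a convex set is a null set.
variable {M} in
theorem integral_fderiv_eq_zero (hΩ : IsConvexPolytopalDomain Ω) {u : E d → ℝ} (hu : u ∈ M.V0)
    (t : E d) : ∫ x in Ω, fderiv ℝ u x t = 0 := by
  obtain ⟨K, hK⟩ := exists_lipschitz hΩ hu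
  have hcompact : IsCompact (closure Ω) := by
    rw [M.closure_eq]
    exact M.cells.isCompact_biUnion fun T _ => isCompact_hull T
  have hsupp : HasCompactSupport u := by
    refine HasCompactSupport.intro hcompact fun x hx => hu.2 x fun h => hx (subset_closure h)
  have h1 := LipschitzWith.integral_lineDeriv_mul_eq (μ := (volume : Measure (E d)))
    (LipschitzWith.const (1 : ℝ) (α := E d)) hK hsupp (-t)
  simp only [neg_neg, mul_one] at h1
  have h2 : ∀ x, lineDeriv ℝ (fun _ : E d => (1 : ℝ)) x (-t) = 0 := fun x => by
    simp [lineDeriv]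
  simp only [h2, zero_mul, integral_zero] at h1
  have h3 : ∫ x in Ω, lineDeriv ℝ u x t = 0 := by
    rw [h1]
    refine setIntegral_eq_integral_of_ae_compl_eq_zero ?_
    have hfr : ∀ᵐ x ∂(volume : Measure (E d)), x ∉ frontier Ω :=
      measure_eq_zero_iff_ae_notMem.1 (hΩ.convex.addHaar_frontier volume)
    filter_upwards [hfr] with x hx hxΩ
    have hxc : x ∉ closure Ω := fun h => hx ⟨h, by rwa [hΩ.isOpen.interior_eq]⟩
    have hev : u =ᶠ[nhds x] fun _ => 0 := by
      filter_upwards [isClosed_closure.isOpen_compl.mem_nhds hxc] with z hz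
      exact hu.2 z fun h => hz (subset_closure h)
    have hfd : HasFDerivAt u (0 : E d →L[ℝ] ℝ) x :=
      (hasFDerivAt_const (0 : ℝ) x).congr_of_eventuallyEq hev
    rw [hfd.hasLineDerivAt t |>.lineDeriv]
    rfl
  rw [← h3]
  refine integral_congr_ae ?_
  filter_upwards [M.ae_mem_interior] with x ⟨T, hT, hx⟩
  exact (((contDiffAt_of_mem_interior hu hT hx).differentiableAt
    (by simp)).lineDeriv_eq_fderiv).symm

end Mesh

/-! ### Vertex patches -/

/-- In dimension at least two a point on the line can be moved off it slightly. This serves to join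
two cells at a node by a segment that misses the node. -/
theorem exists_mem_open_not_mem_span (hd : 2 ≤ d) {U : Set (E d)} (hU : IsOpen U)
    (hne : U.Nonempty) (x w : E d) : ∃ b ∈ U, b - x ∉ Submodule.span ℝ {w} := by
  obtain ⟨b, hb⟩ := hne
  by_cases h : b - x ∈ Submodule.span ℝ {w}
  swap
  · exact ⟨b, hb, h⟩
  obtain ⟨u, hu⟩ : ∃ u, u ∉ Submodule.span ℝ {w} := by
    by_contra hcon
    push Not at hcon
    have h1 : Submodule.span ℝ {w} = ⊤ := eq_top_iff.2 fun u _ => hcon u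
    have h2 := finrank_span_le_card (R := ℝ) ({w} : Set (E d))
    rw [h1, finrank_top, finrank_euclideanSpace_fin] at h2
    simp at h2
    omega
  obtain ⟨ε, hε, hball⟩ := Metric.isOpen_iff.1 hU b hb
  have hu0 : 0 < ‖u‖ := norm_pos_iff.2 fun h0 => hu (h0 ▸ Submodule.zero_mem _)
  have hη : 0 < ε / (2 * ‖u‖) := by positivity
  refine ⟨b + (ε / (2 * ‖u‖)) • u, hball ?_, fun hcon => hu ?_⟩
  · rw [Metric.mem_ball, dist_eq_norm, add_sub_cancel_left, norm_smul, Real.norm_of_nonneg hη.le]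
    have : ε / (2 * ‖u‖) * ‖u‖ = ε / 2 := by field_simp
    rw [this]
    linarith
  · have h1 := Submodule.sub_mem _ hcon h
    rw [show b + (ε / (2 * ‖u‖)) • u - x - (b - x) = (ε / (2 * ‖u‖)) • u by abel] at h1
    exact (Submodule.smul_mem_iff _ hη.ne').1 h1

namespace Mesh

variable {M : Mesh Ω}

theorem mem_of_mem_hull {x : E d} (hx : x ∈ M.nodes) {T : Finset (E d)} (hT : T ∈ M.cells)
    (h : x ∈ hull T) : x ∈ T := by
  have := M.complex.inter_subset_convexHull hx (M.mem_cells.1 hT).1 ⟨by simp, h⟩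
  by_contra hcon
  have he : ((({x} : Finset (E d)) : Set (E d)) ∩ (T : Set (E d))) = ∅ := by
    ext z
    simp only [Finset.coe_singleton, mem_inter_iff, mem_singleton_iff, Finset.mem_coe,
      mem_empty_iff_false, iff_false, not_and]
    rintro rfl
    exact hcon
  rw [he, convexHull_empty] at this
  exact this

/-- The cells which contain the node `x`. -/
abbrev cellsAt (M : Mesh Ω) (x : E d) : Finset (Finset (E d)) :=
  open Classical in M.cells.filter fun T => x ∈ T

theorem mem_cellsAt {x : E d} {T : Finset (E d)} : T ∈ M.cellsAt x ↔ T ∈ M.cells ∧ x ∈ T :=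
  Finset.mem_filter

/-- Contract all cells at `x` towards `x` to the size of the smallest one. Their inscribed balls
contain disjoint balls of radius `δ / ρ` inside the ball of radius `δ + δ / ρ` about `x`, and
volumes are compared. No comparability of the diameters is presupposed. -/
theorem IsShapeRegular.card_cellsAt_le {ρ : ℝ} (hM : M.IsShapeRegular ρ) (hρ : 0 < ρ)
    (hd : 0 < d) (x : E d) : ((M.cellsAt x).card : ℝ) ≤ (ρ + 1) ^ d := by
  rcases (M.cellsAt x).eq_empty_or_nonempty with h0 | h0
  · rw [h0, Finset.card_empty, Nat.cast_zero]
    positivity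
  obtain ⟨T₀, hT₀, hmin⟩ := Finset.exists_min_image (M.cellsAt x) hdiam h0
  set δ := hdiam T₀
  have hδ : 0 < δ := M.hdiam_pos hd (mem_cellsAt.1 hT₀).1
  have hballs : ∀ T ∈ M.cellsAt x, ∃ w, Metric.ball w (δ / ρ) ⊆ interior (hull T) ∧
      Metric.ball w (δ / ρ) ⊆ Metric.ball x (δ + δ / ρ) := by
    intro T hT
    obtain ⟨hTc, hxT⟩ := mem_cellsAt.1 hT
    obtain ⟨x₀, hx₀, hb, hb'⟩ := hM.exists_ball hρ hTc
    have hh := M.hdiam_pos hd hTc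
    have hδh : δ ≤ hdiam T := hmin T hT
    have hq : 0 < δ / hdiam T := div_pos hδ hh
    refine ⟨x + (δ / hdiam T) • (x₀ - x), ?_, ?_⟩
    · refine interior_maximal (fun y hy => ?_) Metric.isOpen_ball
      rw [Metric.mem_ball, dist_eq_norm] at hy
      have h1 : x + (δ / hdiam T)⁻¹ • (y - x) ∈ hull T := by
        refine hb ?_
        rw [Metric.mem_closedBall, dist_eq_norm]
        have : x + (δ / hdiam T)⁻¹ • (y - x) - x₀ =
            (δ / hdiam T)⁻¹ • (y - (x + (δ / hdiam T) • (x₀ - x))) := by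
          rw [← sub_sub, smul_sub _ (y - x), inv_smul_smul₀ hq.ne']
          abel
        rw [this, norm_smul, norm_inv, Real.norm_of_nonneg hq.le, inv_mul_le_iff₀ hq]
        refine hy.le.trans_eq ?_
        field_simp
      have h2 := (convex_convexHull ℝ (T : Set (E d))).add_smul_sub_mem (subset_hull T hxT) h1
        (t := δ / hdiam T) ⟨hq.le, (div_le_one hh).2 hδh⟩
      rw [add_sub_cancel_left, smul_inv_smul₀ hq.ne', add_sub_cancel] at h2
      exact h2
    · refine Metric.ball_subset_ball' ?_
      rw [dist_eq_norm, add_sub_cancel_left, norm_smul, Real.norm_of_nonneg hq.le]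
      have h1 : ‖x₀ - x‖ ≤ hdiam T := dist_le_hdiam hx₀ (subset_hull T hxT)
      have : δ / hdiam T * ‖x₀ - x‖ ≤ δ := by
        rw [div_mul_eq_mul_div, div_le_iff₀ hh]
        gcongr
      linarith
  choose! w hw hw' using hballs
  have hV : 0 < volume.real (Metric.ball (0 : E d) 1) :=
    ENNReal.toReal_pos (Metric.measure_ball_pos _ _ one_pos).ne' measure_ball_lt_top.ne
  have h1 : volume.real (⋃ T ∈ M.cellsAt x, Metric.ball (w T) (δ / ρ)) =
      ∑ T ∈ M.cellsAt x, volume.real (Metric.ball (w T) (δ / ρ)) := by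
    refine measureReal_biUnion_finset (fun T hT T' hT' hne => ?_)
      (fun T _ => measurableSet_ball) (fun T _ => measure_ball_lt_top.ne)
    exact (M.disjoint_interior (mem_cellsAt.1 hT).1 (mem_cellsAt.1 hT').1 hne).mono
      (hw T hT) (hw T' hT')
  have h2 : volume.real (⋃ T ∈ M.cellsAt x, Metric.ball (w T) (δ / ρ)) ≤
      volume.real (Metric.ball x (δ + δ / ρ)) :=
    measureReal_mono (iUnion₂_subset hw') measure_ball_lt_top.ne
  have hr : 0 ≤ δ / ρ := by positivity
  rw [h1] at h2
  have : Nonempty (Fin d) := ⟨⟨0, hd⟩⟩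
  have : Nontrivial (E d) := Module.nontrivial_of_finrank_pos (R := ℝ)
    (by rwa [finrank_euclideanSpace_fin])
  simp only [← Measure.addHaar_real_closedBall_eq_addHaar_real_ball volume _ (δ / ρ),
    ← Measure.addHaar_real_closedBall_eq_addHaar_real_ball volume _ (δ + δ / ρ),
    Measure.addHaar_real_closedBall volume _ hr,
    Measure.addHaar_real_closedBall volume _ (by positivity : (0 : ℝ) ≤ δ + δ / ρ),
    finrank_euclideanSpace_fin, Finset.sum_const, nsmul_eq_mul] at h2
  rw [← mul_assoc] at h2
  have h3 := le_of_mul_le_mul_right h2 hV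
  have h4 : (δ + δ / ρ) ^ d = (ρ + 1) ^ d * (δ / ρ) ^ d := by
    rw [← mul_pow]
    congr 1
    field_simp
  rw [h4] at h3
  exact le_of_mul_le_mul_right h3 (by positivity)

theorem exists_common_vertex {A B : Finset (E d)} (hA : A ∈ M.cells) (hB : B ∈ M.cells)
    {x z : E d} (hz : z ∈ hull A) (hz' : z ∈ hull B) (hne : z ≠ x) :
    ∃ y, y ≠ x ∧ y ∈ A ∧ y ∈ B := by
  classical
  have h := M.mem_hull_inter hA hB hz hz'
  by_contra hcon
  push Not at hcon
  have hsub : hull (A ∩ B) ⊆ {x} := by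
    refine hull_subset_of_convex (convex_singleton x) fun y hy => ?_
    rw [Finset.mem_inter] at hy
    by_contra hyx
    exact hcon y hyx hy.1 hy.2
  exact hne (hsub h)

/-- The graph of the cells at a node, two of them being adjacent if they share an edge. -/
def patchGraph (M : Mesh Ω) (x : E d) : SimpleGraph (M.cellsAt x) where
  Adj A B := A ≠ B ∧ ∃ y, y ≠ x ∧ y ∈ A.1 ∧ y ∈ B.1
  symm := ⟨fun _ _ h => ⟨h.1.symm, h.2.imp fun _ hy => ⟨hy.1, hy.2.2, hy.2.1⟩⟩⟩
  loopless := ⟨fun _ h => h.1 rfl⟩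

/-- The union of the finitely many cells without the vertex `x` is closed and does not contain `x`.
-/
theorem exists_nearby_in_patch {x : E d} (hx : x ∈ M.nodes) :
    ∃ δ > 0, ∀ z ∈ closure Ω, ‖z - x‖ < δ → ∃ T ∈ M.cellsAt x, z ∈ hull T := by
  classical
  let W : Set (E d) := ⋃ T ∈ M.cells.filter (fun T => x ∉ T), hull T
  have hW : IsClosed W := by
    refine (Finset.finite_toSet _).isClosed_biUnion fun T _ => (isCompact_hull T).isClosed
  have hxW : x ∉ W := by
    simp only [W, mem_iUnion, exists_prop, Finset.mem_filter, not_exists, not_and]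
    exact fun T hT hxT => hT.2 (mem_of_mem_hull hx hT.1 hxT)
  obtain ⟨δ, hδ, hb⟩ := Metric.isOpen_iff.1 hW.isOpen_compl x hxW
  refine ⟨δ, hδ, fun z hz hzx => ?_⟩
  obtain ⟨T, hT, hzT⟩ := M.exists_cell_of_mem hz
  refine ⟨T, mem_cellsAt.2 ⟨hT, ?_⟩, hzT⟩
  by_contra hxT
  refine hb (by rwa [Metric.mem_ball, dist_eq_norm] : z ∈ Metric.ball x δ) ?_
  exact mem_biUnion (Finset.mem_coe.2 (Finset.mem_filter.2 ⟨hT, hxT⟩)) hzT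

/-- Join points of the two cells close to `x` by a segment that misses `x`; by convexity it stays in
the patch. If some cells were unreachable, connectedness would give a point of the segment lying in
a reachable and in an unreachable cell. As this point is not `x`, the two cells share a second
vertex, hence an edge at `x`. -/
theorem patchGraph_reachable (hΩ : IsConvexPolytopalDomain Ω) (hd : 2 ≤ d) {x : E d}
    (hx : x ∈ M.nodes) (T T' : M.cellsAt x) : (M.patchGraph x).Reachable T T' := by
  classical
  have hT := mem_cellsAt.1 T.2
  have hT' := mem_cellsAt.1 T'.2
  obtain ⟨δ, hδ, hnear⟩ := exists_nearby_in_patch hx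
  obtain ⟨a, ha, hax⟩ := exists_mem_open_not_mem_span hd isOpen_interior
    (M.interior_hull_nonempty hT.1) x 0
  obtain ⟨b, hb, hbx⟩ := exists_mem_open_not_mem_span hd isOpen_interior
    (M.interior_hull_nonempty hT'.1) x (a - x)
  have hax' : a - x ≠ 0 := fun h => hax (by rw [h]; exact Submodule.zero_mem _)
  set θ := min 1 (δ / (2 * (‖a - x‖ + ‖b - x‖ + 1))) with hθ
  have hθ0 : 0 < θ := lt_min one_pos (by positivity)
  have hθ1 : θ ≤ 1 := min_le_left _ _
  have hθδ : θ * (‖a - x‖ + ‖b - x‖ + 1) < δ := by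
    have h1 : θ ≤ δ / (2 * (‖a - x‖ + ‖b - x‖ + 1)) := min_le_right _ _
    rw [le_div_iff₀ (by positivity)] at h1
    linarith
  set a' := x + θ • (a - x) with ha'
  set b' := x + θ • (b - x) with hb'
  have haT : a' ∈ hull (T : Finset (E d)) := interior_subset
    ((convex_convexHull ℝ _).add_smul_sub_mem_interior (subset_hull _ hT.2) ha ⟨hθ0, hθ1⟩)
  have hbT : b' ∈ hull (T' : Finset (E d)) := interior_subset
    ((convex_convexHull ℝ _).add_smul_sub_mem_interior (subset_hull _ hT'.2) hb ⟨hθ0, hθ1⟩)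
  have hseg1 : segment ℝ a' b' ⊆ closure Ω := hΩ.convex.closure.segment_subset
    (M.cells_subset_closure hT.1 haT) (M.cells_subset_closure hT'.1 hbT)
  have hnorm : ∀ w : E d, ‖w‖ ≤ ‖a - x‖ + ‖b - x‖ → x + θ • w ∈ Metric.ball x δ := by
    intro w hw
    rw [Metric.mem_ball, dist_eq_norm, add_sub_cancel_left, norm_smul, Real.norm_of_nonneg hθ0.le]
    nlinarith
  have hseg2 : segment ℝ a' b' ⊆ Metric.ball x δ := (convex_ball x δ).segment_subset
    (hnorm _ (by linarith [norm_nonneg (b - x)])) (hnorm _ (by linarith [norm_nonneg (a - x)]))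
  -- If `x` were on the segment, `b - x` would be a multiple of `a - x`, which the choice of `b`
  -- excludes.
  have hseg3 : x ∉ segment ℝ a' b' := by
    rintro ⟨s, t, hs, ht, hst, h⟩
    have h1 : s • (a - x) + t • (b - x) = 0 := by
      have h2 : θ • (s • (a - x) + t • (b - x)) = 0 := by
        have h3 : s • a' + t • b' = (s + t) • x + θ • (s • (a - x) + t • (b - x)) := by
          simp only [ha', hb']
          module
        rw [h3, hst, one_smul] at h
        simpa using h
      exact (smul_eq_zero.1 h2).resolve_left hθ0.ne'
    rcases eq_or_ne t 0 with rfl | ht0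
    · rw [add_zero] at hst
      rw [hst, one_smul, zero_smul, add_zero] at h1
      exact hax' h1
    · refine hbx (Submodule.mem_span_singleton.2 ⟨-(t⁻¹ * s), ?_⟩)
      have h2 : t • (b - x) = -(s • (a - x)) := by
        rw [eq_neg_iff_add_eq_zero, add_comm]
        exact h1
      rw [neg_smul, mul_smul, ← smul_neg, ← h2, inv_smul_smul₀ ht0]
  by_contra hcon
  let 𝒞 := (Finset.univ : Finset (M.cellsAt x)).filter fun A => (M.patchGraph x).Reachable T A
  let 𝒟 := (Finset.univ : Finset (M.cellsAt x)).filter fun A => ¬(M.patchGraph x).Reachable T A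
  have hpre : IsPreconnected (segment ℝ a' b') := (convex_segment a' b').isPreconnected
  obtain ⟨z, hz, hz1, hz2⟩ := isPreconnected_closed_iff.1 hpre
    (⋃ A ∈ 𝒞, hull (A : Finset (E d))) (⋃ A ∈ 𝒟, hull (A : Finset (E d)))
    ((Finset.finite_toSet _).isClosed_biUnion fun A _ => (isCompact_hull _).isClosed)
    ((Finset.finite_toSet _).isClosed_biUnion fun A _ => (isCompact_hull _).isClosed)
    (fun z hz => by
      obtain ⟨A, hA, hzA⟩ := hnear z (hseg1 hz) (by
        rw [← dist_eq_norm]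
        exact hseg2 hz)
      by_cases h : (M.patchGraph x).Reachable T ⟨A, hA⟩
      · exact Or.inl (mem_biUnion (x := (⟨A, hA⟩ : M.cellsAt x)) (by simp [𝒞, h]) hzA)
      · exact Or.inr (mem_biUnion (x := (⟨A, hA⟩ : M.cellsAt x)) (by simp [𝒟, h]) hzA))
    ⟨a', left_mem_segment _ _ _, mem_biUnion (x := T) (by simp [𝒞]) haT⟩
    ⟨b', right_mem_segment _ _ _, mem_biUnion (x := T') (by simp [𝒟, hcon]) hbT⟩
  simp only [mem_iUnion, exists_prop] at hz1 hz2
  obtain ⟨A, hA, hzA⟩ := hz1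
  obtain ⟨B, hB, hzB⟩ := hz2
  have hA' : (M.patchGraph x).Reachable T A := (Finset.mem_filter.1 hA).2
  have hB' : ¬(M.patchGraph x).Reachable T B := (Finset.mem_filter.1 hB).2
  obtain ⟨y, hy⟩ := exists_common_vertex (mem_cellsAt.1 A.2).1 (mem_cellsAt.1 B.2).1 hzA hzB
    (x := x) (fun h => hseg3 (h ▸ hz))
  refine hB' (hA'.trans (SimpleGraph.Adj.reachable ⟨?_, y, hy⟩))
  rintro rfl
  exact hB' hA'

/-- Adjacent cells share an edge at `x`. By shape regularity one diameter is at most `ρ` times its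
length, and the other is at least its length, so each step costs at most a factor `ρ + 1`. -/
theorem IsShapeRegular.hdiam_le_of_walk {ρ : ℝ} (hM : M.IsShapeRegular ρ) (hρ : 0 < ρ)
    (hd : 0 < d) {x : E d} {T T' : M.cellsAt x} (p : (M.patchGraph x).Walk T T') :
    hdiam (T : Finset (E d)) ≤ (ρ + 1) ^ p.length * hdiam (T' : Finset (E d)) := by
  induction p with
  | nil => simp
  | @cons A B C hAB p ih =>
    obtain ⟨y, hyx, hyA, hyB⟩ := hAB.2
    have hA := mem_cellsAt.1 A.2
    have hB := mem_cellsAt.1 B.2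
    have h1 := hM.hdiam_le_edge hρ hd hA.1 hA.2 hyA hyx.symm
    have h2 : ‖x - y‖ ≤ hdiam (B : Finset (E d)) :=
      dist_le_hdiam (subset_hull _ hB.2) (subset_hull _ hyB)
    have h3 : (0 : ℝ) ≤ hdiam (B : Finset (E d)) := Metric.diam_nonneg
    rw [SimpleGraph.Walk.length_cons, pow_succ']
    calc hdiam (A : Finset (E d)) ≤ (ρ + 1) * hdiam (B : Finset (E d)) := by nlinarith
      _ ≤ (ρ + 1) * ((ρ + 1) ^ p.length * hdiam (C : Finset (E d))) := by gcongr
      _ = _ := by ring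

/-- A path meets each cell at `x` at most once, so its length is bounded by their number, which
`card_cellsAt_le` controls. -/
theorem exists_hdiam_comparable {ρ : ℝ} (hρ : 0 < ρ) (hd : 2 ≤ d) :
    ∃ C : ℝ, 1 ≤ C ∧ ∀ (Ω : Set (E d)), IsConvexPolytopalDomain Ω → ∀ M : Mesh Ω,
      M.IsShapeRegular ρ → ∀ x, ∀ T ∈ M.cellsAt x, ∀ T' ∈ M.cellsAt x,
        hdiam T ≤ C * hdiam T' := by
  refine ⟨(ρ + 1) ^ ⌊(ρ + 1) ^ d⌋₊, one_le_pow₀ (by linarith), fun Ω hΩ M hM x T hT T' hT' => ?_⟩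
  have hx := M.mem_nodes_of_mem_cell (mem_cellsAt.1 hT).1 (mem_cellsAt.1 hT).2
  obtain ⟨p, hp⟩ := (patchGraph_reachable hΩ hd hx ⟨T, hT⟩ ⟨T', hT'⟩).exists_isPath
  refine (hM.hdiam_le_of_walk hρ (by omega) p).trans ?_
  refine mul_le_mul_of_nonneg_right ?_ Metric.diam_nonneg
  refine pow_le_pow_right₀ (by linarith) ?_
  have h1 := hp.length_lt
  rw [Fintype.card_coe] at h1
  exact Nat.le_floor ((Nat.cast_le.2 h1.le).trans (hM.card_cellsAt_le hρ (by omega) x))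

/-- The cells which share a node with the cell `T`. -/
abbrev neighbors (M : Mesh Ω) (T : Finset (E d)) : Finset (Finset (E d)) :=
  open Classical in M.cells.filter fun T' => ∃ x ∈ T, x ∈ T'

theorem mem_neighbors {T T' : Finset (E d)} :
    T' ∈ M.neighbors T ↔ T' ∈ M.cells ∧ ∃ x ∈ T, x ∈ T' := Finset.mem_filter

theorem IsShapeRegular.card_neighbors_le {ρ : ℝ} (hM : M.IsShapeRegular ρ) (hρ : 0 < ρ)
    (hd : 0 < d) {T : Finset (E d)} (hT : T ∈ M.cells) :
    ((M.neighbors T).card : ℝ) ≤ (d + 1) * (ρ + 1) ^ d := by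
  classical
  have hsub : M.neighbors T ⊆ T.biUnion fun x => M.cellsAt x := by
    intro T' hT'
    obtain ⟨h, x, hx, hx'⟩ := mem_neighbors.1 hT'
    exact Finset.mem_biUnion.2 ⟨x, hx, mem_cellsAt.2 ⟨h, hx'⟩⟩
  have h1 : (M.neighbors T).card ≤ ∑ x ∈ T, (M.cellsAt x).card :=
    (Finset.card_le_card hsub).trans Finset.card_biUnion_le
  have h2 : ((M.neighbors T).card : ℝ) ≤ ∑ x ∈ T, ((M.cellsAt x).card : ℝ) := by exact_mod_cast h1
  refine h2.trans ((Finset.sum_le_sum fun x _ => hM.card_cellsAt_le hρ hd x).trans_eq ?_)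
  rw [Finset.sum_const, (M.mem_cells.1 hT).2, nsmul_eq_mul]
  push_cast
  ring

end Mesh

/-! ### Boundary behaviour of the gradient -/

namespace Mesh

variable {M : Mesh Ω}

theorem iteratedFDerivWithin_eq_piece {T : Finset (E d)} (hT : T ∈ M.cells) {v f : E d → ℝ}
    (hf : ContDiff ℝ (⊤ : ℕ∞) f) (hvf : EqOn v f (hull T)) {x : E d} (hx : x ∈ hull T) (m : ℕ) :
    iteratedFDerivWithin ℝ m v (hull T) x = iteratedFDeriv ℝ m f x := by
  rw [iteratedFDerivWithin_congr hvf hx,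
    iteratedFDerivWithin_eq_iteratedFDeriv (M.uniqueDiffOn_hull hT)
      (hf.contDiffAt.of_le (by exact_mod_cast le_top)) hx]

theorem fderiv_eq_of_isCmAt {k : ℕ} {v : E d → ℝ} {x : E d} (h : M.IsCmAt 1 v x)
    {T T' : Finset (E d)} (hT : T ∈ M.cells) (hT' : T' ∈ M.cells) {f f' : E d → ℝ}
    (hf : IsPoly k f) (hf' : IsPoly k f') (hvf : EqOn v f (hull T)) (hvf' : EqOn v f' (hull T'))
    (hx : x ∈ hull T) (hx' : x ∈ hull T') : fderiv ℝ f x = fderiv ℝ f' x := by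
  have h1 := h T hT T' hT' hx hx' 1 le_rfl
  rw [iteratedFDerivWithin_eq_piece hT hf.contDiff hvf hx,
    iteratedFDerivWithin_eq_piece hT' hf'.contDiff hvf' hx'] at h1
  ext t
  have h2 := congrArg (fun S => S fun _ => t) h1
  simpa using h2

/-- `closure Ω` is a finite union of cells. Those containing `x` have a common derivative there, and
the others stay away from `x`. -/
theorem hasFDerivWithinAt_closure {k : ℕ} {v : E d → ℝ} (hv : v ∈ M.piecewisePoly k) {x : E d}
    (h : M.IsCmAt 1 v x) {T : Finset (E d)} (hT : T ∈ M.cells) {f : E d → ℝ} (hf : IsPoly k f)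
    (hvf : EqOn v f (hull T)) (hx : x ∈ hull T) :
    HasFDerivWithinAt v (fderiv ℝ f x) (closure Ω) x := by
  have key : ∀ S : Finset (Finset (E d)), S ⊆ M.cells →
      HasFDerivWithinAt v (fderiv ℝ f x) (⋃ A ∈ S, hull A) x := by
    classical
    intro S
    induction S using Finset.induction_on with
    | empty => intro _; simp
    | insert A S _ ih =>
      intro hS
      rw [Finset.set_biUnion_insert]
      refine HasFDerivWithinAt.union ?_ (ih fun B hB => hS (Finset.mem_insert_of_mem hB))
      have hA : A ∈ M.cells := hS (Finset.mem_insert_self _ _)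
      by_cases hxA : x ∈ hull A
      · obtain ⟨g, hg, hvg⟩ := exists_piece hv hA
        rw [fderiv_eq_of_isCmAt h hT hA hf hg hvf hvg hx hxA]
        exact ((hg.contDiff.differentiable (by simp) x).hasFDerivAt.hasFDerivWithinAt).congr
          hvg (hvg hxA)
      · refine HasFDerivWithinAt.of_notMem_closure ?_
        rwa [(isCompact_hull A).isClosed.closure_eq]
  rw [M.closure_eq]
  exact key _ subset_rfl

end Mesh

/-- The point `y + ε • τ` lies on a supporting hyperplane, hence off `Ω`. Unless it is already in
the closure, pushing it inward along `w` reaches `Ω` at `a = C`, so the boundary is met on the way.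
What matters is that `C` is independent of `ε`. -/
theorem exists_frontier_near {y n τ w : E d} (hΩ : IsConvexPolytopalDomain Ω)
    (hy : y ∈ closure Ω) (hn : ∀ z ∈ Ω, inner ℝ (z - y) n < 0) (hτ : inner ℝ τ n = 0)
    (hw : y + w ∈ Ω) :
    ∃ C : ℝ, 0 < C ∧ ∃ ε₀ : ℝ, 0 < ε₀ ∧ ∀ ε : ℝ, 0 < ε → ε ≤ ε₀ →
      ∃ a : ℝ, 0 ≤ a ∧ a ≤ C ∧ y + ε • (τ + a • w) ∈ closure Ω ∧ y + ε • (τ + a • w) ∉ Ω := by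
  obtain ⟨r, hr, hball⟩ := Metric.isOpen_iff.1 hΩ.isOpen _ hw
  -- So large that `y + w + C⁻¹ • τ` stays in the ball of radius `r` about `y + w`.
  set C := (‖τ‖ + 1) / r with hC
  have hC0 : 0 < C := by positivity
  refine ⟨C, hC0, C⁻¹, inv_pos.2 hC0, fun ε hε hεC => ?_⟩
  have h0 : y + ε • (τ + (0 : ℝ) • w) ∉ Ω := by
    intro h
    have := hn _ h
    rw [add_sub_cancel_left, zero_smul, add_zero, inner_smul_left, hτ, mul_zero] at this
    exact lt_irrefl _ this
  by_cases hcl : y + ε • (τ + (0 : ℝ) • w) ∈ closure Ω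
  · exact ⟨0, le_rfl, hC0.le, hcl, h0⟩
  have hCΩ : y + ε • (τ + C • w) ∈ Ω := by
    have h1 : y + w + C⁻¹ • τ ∈ Ω := by
      refine hball ?_
      rw [Metric.mem_ball, dist_eq_norm, add_sub_cancel_left, norm_smul, norm_inv,
        Real.norm_of_nonneg hC0.le, inv_mul_lt_iff₀ hC0, hC, div_mul_cancel₀ _ hr.ne']
      linarith
    have h2 := hΩ.convex.add_smul_sub_mem_interior' hy (hΩ.isOpen.interior_eq.symm ▸ h1)
      (t := ε * C) ⟨by positivity, by rwa [← le_div_iff₀ hC0, one_div]⟩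
    rw [hΩ.isOpen.interior_eq] at h2
    convert h2 using 1
    rw [show y + w + C⁻¹ • τ - y = C⁻¹ • τ + w by abel, mul_smul, smul_add C,
      smul_inv_smul₀ hC0.ne']
  by_contra hcon
  push Not at hcon
  have hpre : IsPreconnected ((fun a : ℝ => y + ε • (τ + a • w)) '' Icc 0 C) :=
    isPreconnected_Icc.image _ (by fun_prop)
  obtain ⟨z, -, hz1, hz2⟩ := hpre Ω (closure Ω)ᶜ hΩ.isOpen isClosed_closure.isOpen_compl
    (by
      rintro _ ⟨a, ha, rfl⟩
      by_cases h : y + ε • (τ + a • w) ∈ closure Ω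
      · exact Or.inl (hcon a ha.1 ha.2 h)
      · exact Or.inr h)
    ⟨_, ⟨C, right_mem_Icc.2 hC0.le, rfl⟩, hCΩ⟩ ⟨_, ⟨0, left_mem_Icc.2 hC0.le, rfl⟩, hcl⟩
  exact hz2 (subset_closure hz1)

-- At the boundary points `y + ε • (τ + a • w)` the function vanishes and `a` is bounded, so `g τ +
-- a * g w` must be small with `ε`. But it is at least `g τ`.
open Filter Topology in
theorem not_pos_of_vanish_frontier {y n τ w : E d} (hΩ : IsConvexPolytopalDomain Ω)
    (hy : y ∈ closure Ω) (hyΩ : y ∉ Ω)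
    (hn : ∀ z ∈ Ω, inner ℝ (z - y) n < 0) (hτ : inner ℝ τ n = 0)
    (hw : y + w ∈ Ω) {v : E d → ℝ} (hv0 : ∀ x ∉ Ω, v x = 0) {g : E d →L[ℝ] ℝ}
    (hg : HasFDerivWithinAt v g (closure Ω) y) (h1 : 0 < g τ) (h2 : 0 ≤ g w) : False := by
  obtain ⟨C, hC, ε₀, hε₀, hex⟩ := exists_frontier_near hΩ hy hn hτ hw
  set D := ‖τ‖ + C * ‖w‖ + 1 with hD
  have hDpos : 0 < D := by positivity
  have hlo := (hasFDerivWithinAt_iff_isLittleO.1 hg).def (c := g τ / (2 * D)) (by positivity)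
  rw [eventually_nhdsWithin_iff, Metric.eventually_nhds_iff] at hlo
  obtain ⟨δ, hδ, hlo⟩ := hlo
  set ε := min ε₀ (δ / (2 * D))
  have hε : 0 < ε := lt_min hε₀ (by positivity)
  obtain ⟨a, ha, haC, hcl, hnot⟩ := hex ε hε (min_le_left _ _)
  have hnorm : ‖τ + a • w‖ ≤ D := by
    refine (norm_add_le _ _).trans ?_
    rw [norm_smul, Real.norm_of_nonneg ha]
    have : a * ‖w‖ ≤ C * ‖w‖ := by gcongr
    linarith
  have h3 := hlo (y := y + ε • (τ + a • w)) (by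
    rw [dist_eq_norm, add_sub_cancel_left, norm_smul, Real.norm_of_nonneg hε.le]
    have h4 : ε ≤ δ / (2 * D) := min_le_right _ _
    rw [le_div_iff₀ (by positivity)] at h4
    nlinarith) hcl
  rw [hv0 _ hnot, hv0 _ hyΩ, add_sub_cancel_left, norm_smul, map_smul, smul_eq_mul,
    Real.norm_of_nonneg hε.le, map_add, map_smul, smul_eq_mul] at h3
  simp only [sub_self, zero_sub, norm_neg, norm_mul, Real.norm_eq_abs, abs_of_pos hε] at h3
  have h5 : g τ ≤ |g τ + a * g w| := (le_abs_self _).trans' (by nlinarith [mul_nonneg ha h2])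
  have h6 : g τ / (2 * D) * (ε * ‖τ + a • w‖) ≤ ε * (g τ / 2) := by
    have : g τ / (2 * D) * (ε * ‖τ + a • w‖) ≤ g τ / (2 * D) * (ε * D) := by gcongr
    refine this.trans_eq ?_
    field_simp
  have h7 : ε * g τ ≤ ε * (g τ / 2) := by
    refine le_trans ?_ (h3.trans h6)
    gcongr
  have := le_of_mul_le_mul_left h7 hε
  linarith

/-- A function which vanishes outside `Ω` has a normal gradient at the boundary. -/
theorem fderiv_eq_zero_of_tangential {y n τ : E d} (hΩ : IsConvexPolytopalDomain Ω)
    (hy : y ∈ closure Ω) (hyΩ : y ∉ Ω) (hn0 : n ≠ 0)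
    (hn : ∀ z ∈ Ω, inner ℝ (z - y) n ≤ 0) (hτ : inner ℝ τ n = 0)
    {v : E d → ℝ} (hv0 : ∀ x ∉ Ω, v x = 0) {g : E d →L[ℝ] ℝ}
    (hg : HasFDerivWithinAt v g (closure Ω) y) : g τ = 0 := by
  -- Points of the open set `Ω` can still be moved a little along `n`, so the inequality is strict.
  have hn' : ∀ z ∈ Ω, inner ℝ (z - y) n < 0 := by
    intro z hz
    obtain ⟨r, hr, hball⟩ := Metric.isOpen_iff.1 hΩ.isOpen _ hz
    have hnn : 0 < ‖n‖ := norm_pos_iff.2 hn0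
    have h1 := hn (z + (r / (2 * ‖n‖)) • n) (hball (by
      rw [Metric.mem_ball, dist_eq_norm, add_sub_cancel_left, norm_smul,
        Real.norm_of_nonneg (by positivity)]
      have : r / (2 * ‖n‖) * ‖n‖ = r / 2 := by field_simp
      linarith))
    rw [add_sub_right_comm, inner_add_left, inner_smul_left, real_inner_self_eq_norm_sq] at h1
    have : 0 < r / (2 * ‖n‖) * ‖n‖ ^ 2 := by positivity
    simp only [conj_trivial] at h1
    linarith
  obtain ⟨z, hz⟩ := hΩ.nonempty
  have hw : y + (z - y) ∈ Ω := by rwa [add_sub_cancel]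
  have hτ' : inner ℝ (-τ) n = (0 : ℝ) := by rw [inner_neg_left, hτ, neg_zero]
  have hng : HasFDerivWithinAt (-v) (-g) (closure Ω) y := hg.neg
  have hnv0 : ∀ x ∉ Ω, (-v) x = 0 := fun x hx => by simp [hv0 x hx]
  -- Changing the signs of `τ` and of `v` yields all sign patterns of `g τ` and `g (z - y)`; each of
  -- the four applications excludes one.
  have a1 := not_pos_of_vanish_frontier hΩ hy hyΩ hn' hτ hw hv0 hg
  have a2 := not_pos_of_vanish_frontier hΩ hy hyΩ hn' hτ' hw hv0 hg
  have a3 := not_pos_of_vanish_frontier hΩ hy hyΩ hn' hτ hw hnv0 hng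
  have a4 := not_pos_of_vanish_frontier hΩ hy hyΩ hn' hτ' hw hnv0 hng
  simp only [_root_.neg_apply, map_neg, neg_neg] at a1 a2 a3 a4
  rcases lt_trichotomy (g τ) 0 with h | h | h
  · rcases le_total 0 (g (z - y)) with h' | h'
    · exact (a2 (by linarith) h').elim
    · exact (a3 (by linarith) (by linarith)).elim
  · exact h
  · rcases le_total 0 (g (z - y)) with h' | h'
    · exact (a1 h h').elim
    · exact (a4 h (by linarith)).elim

/-- Separating the open convex set `Ω` from the disjoint convex set `D` produces such a normal, so
the `epsilon` choice meets its specification. -/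
theorem outerNormal_spec (hΩ : IsConvexPolytopalDomain Ω) {D : Set (E d)} (hD : Convex ℝ D)
    (hne : D.Nonempty) (hdisj : Disjoint Ω D) :
    ‖outerNormal Ω D‖ = 1 ∧ ∀ x ∈ D, ∀ y ∈ Ω, inner ℝ (y - x) (outerNormal Ω D) ≤ 0 := by
  refine Classical.epsilon_spec (p := fun n : E d =>
    ‖n‖ = 1 ∧ ∀ x ∈ D, ∀ y ∈ Ω, inner ℝ (y - x) n ≤ 0) ?_
  obtain ⟨f, u, hf, hf'⟩ := geometric_hahn_banach_open hΩ.convex hΩ.isOpen hD hdisj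
  set n := (InnerProductSpace.toDual ℝ (E d)).symm f with hn
  have hfn : ∀ z, inner ℝ z n = f z := fun z => by
    rw [real_inner_comm, hn, InnerProductSpace.toDual_symm_apply]
  have hn0 : n ≠ 0 := by
    intro h0
    obtain ⟨x, hx⟩ := hne
    obtain ⟨y, hy⟩ := hΩ.nonempty
    have h1 := hfn x
    have h2 := hfn y
    rw [h0, inner_zero_right] at h1 h2
    have := hf y hy
    have := hf' x hx
    linarith
  have hnn : 0 < ‖n‖ := norm_pos_iff.2 hn0
  refine ⟨‖n‖⁻¹ • n, ?_, fun x hx y hy => ?_⟩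
  · rw [norm_smul, norm_inv, norm_norm, inv_mul_cancel₀ hnn.ne']
  · rw [inner_smul_right, hfn, map_sub]
    have := hf y hy
    have := hf' x hx
    exact mul_nonpos_of_nonneg_of_nonpos (by positivity) (by linarith)

/-! ### The reference simplex -/

/-- The reference simplex in `ℝ^j`. -/
def refSimplex (j : ℕ) : Set (Fin j → ℝ) := {s | (∀ i, 0 ≤ s i) ∧ ∑ i, s i ≤ 1}

theorem isCompact_refSimplex (j : ℕ) : IsCompact (refSimplex j) := by
  have hsub : refSimplex j ⊆ Icc 0 1 := by
    rintro s ⟨h0, h1⟩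
    refine ⟨h0, fun i => ?_⟩
    exact (Finset.single_le_sum (fun i _ => h0 i) (Finset.mem_univ i)).trans h1
  refine isCompact_Icc.of_isClosed_subset ?_ hsub
  have : refSimplex j = (⋂ i, {s : Fin j → ℝ | 0 ≤ s i}) ∩ {s | ∑ i, s i ≤ 1} := by
    ext s
    simp [refSimplex]
  rw [this]
  exact (isClosed_iInter fun i => isClosed_le continuous_const (continuous_apply i)).inter
    (isClosed_le (by fun_prop) continuous_const)

theorem refBoundary_subset (j : ℕ) : refBoundary j ⊆ refSimplex j := fun _ hx => ⟨hx.1, hx.2.1⟩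

theorem eq_zero_of_refSimplex {j : ℕ} {q : MvPolynomial (Fin j) ℝ}
    (h : ∀ x ∈ refSimplex j, MvPolynomial.eval x q = 0) : q = 0 := by
  -- A cube of side `1 / (j + 1)` fits into the simplex; `j + 1` in place of `j` includes `j = 0`.
  have hpos : (0 : ℝ) < 1 / (j + 1) := by positivity
  refine MvPolynomial.funext_set (s := fun _ => Icc (0 : ℝ) (1 / (j + 1)))
    (fun _ => Icc_infinite hpos) fun x hx => ?_
  rw [map_zero]
  refine h x ⟨fun i => (hx i trivial).1, ?_⟩
  refine (Finset.sum_le_sum fun i _ => (hx i trivial).2).trans ?_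
  rw [Finset.sum_const, Finset.card_univ, Fintype.card_fin, nsmul_eq_mul, mul_one_div,
    div_le_one (by positivity)]
  linarith

/-- The affine parametrization (its linear part) of the simplex with vertices `p 0, …, p j`. -/
def paramLin {j : ℕ} (p : Fin (j + 1) → E d) : (Fin j → ℝ) →L[ℝ] E d :=
  ∑ i, (ContinuousLinearMap.proj (R := ℝ) (φ := fun _ : Fin j => ℝ) i).smulRight (p i.succ - p 0)

theorem paramLin_apply {j : ℕ} (p : Fin (j + 1) → E d) (x : Fin j → ℝ) :
    paramLin p x = ∑ i, x i • (p i.succ - p 0) := by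
  simp [paramLin]

/-- The weights of a point of the reference simplex. -/
def refWeight {j : ℕ} (x : Fin j → ℝ) : Fin (j + 1) → ℝ := Fin.cons (1 - ∑ i, x i) x

theorem sum_refWeight {j : ℕ} (x : Fin j → ℝ) : ∑ i, refWeight x i = 1 := by
  simp [refWeight, Fin.sum_univ_succ]

theorem refWeight_nonneg {j : ℕ} {x : Fin j → ℝ} (hx : x ∈ refSimplex j) (i : Fin (j + 1)) :
    0 ≤ refWeight x i := by
  refine Fin.cases ?_ (fun i => ?_) i
  · simp [refWeight, hx.2]
  · simpa [refWeight] using hx.1 i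

theorem param_eq_sum {j : ℕ} (p : Fin (j + 1) → E d) (x : Fin j → ℝ) :
    paramLin p x + p 0 = ∑ i, refWeight x i • p i := by
  rw [paramLin_apply, Fin.sum_univ_succ]
  simp only [refWeight, Fin.cons_zero, Fin.cons_succ, smul_sub, Finset.sum_sub_distrib, sub_smul,
    one_smul, ← Finset.sum_smul]
  abel

theorem param_refVertex {j : ℕ} (p : Fin (j + 1) → E d) (i : Fin (j + 1)) :
    paramLin p (refVertex j i) + p 0 = p i := by
  rw [paramLin_apply]
  refine Fin.cases ?_ (fun i => ?_) i
  · simp [refVertex]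
  · simp only [refVertex, Fin.cons_succ]
    rw [Finset.sum_eq_single i]
    · simp
    · intro b _ hb
      simp [hb]
    · simp

theorem param_mem {j : ℕ} (p : Fin (j + 1) → E d) {x : Fin j → ℝ} (hx : x ∈ refSimplex j) :
    paramLin p x + p 0 ∈ convexHull ℝ (range p) := by
  rw [param_eq_sum]
  exact (convex_convexHull ℝ _).sum_mem (fun i _ => refWeight_nonneg hx i) (sum_refWeight x)
    fun i _ => subset_convexHull ℝ _ ⟨i, rfl⟩

theorem exists_param {j : ℕ} (p : Fin (j + 1) → E d) {y : E d} (hy : y ∈ convexHull ℝ (range p)) :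
    ∃ x ∈ refSimplex j, paramLin p x + p 0 = y := by
  have hconv : Convex ℝ (refSimplex j) := by
    intro x hx y hy a b ha hb hab
    refine ⟨fun i => ?_, ?_⟩
    · have := hx.1 i
      have := hy.1 i
      simp only [Pi.add_apply, Pi.smul_apply, smul_eq_mul]
      positivity
    · simp only [Pi.add_apply, Pi.smul_apply, smul_eq_mul, Finset.sum_add_distrib,
        ← Finset.mul_sum]
      nlinarith [hx.2, hy.2]
  have himg : Convex ℝ ((fun x => paramLin p x + p 0) '' refSimplex j) := by
    have h1 := (hconv.linear_image (paramLin p).toLinearMap).translate (p 0)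
    rw [image_image] at h1
    simp only [add_comm _ (p 0)]
    exact h1
  have hsub : convexHull ℝ (range p) ⊆ (fun x => paramLin p x + p 0) '' refSimplex j := by
    refine convexHull_min ?_ himg
    rintro _ ⟨i, rfl⟩
    refine ⟨refVertex j i, ?_, param_refVertex p i⟩
    refine Fin.cases ?_ (fun i => ?_) i
    · simp [refVertex, refSimplex]
    · simp only [refVertex, Fin.cons_succ]
      refine ⟨fun k => ?_, by simp⟩
      by_cases h : k = i
      · subst h; simp
      · simp [h]
  exact hsub hy

theorem param_boundary {j : ℕ} (p : Fin (j + 1) → E d) {x : Fin j → ℝ} (hx : x ∈ refBoundary j) :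
    ∃ i, paramLin p x + p 0 ∈ convexHull ℝ (p '' {i}ᶜ) := by
  classical
  have hx' := refBoundary_subset j hx
  obtain ⟨i, hi⟩ : ∃ i, refWeight x i = 0 := by
    rcases hx.2.2 with ⟨i, hi⟩ | h
    · exact ⟨i.succ, by simpa [refWeight] using hi⟩
    · exact ⟨0, by simp [refWeight, h]⟩
  refine ⟨i, ?_⟩
  have h1 := sum_refWeight x
  rw [← Finset.add_sum_erase _ _ (Finset.mem_univ i), hi, zero_add] at h1
  rw [param_eq_sum, ← Finset.add_sum_erase _ _ (Finset.mem_univ i), hi, zero_smul, zero_add]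
  refine (convex_convexHull ℝ _).sum_mem (fun k _ => refWeight_nonneg hx' k) h1 fun k hk => ?_
  exact subset_convexHull ℝ _ ⟨k, by simpa using hk, rfl⟩

/-! ### Averages -/

namespace RefDomain

/-- A point domain lies in the simplex. -/
def IsValid {j : ℕ} (r : RefDomain j) : Prop :=
  ∀ w, r = point w → (∀ i, 0 ≤ w i) ∧ ∑ i, w i = 1

theorem param_whole {j : ℕ} (p : Fin (j + 1) → E d) (s : Fin j → ℝ) :
    p 0 + ∑ i, s i • (p i.succ - p 0) = paramLin p s + p 0 := by
  rw [paramLin_apply, add_comm]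

theorem average_whole {j : ℕ} (p : Fin (j + 1) → E d) (f : E d → ℝ) :
    (whole : RefDomain j).average p f = ⨍ s in refSimplex j, f (paramLin p s + p 0) := by
  simp only [average, param_whole]
  rfl

theorem carrier_subset {j : ℕ} {r : RefDomain j} (hr : r.IsValid) (p : Fin (j + 1) → E d) :
    r.carrier p ⊆ convexHull ℝ (range p) := by
  cases r with
  | point w =>
    obtain ⟨h0, h1⟩ := hr w rfl
    rintro _ rfl
    exact (convex_convexHull ℝ _).sum_mem (fun i _ => h0 i) h1
      fun i _ => subset_convexHull ℝ _ ⟨i, rfl⟩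
  | whole => exact subset_rfl

theorem carrier_nonempty {j : ℕ} (r : RefDomain j) (p : Fin (j + 1) → E d) :
    (r.carrier p).Nonempty := by
  cases r with
  | point w => exact singleton_nonempty _
  | whole => exact (range_nonempty p).convexHull

theorem convex_carrier {j : ℕ} (r : RefDomain j) (p : Fin (j + 1) → E d) :
    Convex ℝ (r.carrier p) := by
  cases r with
  | point w => exact convex_singleton _
  | whole => exact convex_convexHull ℝ _

theorem average_congr {j : ℕ} (r : RefDomain j) (p : Fin (j + 1) → E d) {f g : E d → ℝ}
    (h : EqOn f g (r.carrier p)) : r.average p f = r.average p g := by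
  cases r with
  | point w => exact h rfl
  | whole =>
    rw [average_whole, average_whole]
    exact setAverage_congr_fun (isCompact_refSimplex j).measurableSet
      (Filter.Eventually.of_forall fun s hs => h (param_mem p hs))

theorem integrableOn_param {j : ℕ} (p : Fin (j + 1) → E d) {G : Type*} [NormedAddCommGroup G]
    {f : E d → G} (hf : Continuous f) :
    IntegrableOn (fun s => f (paramLin p s + p 0)) (refSimplex j) :=
  (hf.comp ((paramLin p).continuous.add continuous_const)).continuousOn.integrableOn_compact
    (isCompact_refSimplex j)

theorem average_add {j : ℕ} (r : RefDomain j) (p : Fin (j + 1) → E d) {f g : E d → ℝ}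
    (hf : Continuous f) (hg : Continuous g) :
    r.average p (f + g) = r.average p f + r.average p g := by
  cases r with
  | point w => rfl
  | whole =>
    simp only [average_whole, setAverage_eq, Pi.add_apply]
    rw [integral_add (integrableOn_param p hf) (integrableOn_param p hg), smul_add]

theorem average_smul {j : ℕ} (r : RefDomain j) (p : Fin (j + 1) → E d) (c : ℝ) (f : E d → ℝ) :
    r.average p (c • f) = c * r.average p f := by
  cases r with
  | point w => rfl
  | whole =>
    simp only [average_whole, setAverage_eq, Pi.smul_apply, smul_eq_mul]
    rw [integral_const_mul]
    ring

theorem abs_average_le {j : ℕ} (r : RefDomain j) (p : Fin (j + 1) → E d) {f : E d → ℝ} {B : ℝ}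
    (hB : 0 ≤ B) (h : ∀ y ∈ r.carrier p, |f y| ≤ B) : |r.average p f| ≤ B := by
  cases r with
  | point w => exact h _ rfl
  | whole =>
    rw [average_whole, setAverage_eq, smul_eq_mul, abs_mul, abs_of_nonneg (by positivity)]
    have h1 : ‖∫ s in refSimplex j, f (paramLin p s + p 0)‖ ≤
        B * volume.real (refSimplex j) :=
      norm_setIntegral_le_of_norm_le_const (isCompact_refSimplex j).measure_lt_top
        fun s hs => h _ (param_mem p hs)
    rw [Real.norm_eq_abs] at h1
    rw [inv_mul_eq_div]
    exact div_le_of_le_mul₀ measureReal_nonneg hB h1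

/-- Averaging commutes with evaluation, so the averaged derivative is itself a multilinear form,
which is the kind of object for which the conditioning of the directions is stated. -/
theorem exists_average_form {j m : ℕ} (r : RefDomain j) (p : Fin (j + 1) → E d) {f : E d → ℝ}
    (hf : ContDiff ℝ (⊤ : ℕ∞) f) :
    ∃ S : ContinuousMultilinearMap ℝ (fun _ : Fin m => E d) ℝ,
      ∀ t, S t = r.average p fun y => iteratedFDeriv ℝ m f y t := by
  have hc : Continuous (iteratedFDeriv ℝ m f) :=
    hf.continuous_iteratedFDeriv (by exact_mod_cast le_top)
  cases r with
  | point w => exact ⟨iteratedFDeriv ℝ m f (∑ i, w i • p i), fun t => rfl⟩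
  | whole =>
    refine ⟨⨍ s in refSimplex j, iteratedFDeriv ℝ m f (paramLin p s + p 0), fun t => ?_⟩
    rw [average_whole, setAverage_eq, setAverage_eq]
    have h := (ContinuousMultilinearMap.apply ℝ (fun _ : Fin m => E d) ℝ t).integral_comp_comm
      (integrableOn_param p hc)
    simp only [ContinuousMultilinearMap.apply_apply] at h
    rw [h]
    rfl

theorem average_comp_param {j : ℕ} {r : RefDomain j} (hr : r.IsValid) (p : Fin (j + 1) → E d)
    (f : E d → ℝ) :
    r.average (refVertex j) (fun x => f (paramLin p x + p 0)) = r.average p f := by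
  cases r with
  | point w =>
    have h1 := (hr w rfl).2
    simp only [average]
    congr 1
    have h2 : p 0 = ∑ i, w i • p 0 := by rw [← Finset.sum_smul, h1, one_smul]
    rw [map_sum]
    nth_rw 1 [h2]
    rw [← Finset.sum_add_distrib]
    refine Finset.sum_congr rfl fun i _ => ?_
    rw [map_smul, ← smul_add, param_refVertex]
  | whole =>
    rw [average_whole]
    simp only [average]
    congr 1
    funext s
    congr 3
    simp only [refVertex, Fin.cons_zero, Fin.cons_succ, sub_zero, zero_add]
    funext k
    simp [Finset.sum_apply, Pi.single_apply]

end RefDomain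

/-! ### Estimates on the reference simplex -/

theorem NodeLayout.isValid {k m j : ℕ} (L : NodeLayout d k) {r : RefDomain j}
    (hr : r ∈ L.nodes m j) : r.IsValid := by
  rintro w rfl
  exact ⟨fun i => ((L.point_mem m j w hr).1 i).le, (L.point_mem m j w hr).2⟩

/-- The reference average as a linear functional. -/
def refAverage {j : ℕ} (n : ℕ) (r : RefDomain j) : Module.Dual ℝ (PolyLe j n) where
  toFun q := r.average (refVertex j) (polyFun (ContinuousLinearMap.id ℝ _) q)
  map_add' p q := by
    cases r with
    | point w => simp [RefDomain.average]
    | whole =>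
      have hint : ∀ q : MvPolynomial (Fin j) ℝ, IntegrableOn (fun s : Fin j → ℝ =>
          polyFun (ContinuousLinearMap.id ℝ _) q
            (refVertex j 0 + ∑ i, s i • (refVertex j i.succ - refVertex j 0)))
          {s : Fin j → ℝ | (∀ i, 0 ≤ s i) ∧ ∑ i, s i ≤ 1} := fun q =>
        ((contDiff_polyFun _ q).continuous.comp (by fun_prop)).continuousOn.integrableOn_compact
          (isCompact_refSimplex j)
      simp only [RefDomain.average, setAverage_eq, Submodule.coe_add, map_add, Pi.add_apply]
      rw [integral_add (hint _) (hint _), smul_add]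
  map_smul' c q := by
    cases r with
    | point w => simp [RefDomain.average]
    | whole =>
      simp only [RefDomain.average, setAverage_eq, Submodule.coe_smul, map_smul, Pi.smul_apply,
        smul_eq_mul, RingHom.id_apply]
      rw [integral_const_mul]
      ring

/-- Unisolvence with zero data says that the averages and the boundary derivatives together separate
polynomials. Finite dimension turns this into a bound whose constant depends on the layout alone. -/
theorem exists_ref_bound {k m j : ℕ} (L : NodeLayout d k) (hmj : IsDofDim d m j) :
    ∃ C : ℝ, 0 ≤ C ∧ ∀ q ∈ PolyLe j (k - m), ∀ ε : ℝ, 0 ≤ ε →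
      (∀ r ∈ L.nodes m j, |r.average (refVertex j)
        (polyFun (ContinuousLinearMap.id ℝ (Fin j → ℝ)) q)| ≤ ε) →
      (∀ l : List (Fin j → ℝ), l.length + m + j ≤ d → ∀ x ∈ refBoundary j,
        |dirDeriv l (polyFun (ContinuousLinearMap.id ℝ (Fin j → ℝ)) q) x| ≤ ε * normProd l) →
      ∀ x ∈ refSimplex j, |polyFun (ContinuousLinearMap.id ℝ (Fin j → ℝ)) q x| ≤ C * ε := by
  let c := ContinuousLinearMap.id ℝ (Fin j → ℝ)
  let dd : List (Fin j → ℝ) × (Fin j → ℝ) → Module.Dual ℝ (PolyLe j (k - m)) := fun lx =>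
    { toFun := fun q => dirDeriv lx.1 (polyFun c q) lx.2
      map_add' := fun p q => by
        simp only [Submodule.coe_add, map_add]
        rw [dirDeriv_add (contDiff_polyFun c _) (contDiff_polyFun c _)]
        rfl
      map_smul' := fun a q => by
        simp only [Submodule.coe_smul, map_smul]
        rw [dirDeriv_smul (contDiff_polyFun c _)]
        rfl }
  let ι := {r // r ∈ L.nodes m j} ⊕
    {lx : List (Fin j → ℝ) × (Fin j → ℝ) // lx.1.length + m + j ≤ d ∧ lx.2 ∈ refBoundary j}
  let l : ι → Module.Dual ℝ (PolyLe j (k - m)) := Sum.elim (fun r => refAverage _ r.1)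
    fun lx => dd lx.1
  let B : ι → ℝ := Sum.elim (fun _ => 1) fun lx => normProd lx.1.1
  have hsep : ∀ q, (∀ s, l s q = 0) → q = 0 := by
    intro q hq
    obtain ⟨q₀, -, huniq⟩ := L.unisolvent m j hmj fun _ => 0
    have h1 : (q : MvPolynomial (Fin j) ℝ) = q₀ := by
      refine huniq _ ⟨mem_polyLe.1 q.2, fun i hi x hx => ?_, fun r hr => hq (Sum.inl ⟨r, hr⟩)⟩
      ext t
      have h2 := hq (Sum.inr ⟨(List.ofFn t, x), by simpa using hi, hx⟩)
      have h3 := iteratedFDeriv_eq_dirDeriv (contDiff_polyFun c (q : MvPolynomial (Fin j) ℝ)) i x t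
      exact h3.trans h2
    have h2 : (0 : MvPolynomial (Fin j) ℝ) = q₀ := by
      refine huniq _ ⟨by simp, fun i hi x hx => ?_, fun r hr => ?_⟩
      · simp
      · exact (refAverage (k - m) r).map_zero
    exact Subtype.ext (h1.trans h2.symm)
  obtain ⟨C, hC, h⟩ := polyLe_bound c l B hsep (isCompact_refSimplex j) 0
  refine ⟨C, hC, fun q hq ε hε h1 h2 x hx => ?_⟩
  have := h ⟨q, hq⟩ ε hε (fun s => by
    rcases s with ⟨r, hr⟩ | ⟨⟨l, x⟩, hl, hx⟩
    · exact (h1 r hr).trans_eq (one_mul ε).symm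
    · exact (h2 l hl x hx).trans_eq (mul_comm _ _)) x hx
  rwa [norm_iteratedFDeriv_zero, Real.norm_eq_abs] at this

/-- A Markov inequality: values on the simplex separate polynomials and therefore bound derivatives.
-/
theorem exists_ref_markov (j k : ℕ) :
    ∃ C : ℝ, 0 ≤ C ∧ ∀ q ∈ PolyLe j k, ∀ ε : ℝ, 0 ≤ ε →
      (∀ x ∈ refSimplex j, |polyFun (ContinuousLinearMap.id ℝ (Fin j → ℝ)) q x| ≤ ε) →
      ∀ x ∈ refSimplex j, ∀ t,
        |dirDeriv [t] (polyFun (ContinuousLinearMap.id ℝ (Fin j → ℝ)) q) x| ≤ C * ε * ‖t‖ := by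
  let c := ContinuousLinearMap.id ℝ (Fin j → ℝ)
  let l : refSimplex j → Module.Dual ℝ (PolyLe j k) := fun z =>
    ((LinearMap.proj (z : Fin j → ℝ)).comp (polyFun c)).comp (PolyLe j k).subtype
  have hsep : ∀ q, (∀ s, l s q = 0) → q = 0 := fun q hq =>
    Subtype.ext (eq_zero_of_refSimplex fun x hx => hq ⟨x, hx⟩)
  obtain ⟨C, hC, h⟩ := polyLe_bound c l (fun _ => 1) hsep (isCompact_refSimplex j) 1
  refine ⟨C, hC, fun q hq ε hε h1 x hx t => ?_⟩
  have h2 := h ⟨q, hq⟩ ε hε (fun s => by rw [one_mul]; exact h1 s s.2) x hx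
  have h3 := abs_dirDeriv_le (contDiff_polyFun c q) [t] x
  simp only [List.length_singleton, normProd_cons, normProd_nil, mul_one] at h3
  exact h3.trans (mul_le_mul_of_nonneg_right h2 (norm_nonneg _))

/-! ### Degrees of freedom -/

theorem exists_ordering {num : E d → ℕ} {s : Finset (E d)} (hinj : InjOn num s) {j : ℕ}
    (hs : s.card = j + 1) :
    ∃ p : Fin (j + 1) → E d, StrictMono (num ∘ p) ∧ range p = s := by
  have hc : (s.image num).card = j + 1 := by rw [Finset.card_image_of_injOn hinj, hs]
  have h : ∀ i, ∃ x ∈ s, num x = (s.image num).orderEmbOfFin hc i := fun i =>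
    Finset.mem_image.1 (Finset.orderEmbOfFin_mem _ hc i)
  choose p hp hp' using h
  refine ⟨p, fun a b hab => ?_, ?_⟩
  · simp only [Function.comp_apply, hp']
    exact (Finset.orderEmbOfFin _ hc).strictMono hab
  · ext x
    constructor
    · rintro ⟨i, rfl⟩
      exact hp i
    · intro hx
      have h1 : num x ∈ range ((s.image num).orderEmbOfFin hc) := by
        rw [Finset.range_orderEmbOfFin]
        exact Finset.mem_coe.2 (Finset.mem_image_of_mem _ hx)
      obtain ⟨i, hi⟩ := h1
      exact ⟨i, hinj (hp i) hx ((hp' i).trans hi)⟩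

theorem vectorSpan_le_range_paramLin {j : ℕ} (p : Fin (j + 1) → E d) {t : E d}
    (ht : t ∈ vectorSpan ℝ (range p)) : ∃ c, paramLin p c = t := by
  have h : vectorSpan ℝ (range p) ≤ LinearMap.range (paramLin p).toLinearMap := by
    rw [vectorSpan_range_eq_span_range_vsub_right ℝ p 0, Submodule.span_le]
    rintro _ ⟨i, rfl⟩
    refine ⟨refVertex j i, ?_⟩
    have := param_refVertex p i
    simp only [vsub_eq_sub]
    exact eq_sub_of_add_eq this
  exact h ht

/-- By induction on the directions: a function vanishing on the simplex has zero derivative at `y`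
towards every vertex, and differences of these vectors span the tangent space. Since `y` may be a
relative boundary point, the derivative along the segment is taken one-sidedly. -/
theorem dirDeriv_eq_zero_of_facet {F : Finset (E d)} {f : E d → ℝ}
    (hf : ContDiff ℝ (⊤ : ℕ∞) f) (h0 : ∀ y ∈ hull F, f y = 0) (l : List (E d))
    (hl : ∀ t ∈ l, t ∈ vectorSpan ℝ (F : Set (E d))) : ∀ y ∈ hull F, dirDeriv l f y = 0 := by
  induction l with
  | nil => exact h0
  | cons t l ih =>
    intro y hy
    have ih' := ih fun s hs => hl s (List.mem_cons_of_mem _ hs)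
    have hd : DifferentiableAt ℝ (dirDeriv l f) y :=
      (contDiff_dirDeriv hf l).differentiable (by simp) y
    have key : ∀ x ∈ F, fderiv ℝ (dirDeriv l f) y (x - y) = 0 := by
      intro x hx
      have hline : HasDerivAt (fun s : ℝ => dirDeriv l f (y + s • (x - y)))
          (fderiv ℝ (dirDeriv l f) y (x - y)) 0 := hd.hasFDerivAt.hasLineDerivAt _
      have h1 : HasDerivWithinAt (fun s : ℝ => dirDeriv l f (y + s • (x - y)))
          (fderiv ℝ (dirDeriv l f) y (x - y)) (Icc 0 1) 0 := hline.hasDerivWithinAt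
      have h2 : HasDerivWithinAt (fun s : ℝ => dirDeriv l f (y + s • (x - y))) 0 (Icc 0 1) 0 := by
        refine (hasDerivWithinAt_const (0 : ℝ) (Icc 0 1) (0 : ℝ)).congr (fun s hs => ?_) ?_
        · exact ih' _ ((convex_convexHull ℝ _).add_smul_sub_mem hy (subset_hull F hx) hs)
        · simpa using ih' y hy
      exact (uniqueDiffOn_Icc zero_lt_one 0 (left_mem_Icc.2 zero_le_one)).eq_deriv _ h1 h2
    have hle : vectorSpan ℝ (F : Set (E d)) ≤ LinearMap.ker (fderiv ℝ (dirDeriv l f) y).toLinearMap := by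
      rw [vectorSpan_def, Submodule.span_le]
      rintro _ ⟨a, ha, b, hb, rfl⟩
      have h3 := key a ha
      have h4 := key b hb
      change fderiv ℝ (dirDeriv l f) y (a - b) = 0
      rw [show a - b = (a - y) - (b - y) by abel, map_sub, h3, h4, sub_zero]
    exact hle (hl t List.mem_cons_self)

theorem Dof.coe_cell (a : Dof d) : (a.cell : Set (E d)) = range a.vtx := by
  classical
  simp [Dof.cell]

theorem Dof.hull_cell (a : Dof d) : hull a.cell = convexHull ℝ (range a.vtx) := by
  rw [hull, a.coe_cell]

theorem Dof.evalOn_eq {M : Mesh Ω} {a : Dof d} (ha : a.dom.IsValid) {T : Finset (E d)}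
    (hT : T ∈ M.cells) (haT : a.cell ⊆ T) {v f : E d → ℝ} (hf : ContDiff ℝ (⊤ : ℕ∞) f)
    (hvf : EqOn v f (hull T)) :
    a.evalOn T v = a.dom.average a.vtx (dirDeriv (List.ofFn a.dir) f) := by
  refine RefDomain.average_congr _ _ fun y hy => ?_
  have hyT : y ∈ hull T := by
    refine hull_mono haT ?_
    rw [a.hull_cell]
    exact RefDomain.carrier_subset ha _ hy
  rw [Mesh.iteratedFDerivWithin_eq_piece hT hf hvf hyT, iteratedFDeriv_eq_dirDeriv hf]

namespace DofSystem

variable {M : Mesh Ω} {k : ℕ} {L : NodeLayout d k} {κ : ℝ} (S : DofSystem M L κ)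

theorem dom_isValid (a : Fin S.N) : (S.dof a).dom.IsValid := L.isValid (S.valid a).2.2.2.1

/-- Duality is extended from the basis by linearity. In particular the value does not depend on the
cell on which it is computed. -/
theorem evalOn_eq_repr {T : Finset (E d)} (hT : T ∈ M.cells) {b : Fin S.N}
    (hb : (S.dof b).cell ⊆ T) (v : M.Vh k) :
    (S.dof b).evalOn T (v : E d → ℝ) = S.basis.repr v b := by
  have hval := S.dom_isValid b
  let ev : M.Vh k →ₗ[ℝ] ℝ :=
    { toFun := fun v => (S.dof b).evalOn T (v : E d → ℝ)
      map_add' := fun v w => by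
        obtain ⟨f, hf, hvf⟩ := Mesh.exists_piece v.2.1 hT
        obtain ⟨g, hg, hwg⟩ := Mesh.exists_piece w.2.1 hT
        have h1 : EqOn ((v + w : M.Vh k) : E d → ℝ) (f + g) (hull T) := fun x hx => by
          simp [hvf hx, hwg hx]
        rw [Dof.evalOn_eq hval hT hb (hf.add hg).contDiff h1,
          Dof.evalOn_eq hval hT hb hf.contDiff hvf, Dof.evalOn_eq hval hT hb hg.contDiff hwg,
          dirDeriv_add hf.contDiff hg.contDiff]
        exact RefDomain.average_add _ _ (contDiff_dirDeriv hf.contDiff _).continuous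
          (contDiff_dirDeriv hg.contDiff _).continuous
      map_smul' := fun c v => by
        obtain ⟨f, hf, hvf⟩ := Mesh.exists_piece v.2.1 hT
        have h1 : EqOn ((c • v : M.Vh k) : E d → ℝ) (c • f) (hull T) := fun x hx => by
          simp [hvf hx]
        rw [Dof.evalOn_eq hval hT hb (hf.smul c).contDiff h1,
          Dof.evalOn_eq hval hT hb hf.contDiff hvf, dirDeriv_smul hf.contDiff]
        exact RefDomain.average_smul _ _ _ _ }
  have h1 : ev v = ∑ a, S.basis.repr v a * ev (S.basis a) := by
    conv_lhs => rw [← S.basis.sum_repr v, map_sum]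
    simp
  change ev v = _
  rw [h1, Finset.sum_eq_single b]
  · change _ * (S.dof b).evalOn T (S.basis b : E d → ℝ) = _
    rw [S.dual b b T hT hb, if_pos rfl, mul_one]
  · intro a _ hab
    change _ * (S.dof b).evalOn T (S.basis a : E d → ℝ) = _
    rw [S.dual a b T hT hb, if_neg hab, mul_zero]
  · simp

open Classical in
/-- The degrees of freedom attached to the subsimplices of the cell `T`. -/
def dofsOf (T : Finset (E d)) : Finset (Fin S.N) := Finset.univ.filter fun a => (S.dof a).cell ⊆ T

theorem mem_dofsOf {T : Finset (E d)} {a : Fin S.N} : a ∈ S.dofsOf T ↔ (S.dof a).cell ⊆ T := by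
  simp [dofsOf]

/-- The functionals attached to `T` see only the restriction to `T`, so duality makes the restricted
basis functions linearly independent polynomials. -/
theorem card_dofsOf_le {T : Finset (E d)} (hT : T ∈ M.cells) :
    (S.dofsOf T).card ≤ Module.finrank ℝ (PolyLe d k) := by
  have h := fun a => Mesh.exists_piece (S.basis a).2.1 hT
  choose f hf hfb using h
  choose q hq hqf using hf
  have hli : LinearIndependent ℝ fun a : S.dofsOf T => (⟨q a, hq a⟩ : PolyLe d k) := by
    rw [Fintype.linearIndependent_iff]
    intro c hc b
    let v : M.Vh k := ∑ a : S.dofsOf T, c a • S.basis a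
    have hv : EqOn (v : E d → ℝ) 0 (hull T) := by
      intro x hx
      have h1 : (v : E d → ℝ) x = ∑ a : S.dofsOf T, c a * (S.basis a : E d → ℝ) x := by
        simp only [v]
        rw [Submodule.coe_sum, Finset.sum_apply]
        simp
      have h2 := congrArg (fun p : PolyLe d k => polyFun (crd d) p x) hc
      simp only [Submodule.coe_sum, Submodule.coe_smul, map_sum, map_smul, Finset.sum_apply,
        Pi.smul_apply, smul_eq_mul, Submodule.coe_zero, map_zero, Pi.zero_apply] at h2
      rw [h1]
      refine Eq.trans ?_ h2
      refine Finset.sum_congr rfl fun a _ => ?_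
      rw [hfb a hx, hqf a]
    have hb := S.mem_dofsOf.1 b.2
    have h3 := S.evalOn_eq_repr hT hb v
    rw [Dof.evalOn_eq (S.dom_isValid b) hT hb contDiff_const hv] at h3
    have h4 : dirDeriv (List.ofFn (S.dof b).dir) (fun _ => (0 : ℝ)) = (0 : ℝ) • fun _ : E d => (0 : ℝ) := by
      have := dirDeriv_smul (f := fun _ : E d => (0 : ℝ)) contDiff_const 0 (List.ofFn (S.dof b).dir)
      rw [zero_smul] at this ⊢
      exact this.trans (zero_smul _ _)
    change (S.dof b).dom.average _ (dirDeriv (List.ofFn (S.dof b).dir) (fun _ => (0 : ℝ))) = _ at h3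
    rw [h4, RefDomain.average_smul, zero_mul] at h3
    have h5 : S.basis.repr v b = c b := by
      simp only [v, map_sum, map_smul, Finsupp.coe_finsetSum, Finset.sum_apply,
        Finsupp.coe_smul, Pi.smul_apply, Module.Basis.repr_self, smul_eq_mul]
      rw [Finset.sum_eq_single b]
      · simp
      · intro a _ hab
        rw [Finsupp.single_eq_of_ne (fun h => hab (Subtype.ext h.symm)), mul_zero]
      · simp
    rw [← h5, ← h3]
  have := hli.fintype_card_le_finrank
  rwa [Fintype.card_coe] at this

end DofSystem

namespace Mesh

variable {M : Mesh Ω}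

theorem isCmAt_of_mem {k m j : ℕ} (hd : d = 2 ∨ d = 3) (h1 : 1 ≤ m) (h2 : m + j + 1 ≤ d)
    (v : M.Vh k) {σ : Finset (E d)} (hσ : σ ∈ M.complex.faces) (hc : σ.card = j + 1) {y : E d}
    (hy : y ∈ hull σ) : M.IsCmAt m v y := by
  suffices h : ∃ n, m ≤ n ∧ M.IsCmAt n v y by
    obtain ⟨n, hn, h⟩ := h
    exact fun T hT T' hT' hx hx' i hi => h T hT T' hT' hx hx' i (hi.trans hn)
  have hnode : j = 0 → y ∈ M.nodes := by
    rintro rfl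
    obtain ⟨x, rfl⟩ := Finset.card_eq_one.1 hc
    have : y = x := by simpa [hull] using hy
    rw [this]
    exact hσ
  rcases hd with hd | hd
  · have hj : j = 0 := by omega
    exact ⟨1, by omega, v.2.2.1 hd y (hnode hj)⟩
  · rcases Nat.lt_or_ge j 1 with hj | hj
    · exact ⟨2, by omega, (v.2.2.2 hd).2 y (hnode (by omega))⟩
    · exact ⟨1, by omega, (v.2.2.2 hd).1 σ hσ (by omega) y hy⟩

theorem iteratedFDeriv_eq_of_mem {k m j : ℕ} (hd : d = 2 ∨ d = 3) (hmj : IsDofDim d m j)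
    (v : M.Vh k) {σ : Finset (E d)} (hσ : σ ∈ M.complex.faces) (hc : σ.card = j + 1) {y : E d}
    (hy : y ∈ hull σ) {T T' : Finset (E d)} (hT : T ∈ M.cells) (hT' : T' ∈ M.cells)
    {f f' : E d → ℝ} (hf : IsPoly k f) (hf' : IsPoly k f') (hvf : EqOn (v : E d → ℝ) f (hull T))
    (hvf' : EqOn (v : E d → ℝ) f' (hull T')) (hyT : y ∈ hull T) (hyT' : y ∈ hull T') :
    iteratedFDeriv ℝ m f y = iteratedFDeriv ℝ m f' y := by
  rcases hmj with ⟨rfl, -⟩ | ⟨h1, h2⟩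
  · ext t
    simp only [iteratedFDeriv_zero_apply]
    rw [← hvf hyT, ← hvf' hyT']
  · have h := isCmAt_of_mem hd h1 h2 v hσ hc hy T hT T' hT' hyT hyT' m le_rfl
    rwa [iteratedFDerivWithin_eq_piece hT hf.contDiff hvf hyT,
      iteratedFDerivWithin_eq_piece hT' hf'.contDiff hvf' hyT'] at h

/-- By the continuity of the derivatives in `Vh` one may compute on a cell that has `F` as a face,
and there the function vanishes on `F`. -/
theorem dirDeriv_eq_zero_boundary (hΩ : IsConvexPolytopalDomain Ω) {k m j : ℕ}
    (hd : d = 2 ∨ d = 3) (hmj : IsDofDim d m j)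
    (v : M.Vh k) {σ : Finset (E d)} (hσ : σ ∈ M.complex.faces) (hc : σ.card = j + 1) {y : E d}
    (hy : y ∈ hull σ) {T : Finset (E d)} (hT : T ∈ M.cells) (hσT : σ ⊆ T)
    {f : E d → ℝ} (hf : IsPoly k f) (hvf : EqOn (v : E d → ℝ) f (hull T))
    {F : Finset (E d)} (hF : F ∈ M.boundaryFacets) (hσF : σ ⊆ F) (t : Fin m → E d)
    (ht : ∀ i, t i ∈ vectorSpan ℝ (F : Set (E d))) : iteratedFDeriv ℝ m f y t = 0 := by
  obtain ⟨hF, -, hFΩ⟩ := hF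
  obtain ⟨T', hT', hFT', hc'⟩ := M.pure F hF
  have hT' := M.mem_cells.2 ⟨hT', hc'⟩
  obtain ⟨f', hf', hvf'⟩ := exists_piece v.2.1 hT'
  rw [iteratedFDeriv_eq_of_mem hd hmj v hσ hc hy hT hT' hf hf' hvf hvf' (hull_mono hσT hy)
    (hull_mono (hσF.trans hFT') hy), iteratedFDeriv_eq_dirDeriv hf'.contDiff]
  refine dirDeriv_eq_zero_of_facet hf'.contDiff (fun z hz => ?_) _ (fun s hs => ?_) y
    (hull_mono hσF hy)
  · rw [← hvf' (hull_mono hFT' hz)]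
    refine v.2.1.2 z fun hzΩ => ?_
    have := hFΩ hz
    rw [frontier, hΩ.isOpen.interior_eq] at this
    exact this.2 hzΩ
  · obtain ⟨i, rfl⟩ := (List.mem_ofFn' _ _).1 hs
    exact ht i

end Mesh

/-! ### Stability of the nodal basis -/

theorem normProd_ofFn {m : ℕ} (t : Fin m → E d) : normProd (List.ofFn t) = ∏ i, ‖t i‖ := by
  rw [normProd, List.map_ofFn, List.prod_ofFn]
  rfl

/-- The degrees of freedom of `v` on the cell `T` are bounded by `ε`, after scaling. -/
def DofSystem.DofBound {M : Mesh Ω} {k : ℕ} {L : NodeLayout d k} {κ : ℝ} (S : DofSystem M L κ)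
    (T : Finset (E d)) (v : M.Vh k) (ε : ℝ) : Prop :=
  ∀ a, (S.dof a).cell ⊆ T → hdiam T ^ (S.dof a).order * |S.basis.repr v a| ≤ ε

/-- The derivatives of order `m` of finite element functions are bounded by the degrees of freedom
on the `j`-dimensional subsimplices. -/
def StableOn {k : ℕ} (L : NodeLayout d k) (κ ρ : ℝ) (m j : ℕ) (C : ℝ) : Prop :=
  ∀ (Ω : Set (E d)), IsConvexPolytopalDomain Ω → ∀ M : Mesh Ω, M.IsShapeRegular ρ →
    ∀ S : DofSystem M L κ, ∀ T ∈ M.cells, ∀ (v : M.Vh k) (f : E d → ℝ), IsPoly k f →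
      EqOn (v : E d → ℝ) f (hull T) → ∀ ε, 0 ≤ ε → S.DofBound T v ε →
        ∀ σ ⊆ T, σ.card = j + 1 → ∀ y ∈ hull σ, ∀ l : List (E d), l.length = m →
          hdiam T ^ m * |dirDeriv l f y| ≤ C * ε * normProd l

theorem StableOn.mono {k : ℕ} {L : NodeLayout d k} {κ ρ : ℝ} {m j : ℕ} {C C' : ℝ}
    (h : StableOn L κ ρ m j C) (hC : C ≤ C') : StableOn L κ ρ m j C' := by
  intro Ω hΩ M hM S T hT v f hf hvf ε hε hS σ hσ hc y hy l hl
  refine (h Ω hΩ M hM S T hT v f hf hvf ε hε hS σ hσ hc y hy l hl).trans ?_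
  have := normProd_nonneg l
  gcongr

/-- The averages of the normal derivatives are bounded by the degrees of freedom. -/
theorem DofSystem.average_normal_le {M : Mesh Ω} {k : ℕ} {L : NodeLayout d k} {κ : ℝ}
    (hΩ : IsConvexPolytopalDomain Ω) (hκ : 0 < κ) (hd : d = 2 ∨ d = 3)
    (S : DofSystem M L κ) {T : Finset (E d)} (hT : T ∈ M.cells) {v : M.Vh k} {f : E d → ℝ}
    (hf : IsPoly k f) (hvf : EqOn (v : E d → ℝ) f (hull T)) {ε : ℝ} (hε : 0 ≤ ε)
    (hS : S.DofBound T v ε) {m j : ℕ} (hmj : IsDofDim d m j) {σ : Finset (E d)} (hσT : σ ⊆ T)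
    (hσc : σ.card = j + 1) {p : Fin (j + 1) → E d} (hp : StrictMono (S.num ∘ p))
    (hpσ : range p = σ) {r : RefDomain j} (hr : r ∈ L.nodes m j) (t : Fin m → E d)
    (ht : ∀ i, t i ∈ (vectorSpan ℝ (σ : Set (E d)))ᗮ) :
    hdiam T ^ m * |r.average p (dirDeriv (List.ofFn t) f)| ≤
      Real.sqrt (Module.finrank ℝ (PolyLe d k) / κ) * ε * ∏ i, ‖t i‖ := by
  classical
  set V := vectorSpan ℝ (σ : Set (E d)) with hV
  have hvalid := L.isValid hr
  have hσ : σ ∈ M.complex.faces := M.complex.down_closed (M.mem_cells.1 hT).1 hσT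
    (Finset.card_pos.1 (by omega))
  obtain ⟨Q, hQ⟩ := RefDomain.exists_average_form (m := m) r p hf.contDiff
  set P := Vᗮ.starProjection with hP
  have hPV : ∀ u ∈ V, P u = 0 := fun u hu => by
    rw [hP, Submodule.starProjection_apply_eq_zero_iff]
    exact Submodule.le_orthogonal_orthogonal V hu
  have hPid : ∀ u ∈ Vᗮ, P u = u := fun u hu => Submodule.starProjection_eq_self_iff.2 hu
  have hPsub : ∀ u, u - P u ∈ V := by
    intro u
    have h := Submodule.sub_starProjection_mem_orthogonal (K := Vᗮ) u
    rwa [Submodule.orthogonal_orthogonal] at h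
  have hcar : r.carrier p ⊆ hull σ := by
    refine (RefDomain.carrier_subset hvalid p).trans_eq ?_
    rw [hpσ]
  have havg0 : r.average p (fun _ => (0 : ℝ)) = 0 := by
    have := RefDomain.average_smul r p 0 fun _ => (0 : ℝ)
    rw [zero_mul, zero_smul] at this
    exact this
  -- Projecting the arguments onto the normal space makes the averaged form vanish on tangential
  -- vectors, as admissibility demands, and does not change it on normal ones.
  let Q' := Q.compContinuousLinearMap fun _ => P
  have hadm : Q' ∈ M.admissible σ m := by
    refine ⟨fun e u => ?_, fun u ⟨i, hi⟩ => ?_, fun F hF hσF u hu => ?_⟩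
    · simp only [Q', ContinuousMultilinearMap.compContinuousLinearMap_apply, hQ]
      congr 1
      funext y
      rw [iteratedFDeriv_eq_dirDeriv hf.contDiff, iteratedFDeriv_eq_dirDeriv hf.contDiff]
      exact dirDeriv_perm hf.contDiff (Equiv.Perm.ofFn_comp_perm e fun i => P (u i)) y
    · simp only [Q', ContinuousMultilinearMap.compContinuousLinearMap_apply]
      exact Q.map_coord_zero i (hPV _ hi)
    · simp only [Q', ContinuousMultilinearMap.compContinuousLinearMap_apply, hQ]
      rw [← havg0]
      refine RefDomain.average_congr _ _ fun y hy => ?_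
      refine Mesh.dirDeriv_eq_zero_boundary hΩ hd hmj v hσ hσc (hcar hy) hT hσT hf hvf hF hσF _
        fun i => ?_
      -- The projection moves a vector by a tangent vector of `σ`, which is also tangent to `F`; so
      -- tangency to `F` is preserved.
      have hVF : V ≤ vectorSpan ℝ (F : Set (E d)) := vectorSpan_mono ℝ (by exact_mod_cast hσF)
      have := Submodule.sub_mem _ (hu i) (hVF (hPsub (u i)))
      rwa [sub_sub_cancel] at this
  have himg : Finset.univ.image p = σ := by
    rw [← Finset.coe_inj, ← hpσ]
    simp
  obtain ⟨A, hA, hA'⟩ := S.complete m j hmj p hp (by convert hσ) r hr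
  have hA'' := hA' Q' (by convert hadm)
  set n : ℝ := ((Module.finrank ℝ (PolyLe d k) : ℕ) : ℝ)
  set H := hdiam T ^ m
  have hH : 0 ≤ H := pow_nonneg Metric.diam_nonneg _
  have hnorm : H * ‖Q'‖ ≤ Real.sqrt (n / κ) * ε := by
    rcases A.eq_empty_or_nonempty with rfl | ⟨u₀, hu₀⟩
    · rw [Finset.sum_empty] at hA''
      have h1 : ‖Q'‖ ^ 2 ≤ 0 := by
        by_contra hcon
        push Not at hcon
        have := mul_pos hκ hcon
        linarith
      rw [pow_eq_zero_iff two_ne_zero |>.1 (le_antisymm h1 (sq_nonneg _)), mul_zero]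
      positivity
    have : Nonempty (Fin S.N) := ⟨(hA u₀ hu₀).choose⟩
    choose! a ha using hA
    have hcell : ∀ u ∈ A, (S.dof (a u)).cell = σ := by
      intro u hu
      rw [← Finset.coe_inj, Dof.coe_cell, ha u hu]
      exact hpσ
    have hval : ∀ u ∈ A, Q' u = S.basis.repr v (a u) := by
      intro u hu
      have h1 := S.evalOn_eq_repr hT (hcell u hu ▸ hσT) v
      rw [Dof.evalOn_eq (S.dom_isValid _) hT (hcell u hu ▸ hσT) hf.contDiff hvf, ha u hu] at h1
      rw [← h1]
      have hnorm : ∀ i, P (u i) = u i := by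
        intro i
        refine hPid _ ((Submodule.mem_orthogonal' _ _).2 fun y hy => ?_)
        have h2 := (S.valid (a u)).2.2.2.2
        rw [hcell u hu, ha u hu] at h2
        exact (h2 i).2 y hy
      simp only [Q', ContinuousMultilinearMap.compContinuousLinearMap_apply, hnorm, hQ]
      congr 1
      funext y
      exact iteratedFDeriv_eq_dirDeriv hf.contDiff _ _ _
    have hord : ∀ u ∈ A, (S.dof (a u)).order = m := fun u hu => by rw [ha u hu]
    -- Different direction tuples belong to different degrees of freedom on `T`, so the size of the
    -- conditioning family is bounded uniformly.
    have hcard : A.card ≤ Module.finrank ℝ (PolyLe d k) := by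
      refine le_trans (Finset.card_le_card_of_injOn a (fun u hu => ?_) fun u hu u' hu' h => ?_)
        (S.card_dofsOf_le hT)
      · exact S.mem_dofsOf.2 (hcell u hu ▸ hσT)
      · have h1 := ha u hu
        rw [h, ha u' hu'] at h1
        have h2 := Dof.mk.inj h1
        exact (eq_of_heq h2.2.2.2.2).symm
    have h1 : κ * (H * ‖Q'‖) ^ 2 ≤ n * ε ^ 2 := by
      calc κ * (H * ‖Q'‖) ^ 2 = H ^ 2 * (κ * ‖Q'‖ ^ 2) := by ring
        _ ≤ H ^ 2 * ∑ u ∈ A, Q' u ^ 2 := by gcongr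
        _ = ∑ u ∈ A, (H * |Q' u|) ^ 2 := by
          rw [Finset.mul_sum]
          exact Finset.sum_congr rfl fun u _ => by rw [mul_pow, sq_abs]
        _ ≤ ∑ u ∈ A, ε ^ 2 := by
          refine Finset.sum_le_sum fun u hu => ?_
          have h2 := hS (a u) (hcell u hu ▸ hσT)
          rw [hord u hu, ← hval u hu] at h2
          exact pow_le_pow_left₀ (by positivity) h2 2
        _ = A.card * ε ^ 2 := by rw [Finset.sum_const, nsmul_eq_mul]
        _ ≤ n * ε ^ 2 := by
          gcongr
          exact Nat.cast_le.2 hcard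
    have h3 : (H * ‖Q'‖) ^ 2 ≤ (Real.sqrt (n / κ) * ε) ^ 2 := by
      rw [mul_pow (Real.sqrt _), Real.sq_sqrt (by positivity), div_mul_eq_mul_div, le_div_iff₀ hκ]
      linarith
    exact (abs_le_of_sq_le_sq' h3 (by positivity)).2
  have hPt : ∀ i, P (t i) = t i := fun i => hPid _ (ht i)
  have hQt : r.average p (dirDeriv (List.ofFn t) f) = Q' t := by
    simp only [Q', ContinuousMultilinearMap.compContinuousLinearMap_apply, hPt, hQ]
    congr 1
    funext y
    exact (iteratedFDeriv_eq_dirDeriv hf.contDiff _ _ _).symm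
  have h5 : |Q' t| ≤ ‖Q'‖ * ∏ i, ‖t i‖ := Q'.le_opNorm t
  rw [hQt]
  calc H * |Q' t| ≤ H * (‖Q'‖ * ∏ i, ‖t i‖) := by gcongr
    _ = H * ‖Q'‖ * ∏ i, ‖t i‖ := by ring
    _ ≤ _ := mul_le_mul_of_nonneg_right hnorm (by positivity)

/-- The directions are decomposed one at a time. The tangential component is moved to the front and
costs `B₂`; the normal component joins the finished list `l`. Orthogonal projections do not increase
`normProd`. -/
theorem dirDeriv_bound_of_split {f : E d → ℝ} (hf : ContDiff ℝ (⊤ : ℕ∞) f) (V : Submodule ℝ (E d))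
    {m : ℕ} {B₁ B₂ : ℝ} (hB₁ : 0 ≤ B₁) (hB₂ : 0 ≤ B₂) {y : E d}
    (h1 : ∀ l : List (E d), l.length = m → (∀ t ∈ l, t ∈ Vᗮ) →
      |dirDeriv l f y| ≤ B₁ * normProd l)
    (h2 : ∀ t ∈ V, ∀ l : List (E d), (t :: l).length = m →
      |dirDeriv (t :: l) f y| ≤ B₂ * normProd (t :: l)) (l' : List (E d)) :
    ∀ l : List (E d), (l ++ l').length = m → (∀ t ∈ l, t ∈ Vᗮ) →
      |dirDeriv (l ++ l') f y| ≤ (B₁ + l'.length * B₂) * normProd (l ++ l') := by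
  induction l' with
  | nil =>
    intro l hl hlV
    simpa using h1 l (by simpa using hl) hlV
  | cons t l' ih =>
    intro l hl hlV
    set u := Vᗮ.starProjection t with hu
    set w := V.starProjection t with hw
    have htw : t = u + w := by
      rw [hu, hw, add_comm]
      exact (V.starProjection_add_starProjection_orthogonal t).symm
    have hperm : ∀ s : E d, (l ++ s :: l').Perm (s :: (l ++ l')) := fun s => List.perm_middle
    have h3 : dirDeriv (l ++ t :: l') f y =
        dirDeriv ((l ++ [u]) ++ l') f y + dirDeriv (w :: (l ++ l')) f y := by
      rw [List.append_assoc, List.singleton_append, dirDeriv_perm hf (hperm t),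
        dirDeriv_perm hf (hperm u)]
      simp only [dirDeriv]
      rw [htw, map_add]
    have hlen : (l ++ l').length + 1 = m := by
      rw [← hl]
      simp only [List.length_append, List.length_cons]
      ring
    have h4 := ih (l ++ [u]) (by rw [← hl]; simp) (fun s hs => by
      rcases List.mem_append.1 hs with hs | hs
      · exact hlV s hs
      · rw [List.mem_singleton.1 hs]
        exact Submodule.starProjection_apply_mem _ _)
    have h5 := h2 w (Submodule.starProjection_apply_mem _ _) (l ++ l') (by simpa using hlen)
    have hn := normProd_nonneg (l ++ l')
    have hnu : normProd ((l ++ [u]) ++ l') ≤ normProd (l ++ t :: l') := by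
      have := normProd_nonneg l
      have := normProd_nonneg l'
      simp only [normProd_append, normProd_cons, normProd_nil, mul_one, mul_assoc]
      gcongr
      exact Submodule.norm_starProjection_apply_le _ _
    have hnw : normProd (w :: (l ++ l')) ≤ normProd (l ++ t :: l') := by
      have := normProd_nonneg l
      have := normProd_nonneg l'
      simp only [normProd_append, normProd_cons, mul_left_comm (normProd l)]
      gcongr
      exact Submodule.norm_starProjection_apply_le _ _
    rw [h3]
    refine (abs_add_le _ _).trans ((add_le_add h4 h5).trans ?_)
    have hlen' : ((t :: l').length : ℝ) = l'.length + 1 := by simp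
    rw [hlen', add_mul (l'.length : ℝ), one_mul, ← add_assoc, add_mul (B₁ + _)]
    gcongr

theorem norm_paramLin_le {j : ℕ} {p : Fin (j + 1) → E d} {h : ℝ}
    (hp : ∀ i : Fin j, ‖p i.succ - p 0‖ ≤ h) (s : Fin j → ℝ) : ‖paramLin p s‖ ≤ j * h * ‖s‖ := by
  rw [paramLin_apply]
  refine (norm_sum_le _ _).trans ((Finset.sum_le_sum (g := fun _ => h * ‖s‖)
    fun i _ => ?_).trans_eq ?_)
  · rw [norm_smul, mul_comm]
    have h0 := (norm_nonneg _).trans (hp i)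
    have := norm_le_pi_norm s i
    gcongr
    exact hp i
  · rw [Finset.sum_const, Finset.card_univ, Fintype.card_fin, nsmul_eq_mul, mul_assoc]

theorem normProd_map_le {F F' : Type*} [NormedAddCommGroup F] [NormedSpace ℝ F]
    [NormedAddCommGroup F'] [NormedSpace ℝ F']
    {A : F → F'} {c : ℝ} (hc : 0 ≤ c) (hA : ∀ s, ‖A s‖ ≤ c * ‖s‖) (l : List F) :
    normProd (l.map A) ≤ c ^ l.length * normProd l := by
  induction l with
  | nil => simp
  | cons t l ih =>
    simp only [List.map_cons, normProd_cons, List.length_cons, pow_succ]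
    have := normProd_nonneg (l.map A)
    calc ‖A t‖ * normProd (l.map A) ≤ (c * ‖t‖) * (c ^ l.length * normProd l) := by
          gcongr
          exact hA t
      _ = _ := by ring

theorem IsPoly.exists_param_poly {k j : ℕ} {f : E d → ℝ} (hf : IsPoly k f)
    (p : Fin (j + 1) → E d) :
    ∃ q ∈ PolyLe j k, polyFun (ContinuousLinearMap.id ℝ (Fin j → ℝ)) q =
      fun x => f (paramLin p x + p 0) := by
  obtain ⟨q, hq, rfl⟩ := hf
  obtain ⟨q', hq', h⟩ := polyFun_comp_affine (crd d) (ContinuousLinearMap.id ℝ (Fin j → ℝ))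
    (ContinuousLinearMap.id ℝ (Fin j → ℝ)) (fun _ => rfl) (paramLin p) (p 0) hq
  exact ⟨q', hq', funext fun x => (h x).symm⟩

/-- In the parametrization of `σ`, a normal derivative is a polynomial of degree at most `k - m`.
Its averages are bounded by `average_normal_le`, and its derivatives at the reference boundary are
derivatives of `f` on faces one dimension lower, bounded by `hb`. So `exists_ref_bound` applies. -/
theorem exists_normal_bound {k m j : ℕ} (L : NodeLayout d k) {κ ρ Cb : ℝ} (hκ : 0 < κ)
    (hd : d = 2 ∨ d = 3) (hmj : IsDofDim d m j) (hCb : 0 ≤ Cb)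
    (hb : ∀ j', j = j' + 1 → ∀ m', IsDofDim d m' j' → StableOn L κ ρ m' j' Cb) :
    ∃ C : ℝ, 0 ≤ C ∧ ∀ (Ω : Set (E d)), IsConvexPolytopalDomain Ω → ∀ M : Mesh Ω,
      M.IsShapeRegular ρ → ∀ S : DofSystem M L κ, ∀ T ∈ M.cells, ∀ (v : M.Vh k) (f : E d → ℝ),
      IsPoly k f → EqOn (v : E d → ℝ) f (hull T) → ∀ ε, 0 ≤ ε → S.DofBound T v ε →
        ∀ σ ⊆ T, σ.card = j + 1 → ∀ y ∈ hull σ, ∀ l : List (E d), l.length = m →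
          (∀ t ∈ l, t ∈ (vectorSpan ℝ (σ : Set (E d)))ᗮ) →
          hdiam T ^ m * |dirDeriv l f y| ≤ C * ε * normProd l := by
  obtain ⟨C, hC, hCq⟩ := exists_ref_bound L hmj
  set K := Real.sqrt (Module.finrank ℝ (PolyLe d k) / κ) + Cb * ((j : ℝ) + 1) ^ d with hK
  have hK0 : 0 ≤ K := by positivity
  refine ⟨C * K, by positivity, fun Ω hΩ M hM S T hT v f hf hvf ε hε hS σ hσ hσc y hy l hl hlV => ?_⟩
  have hh := M.hdiam_pos (by omega) hT
  have hinj : InjOn S.num σ := S.num_inj.mono fun x hx =>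
    M.mem_nodes_of_mem_cell hT (hσ hx)
  obtain ⟨p, hp, hpσ⟩ := exists_ordering hinj hσc
  have hpmem : ∀ i, p i ∈ σ := fun i => by
    rw [← Finset.mem_coe, ← hpσ]
    exact mem_range_self i
  obtain ⟨q, hq, hqf⟩ := (hf.dirDeriv l).exists_param_poly p
  rw [hl] at hq
  have hy' := hy
  rw [hull, ← hpσ] at hy'
  obtain ⟨x, hx, rfl⟩ := exists_param p hy'
  have hlof : List.ofFn (fun i : Fin m => l.get (i.cast hl.symm)) = l := by
    subst hl
    exact List.ofFn_get l
  have hn := normProd_nonneg l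
  have key := hCq q hq (K * ε * normProd l / hdiam T ^ m) (by positivity) (fun r hr => ?_)
    (fun s hs z hz => ?_) x hx
  · rw [hqf] at key
    rw [mul_comm, ← le_div_iff₀ (by positivity)]
    refine key.trans_eq ?_
    ring
  · rw [hqf, RefDomain.average_comp_param (L.isValid hr), le_div_iff₀ (by positivity), mul_comm]
    have h1 := S.average_normal_le hΩ hκ hd hT hf hvf hε hS hmj hσ hσc hp hpσ hr
      (fun i : Fin m => l.get (i.cast hl.symm)) fun i => hlV _ (List.get_mem _ _)
    rw [← normProd_ofFn, hlof] at h1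
    refine h1.trans ?_
    gcongr
    rw [hK]
    exact le_add_of_nonneg_right (by positivity)
  · rw [hqf, dirDeriv_comp_affine (contDiff_dirDeriv hf.contDiff l), ← dirDeriv_append]
    -- For `j = 0` the reference boundary is empty: there is no coordinate to vanish, and the empty
    -- sum is not one.
    have hj : j ≠ 0 := by
      rintro rfl
      rcases hz.2.2 with ⟨i, -⟩ | h
      · exact i.elim0
      · simp at h
    obtain ⟨j', rfl⟩ := Nat.exists_eq_succ_of_ne_zero hj
    obtain ⟨i, hi⟩ := param_boundary p hz
    have hmem : paramLin p z + p 0 ∈ hull (σ.erase (p i)) := by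
      refine convexHull_mono ?_ hi
      rintro _ ⟨i', hi', rfl⟩
      have hpinj : Function.Injective p := fun a b hab =>
        hp.injective (congrArg S.num hab)
      exact Finset.mem_coe.2 (Finset.mem_erase.2 ⟨fun h => hi' (hpinj h), hpmem i'⟩)
    -- The loss of one dimension is offset by the one in `m + j + 1 ≤ d`: the orders `≤ d - m - j`
    -- fixed by the layout on the boundary are available on the faces.
    have hdim : IsDofDim d (s.length + m) j' := by
      unfold IsDofDim at hmj ⊢
      omega
    have h1 := hb j' rfl _ hdim Ω hΩ M hM S T hT v f hf hvf ε hε hS (σ.erase (p i))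
      ((Finset.erase_subset _ _).trans hσ) (by rw [Finset.card_erase_of_mem (hpmem i), hσc]; rfl)
      _ hmem (s.map (paramLin p) ++ l) (by simp [hl])
    have hA := norm_paramLin_le (p := p) (h := hdiam T) fun i =>
      dist_le_hdiam (subset_hull T (hσ (hpmem _))) (subset_hull T (hσ (hpmem _)))
    have h2 := normProd_map_le (by positivity) hA s
    rw [normProd_append] at h1
    have hns := normProd_nonneg s
    have h3 : ((j' + 1 : ℕ) : ℝ) ^ s.length ≤ (((j' + 1 : ℕ) : ℝ) + 1) ^ d := by
      refine (pow_le_pow_left₀ (by positivity) (le_add_of_nonneg_right zero_le_one) _).trans ?_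
      exact pow_le_pow_right₀ (by linarith [(Nat.cast_nonneg (j' + 1) : (0 : ℝ) ≤ _)]) (by omega)
    rw [pow_add] at h1
    rw [div_mul_eq_mul_div, le_div_iff₀ (by positivity)]
    refine le_of_mul_le_mul_left ?_ (pow_pos hh s.length)
    calc hdiam T ^ s.length * (|dirDeriv (s.map (paramLin p) ++ l) f (paramLin p z + p 0)| *
          hdiam T ^ m)
        = hdiam T ^ s.length * hdiam T ^ m *
          |dirDeriv (s.map (paramLin p) ++ l) f (paramLin p z + p 0)| := by ring
      _ ≤ Cb * ε * (normProd (s.map (paramLin p)) * normProd l) := h1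
      _ ≤ Cb * ε * (((((j' + 1 : ℕ) : ℝ) * hdiam T) ^ s.length * normProd s) * normProd l) := by
        gcongr
      _ = hdiam T ^ s.length * ((Cb * ((j' + 1 : ℕ) : ℝ) ^ s.length) * ε * normProd l * normProd s)
          := by ring
      _ ≤ hdiam T ^ s.length * (K * ε * normProd l * normProd s) := by
        gcongr
        rw [hK]
        refine le_trans ?_ (le_add_of_nonneg_left (Real.sqrt_nonneg _))
        gcongr

/-- Derivatives of order `m` are bounded on all of `σ`, so the Markov inequality gives one further
tangential derivative. The preimage `c` of `t` has derivatives of barycentric coordinates as its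
components, and `norm_bary_le` bounds it by `ρ / hdiam T * ‖t‖`. -/
theorem exists_tangential_bound {k m j : ℕ} {L : NodeLayout d k} {κ ρ Cb : ℝ} (hρ : 0 < ρ)
    (hd : 0 < d) (hCb : 0 ≤ Cb) (hb : StableOn L κ ρ m j Cb) :
    ∃ C : ℝ, 0 ≤ C ∧ ∀ (Ω : Set (E d)), IsConvexPolytopalDomain Ω → ∀ M : Mesh Ω,
      M.IsShapeRegular ρ → ∀ S : DofSystem M L κ, ∀ T ∈ M.cells, ∀ (v : M.Vh k) (f : E d → ℝ),
      IsPoly k f → EqOn (v : E d → ℝ) f (hull T) → ∀ ε, 0 ≤ ε → S.DofBound T v ε →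
        ∀ σ ⊆ T, σ.card = j + 1 → ∀ y ∈ hull σ, ∀ t ∈ vectorSpan ℝ (σ : Set (E d)),
          ∀ l : List (E d), l.length = m →
          hdiam T ^ (m + 1) * |dirDeriv (t :: l) f y| ≤ C * ε * normProd (t :: l) := by
  obtain ⟨C, hC, hCq⟩ := exists_ref_markov j k
  refine ⟨C * Cb * ρ, by positivity, fun Ω hΩ M hM S T hT v f hf hvf ε hε hS σ hσ hσc y hy t ht l hl => ?_⟩
  have hh := M.hdiam_pos hd hT
  have hinj : InjOn S.num σ := S.num_inj.mono fun x hx =>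
    M.mem_nodes_of_mem_cell hT (hσ hx)
  obtain ⟨p, hp, hpσ⟩ := exists_ordering hinj hσc
  have hpmem : ∀ i, p i ∈ σ := fun i => by
    rw [← Finset.mem_coe, ← hpσ]
    exact mem_range_self i
  have hpinj : Function.Injective p := fun a b hab => hp.injective (congrArg S.num hab)
  obtain ⟨q, hq, hqf⟩ := ((hf.dirDeriv l).mono (Nat.sub_le _ _)).exists_param_poly p
  rw [hull, ← hpσ] at hy
  obtain ⟨x, hx, rfl⟩ := exists_param p hy
  rw [← hpσ] at ht
  obtain ⟨c, rfl⟩ := vectorSpan_le_range_paramLin p ht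
  have hn := normProd_nonneg l
  have hc : ‖c‖ ≤ ρ / hdiam T * ‖paramLin p c‖ := by
    obtain ⟨α, b, hα⟩ := M.exists_bary hT
    refine (pi_norm_le_iff_of_nonneg (by positivity)).2 fun i => ?_
    have h1 := hM.norm_bary_le hρ hd hT hα (hσ (hpmem i.succ)) (paramLin p c)
    have h2 : α (p i.succ) (paramLin p c) = c i := by
      have h3 : ∀ i', α (p i.succ) (p i') + b (p i.succ) = if i.succ = i' then 1 else 0 := by
        intro i'
        rw [hα.vertex _ (hσ (hpmem _)) _ (hσ (hpmem _))]
        simp only [hpinj.eq_iff]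
      rw [paramLin_apply, map_sum, Finset.sum_eq_single i]
      · rw [map_smul, map_sub, smul_eq_mul]
        have h4 := h3 i.succ
        have h5 := h3 0
        rw [if_pos rfl] at h4
        rw [if_neg (Fin.succ_ne_zero i)] at h5
        rw [show α (p i.succ) (p i.succ) - α (p i.succ) (p 0) = 1 by linarith, mul_one]
      · intro i' _ hi'
        rw [map_smul, map_sub, smul_eq_mul]
        have h4 := h3 i'.succ
        have h5 := h3 0
        rw [if_neg (fun h => hi' (Fin.succ_injective _ h).symm)] at h4
        rw [if_neg (Fin.succ_ne_zero i)] at h5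
        rw [show α (p i.succ) (p i'.succ) - α (p i.succ) (p 0) = 0 by linarith, mul_zero]
      · simp
    rwa [h2] at h1
  have key := hCq q hq (Cb * ε * normProd l / hdiam T ^ m) (by positivity) (fun z hz => ?_) x hx c
  · rw [hqf, dirDeriv_comp_affine (contDiff_dirDeriv hf.contDiff l), ← dirDeriv_append] at key
    simp only [List.map_cons, List.map_nil, List.singleton_append] at key
    calc hdiam T ^ (m + 1) * |dirDeriv (paramLin p c :: l) f (paramLin p x + p 0)|
        ≤ hdiam T ^ (m + 1) * (C * (Cb * ε * normProd l / hdiam T ^ m) *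
          (ρ / hdiam T * ‖paramLin p c‖)) := by
          gcongr
          exact key.trans (by gcongr)
      _ = C * Cb * ρ * ε * normProd (paramLin p c :: l) := by
          rw [normProd_cons]
          field_simp
          ring
  · rw [hqf, le_div_iff₀ (by positivity), mul_comm]
    refine hb Ω hΩ M hM S T hT v f hf hvf ε hε hS σ hσ hσc _ ?_ l hl
    rw [hull, ← hpσ]
    exact param_mem p hz

/-- Induction on the order with the subsimplex dimension fixed. At order zero there are no
directions to split. At order `m + 1`, purely normal derivatives come from the degrees of freedom,
and those with a tangential direction from order `m`. -/
theorem exists_stableOn_of_lower {k j : ℕ} (L : NodeLayout d k) {κ ρ Cb : ℝ} (hκ : 0 < κ)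
    (hρ : 0 < ρ) (hd : d = 2 ∨ d = 3) (hCb : 0 ≤ Cb)
    (hb : ∀ j', j = j' + 1 → ∀ m', IsDofDim d m' j' → StableOn L κ ρ m' j' Cb) (m : ℕ) :
    IsDofDim d m j → ∃ C : ℝ, 0 ≤ C ∧ StableOn L κ ρ m j C := by
  have hd0 : 0 < d := by omega
  induction m with
  | zero =>
    intro hmj
    obtain ⟨C, hC, h⟩ := exists_normal_bound L hκ hd hmj hCb hb
    refine ⟨C, hC, fun Ω hΩ M hM S T hT v f hf hvf ε hε hS σ hσ hσc y hy l hl => ?_⟩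
    refine h Ω hΩ M hM S T hT v f hf hvf ε hε hS σ hσ hσc y hy l hl fun t ht => ?_
    rw [List.length_eq_zero_iff.1 hl] at ht
    simp at ht
  | succ m ih =>
    intro hmj
    obtain ⟨C₀, hC₀, h₀⟩ := ih (by unfold IsDofDim at *; omega)
    obtain ⟨C₁, hC₁, h₁⟩ := exists_normal_bound L hκ hd hmj hCb hb
    obtain ⟨C₂, hC₂, h₂⟩ := exists_tangential_bound hρ hd0 hC₀ h₀
    refine ⟨C₁ + (m + 1 : ℕ) * C₂, by positivity,
      fun Ω hΩ M hM S T hT v f hf hvf ε hε hS σ hσ hσc y hy l hl => ?_⟩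
    have hh := pow_pos (M.hdiam_pos hd0 hT) (m + 1)
    have key := dirDeriv_bound_of_split hf.contDiff (vectorSpan ℝ (σ : Set (E d))) (m := m + 1)
      (B₁ := C₁ * ε / hdiam T ^ (m + 1)) (B₂ := C₂ * ε / hdiam T ^ (m + 1)) (by positivity)
      (by positivity) (y := y) (fun l hl hlV => ?_) (fun t ht l hl => ?_) l [] hl (by simp)
    · rw [List.nil_append, hl] at key
      rw [mul_comm, ← le_div_iff₀ hh]
      refine key.trans_eq ?_
      ring
    · rw [div_mul_eq_mul_div, le_div_iff₀ hh, mul_comm]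
      exact h₁ Ω hΩ M hM S T hT v f hf hvf ε hε hS σ hσ hσc y hy l hl hlV
    · rw [div_mul_eq_mul_div, le_div_iff₀ hh, mul_comm]
      exact h₂ Ω hΩ M hM S T hT v f hf hvf ε hε hS σ hσ hσc y hy t ht l (by simpa using hl)

/-- Induction on the dimension. A vertex has no boundary, so the start requires nothing; only orders
up to `d` occur, and summing their constants makes the bound uniform in `m`. -/
theorem exists_stableOn {k : ℕ} (L : NodeLayout d k) {κ ρ : ℝ} (hκ : 0 < κ) (hρ : 0 < ρ)
    (hd : d = 2 ∨ d = 3) (j : ℕ) :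
    ∃ C : ℝ, 0 ≤ C ∧ ∀ m, IsDofDim d m j → StableOn L κ ρ m j C := by
  have key : ∀ j, ∀ Cb : ℝ, 0 ≤ Cb →
      (∀ j', j = j' + 1 → ∀ m', IsDofDim d m' j' → StableOn L κ ρ m' j' Cb) →
      ∃ C : ℝ, 0 ≤ C ∧ ∀ m, IsDofDim d m j → StableOn L κ ρ m j C := by
    intro j Cb hCb hb
    have h := exists_stableOn_of_lower L hκ hρ hd hCb hb
    choose! C hC hC' using h
    refine ⟨∑ m ∈ Finset.range (d + 1), |C m|, Finset.sum_nonneg fun _ _ => abs_nonneg _,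
      fun m hm => (hC' m hm).mono ((le_abs_self _).trans ?_)⟩
    have hmd : m ∈ Finset.range (d + 1) := by
      unfold IsDofDim at hm
      simp only [Finset.mem_range]
      omega
    exact Finset.single_le_sum (f := fun m => |C m|) (fun _ _ => abs_nonneg _) hmd
  induction j with
  | zero => exact key 0 0 le_rfl fun j' h => absurd h (by omega)
  | succ j ih =>
    obtain ⟨Cb, hCb, hb⟩ := ih
    exact key (j + 1) Cb hCb fun j' h => by
      obtain rfl : j = j' := by omega
      exact hb

/-- The sup norm of finite element functions on a cell is bounded by their degrees of freedom. -/
theorem exists_sup_le_dofs {k : ℕ} (L : NodeLayout d k) {κ ρ : ℝ} (hκ : 0 < κ) (hρ : 0 < ρ)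
    (hd : d = 2 ∨ d = 3) :
    ∃ C : ℝ, 0 ≤ C ∧ ∀ (Ω : Set (E d)), IsConvexPolytopalDomain Ω → ∀ M : Mesh Ω,
      M.IsShapeRegular ρ → ∀ S : DofSystem M L κ, ∀ T ∈ M.cells, ∀ v : M.Vh k,
      ∀ ε, 0 ≤ ε → S.DofBound T v ε → ∀ y ∈ hull T, |(v : E d → ℝ) y| ≤ C * ε := by
  obtain ⟨C, hC, h⟩ := exists_stableOn L hκ hρ hd d
  refine ⟨C, hC, fun Ω hΩ M hM S T hT v ε hε hS y hy => ?_⟩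
  obtain ⟨f, hf, hvf⟩ := Mesh.exists_piece v.2.1 hT
  have h1 := h 0 (Or.inl ⟨rfl, le_rfl⟩) Ω hΩ M hM S T hT v f hf hvf ε hε hS T subset_rfl
    (M.mem_cells.1 hT).2 y hy [] rfl
  rw [hvf hy]
  simpa [dirDeriv] using h1

/-! ### Locality of the nodal basis -/

namespace DofSystem

variable {M : Mesh Ω} {k : ℕ} {L : NodeLayout d k} {κ : ℝ} (S : DofSystem M L κ)

/-- All degrees of freedom on `T` are zero, so the stability estimate applies with `ε = 0`. -/
theorem basis_eq_zero_of_not_subset {ρ : ℝ} (hκ : 0 < κ) (hρ : 0 < ρ) (hd : d = 2 ∨ d = 3)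
    (hΩ : IsConvexPolytopalDomain Ω) (hM : M.IsShapeRegular ρ) {T : Finset (E d)}
    (hT : T ∈ M.cells) {a : Fin S.N} (ha : ¬ (S.dof a).cell ⊆ T) :
    ∀ y ∈ hull T, (S.basis a : E d → ℝ) y = 0 := by
  obtain ⟨C, hC, h⟩ := exists_sup_le_dofs L hκ hρ hd
  intro y hy
  have h1 := h Ω hΩ M hM S T hT (S.basis a) 0 le_rfl (fun b hb => ?_) y hy
  · rw [mul_zero] at h1
    exact abs_nonpos_iff.1 h1
  · have hab : a ≠ b := by
      rintro rfl
      exact ha hb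
    rw [Module.Basis.repr_self, Finsupp.single_eq_of_ne hab.symm, abs_zero, mul_zero]

open Classical in
theorem mem_omega {a : Fin S.N} {T : Finset (E d)} : T ∈ S.omega a ↔
    T ∈ M.cells ∧ (interior (hull T) ∩ tsupport (S.basis a : E d → ℝ)).Nonempty :=
  Finset.mem_filter

theorem cell_subset_of_mem_omega {ρ : ℝ} (hκ : 0 < κ) (hρ : 0 < ρ) (hd : d = 2 ∨ d = 3)
    (hΩ : IsConvexPolytopalDomain Ω) (hM : M.IsShapeRegular ρ) {T : Finset (E d)} {a : Fin S.N}
    (ha : T ∈ S.omega a) : (S.dof a).cell ⊆ T := by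
  obtain ⟨hT, x, hx, hx'⟩ := S.mem_omega.1 ha
  obtain ⟨y, hy, hy'⟩ := mem_closure_iff.1 hx' _ isOpen_interior hx
  by_contra hcon
  exact hy' (S.basis_eq_zero_of_not_subset hκ hρ hd hΩ hM hT hcon y (interior_subset hy))

/-- Otherwise the basis function would vanish in the interior of every cell, hence everywhere by
continuity. This ensures that `transfer` never divides by zero. -/
theorem omega_nonempty (a : Fin S.N) : (S.omega a).Nonempty := by
  by_contra hcon
  rw [Finset.not_nonempty_iff_eq_empty] at hcon
  refine S.basis.ne_zero a (Subtype.ext (funext fun x => ?_))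
  by_cases hx : x ∈ Ω
  swap
  · exact (S.basis a).2.1.2 x hx
  obtain ⟨T, hT, hxT⟩ := M.exists_cell_of_mem (subset_closure hx)
  have hint : EqOn (S.basis a : E d → ℝ) (fun _ => (0 : ℝ)) (interior (hull T)) := by
    intro y hy
    by_contra hne
    have : T ∈ S.omega a := S.mem_omega.2 ⟨hT, y, hy, subset_tsupport _ hne⟩
    rw [hcon] at this
    simp at this
  have hcl := (convex_convexHull ℝ (T : Set (E d))).closure_interior_eq_closure_of_nonempty_interior
    (M.interior_hull_nonempty hT)
  exact hint.of_subset_closure ((S.basis a).2.1.1 T hT).contDiffOn.continuousOn continuousOn_const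
    interior_subset (by rw [hcl]; exact subset_closure) hxT

end DofSystem

/-! ### Local energies -/

/-- The integrand of the inner product `(f, g)_{λ,h}`. -/
def energyDensity (lam : ℝ) (f g : E d → ℝ) (x : E d) : ℝ :=
  Mesh.hessInner f g x + 2 * lam * inner ℝ (gradient f x) (gradient g x) + lam ^ 2 * (f x * g x)

/-- The contribution of the cell `T` to the inner product `(f, g)_{λ,h}`. -/
def localEnergy (lam : ℝ) (T : Finset (E d)) (f g : E d → ℝ) : ℝ :=
  ∫ x in hull T, energyDensity lam f g x

theorem hessInner_congr {f f' g g' : E d → ℝ} {x : E d} (hf : f =ᶠ[nhds x] f')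
    (hg : g =ᶠ[nhds x] g') : Mesh.hessInner f g x = Mesh.hessInner f' g' x := by
  simp only [Mesh.hessInner, (hf.iteratedFDeriv ℝ 2).eq_of_nhds, (hg.iteratedFDeriv ℝ 2).eq_of_nhds]

theorem energyDensity_congr {lam : ℝ} {f f' g g' : E d → ℝ} {x : E d} (hf : f =ᶠ[nhds x] f')
    (hg : g =ᶠ[nhds x] g') : energyDensity lam f g x = energyDensity lam f' g' x := by
  simp only [energyDensity, hessInner_congr hf hg, gradient, hf.fderiv_eq, hg.fderiv_eq,
    hf.eq_of_nhds, hg.eq_of_nhds]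

theorem hessInner_eq {f g : E d → ℝ} (hf : ContDiff ℝ (⊤ : ℕ∞) f) (hg : ContDiff ℝ (⊤ : ℕ∞) g)
    (x : E d) : Mesh.hessInner f g x = ∑ i : Fin d, ∑ j : Fin d,
      dirDeriv [EuclideanSpace.single i 1, EuclideanSpace.single j 1] f x *
        dirDeriv [EuclideanSpace.single i 1, EuclideanSpace.single j 1] g x := by
  simp only [Mesh.hessInner, iteratedFDeriv_eq_dirDeriv hf, iteratedFDeriv_eq_dirDeriv hg]
  rfl

theorem hessInner_comm (f g : E d → ℝ) (x : E d) :
    Mesh.hessInner f g x = Mesh.hessInner g f x := by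
  simp only [Mesh.hessInner, mul_comm]

theorem energyDensity_comm (lam : ℝ) (f g : E d → ℝ) (x : E d) :
    energyDensity lam f g x = energyDensity lam g f x := by
  simp only [energyDensity, hessInner_comm f g, mul_comm (f x), real_inner_comm]

theorem continuous_gradient {f : E d → ℝ} (hf : ContDiff ℝ (⊤ : ℕ∞) f) :
    Continuous (gradient f) :=
  (InnerProductSpace.toDual ℝ (E d)).symm.continuous.comp (hf.continuous_fderiv (by simp))

theorem continuous_hessInner {f g : E d → ℝ} (hf : ContDiff ℝ (⊤ : ℕ∞) f)
    (hg : ContDiff ℝ (⊤ : ℕ∞) g) : Continuous (Mesh.hessInner f g) := by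
  rw [show Mesh.hessInner f g = _ from funext (hessInner_eq hf hg)]
  exact continuous_finsetSum _ fun i _ => continuous_finsetSum _ fun j _ =>
    (contDiff_dirDeriv hf _).continuous.mul (contDiff_dirDeriv hg _).continuous

theorem continuous_energyDensity (lam : ℝ) {f g : E d → ℝ} (hf : ContDiff ℝ (⊤ : ℕ∞) f)
    (hg : ContDiff ℝ (⊤ : ℕ∞) g) : Continuous (energyDensity lam f g) :=
  ((continuous_hessInner hf hg).add (continuous_const.mul
    ((continuous_gradient hf).inner (continuous_gradient hg)))).add
    (continuous_const.mul (hf.continuous.mul hg.continuous))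

theorem energyDensity_add_smul (lam : ℝ) {f g w : E d → ℝ} (hf : ContDiff ℝ (⊤ : ℕ∞) f)
    (hg : ContDiff ℝ (⊤ : ℕ∞) g) (hw : ContDiff ℝ (⊤ : ℕ∞) w) (c : ℝ) (x : E d) :
    energyDensity lam (f + c • g) w x = energyDensity lam f w x + c * energyDensity lam g w x := by
  have hcg : ContDiff ℝ (⊤ : ℕ∞) (c • g) := hg.const_smul c
  have h1 : gradient (f + c • g) x = gradient f x + c • gradient g x := by
    simp only [gradient]
    rw [fderiv_add (hf.differentiable (by simp) x) (hcg.differentiable (by simp) x),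
      fderiv_const_smul (hg.differentiable (by simp) x), map_add, map_smulₛₗ]
    rfl
  have hfcg : ContDiff ℝ (⊤ : ℕ∞) (f + c • g) := hf.add hcg
  have h2 : Mesh.hessInner (f + c • g) w x = Mesh.hessInner f w x + c * Mesh.hessInner g w x := by
    rw [hessInner_eq hfcg hw, hessInner_eq hf hw, hessInner_eq hg hw, Finset.mul_sum,
      ← Finset.sum_add_distrib]
    refine Finset.sum_congr rfl fun i _ => ?_
    rw [Finset.mul_sum, ← Finset.sum_add_distrib]
    refine Finset.sum_congr rfl fun j _ => ?_
    rw [dirDeriv_add hf hcg, dirDeriv_smul hg, Pi.add_apply, Pi.smul_apply, smul_eq_mul]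
    ring
  simp only [energyDensity, h1, h2, inner_add_left, real_inner_smul_left, Pi.add_apply,
    Pi.smul_apply, smul_eq_mul]
  ring

/-- Young's form of the Cauchy–Schwarz inequality: with one common weight `s` it survives summing
over terms, integrating and summing over cells. The weight is optimized at the end by
`sq_le_mul_of_forall`. -/
theorem two_mul_abs_energyDensity_le {lam : ℝ} (hlam : 0 ≤ lam) (f g : E d → ℝ) (x : E d)
    {s : ℝ} (hs : 0 < s) : 2 * |energyDensity lam f g x| ≤
      s * energyDensity lam f f x + s⁻¹ * energyDensity lam g g x := by
  have key : ∀ a b : ℝ, 2 * |a * b| ≤ s * (a * a) + s⁻¹ * (b * b) := by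
    intro a b
    have h1 : 0 ≤ s⁻¹ * (s * |a| - |b|) ^ 2 := by positivity
    have h2 : s⁻¹ * (s * |a| - |b|) ^ 2 = s * |a| ^ 2 + s⁻¹ * |b| ^ 2 - 2 * (|a| * |b|) := by
      field_simp
      ring
    rw [sq_abs, sq_abs] at h2
    rw [abs_mul]
    nlinarith
  have h1 : 2 * |Mesh.hessInner f g x| ≤
      s * Mesh.hessInner f f x + s⁻¹ * Mesh.hessInner g g x := by
    simp only [Mesh.hessInner]
    rw [Finset.mul_sum, Finset.mul_sum, ← Finset.sum_add_distrib]
    refine (mul_le_mul_of_nonneg_left (Finset.abs_sum_le_sum_abs _ _) zero_le_two).trans ?_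
    rw [Finset.mul_sum]
    refine Finset.sum_le_sum fun i _ => ?_
    rw [Finset.mul_sum, Finset.mul_sum, ← Finset.sum_add_distrib]
    refine (mul_le_mul_of_nonneg_left (Finset.abs_sum_le_sum_abs _ _) zero_le_two).trans ?_
    rw [Finset.mul_sum]
    exact Finset.sum_le_sum fun j _ => key _ _
  have h2 : 2 * |inner ℝ (gradient f x) (gradient g x)| ≤
      s * inner ℝ (gradient f x) (gradient f x) + s⁻¹ * inner ℝ (gradient g x) (gradient g x) := by
    have h3 := abs_real_inner_le_norm (gradient f x) (gradient g x)
    have h4 := key ‖gradient f x‖ ‖gradient g x‖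
    rw [abs_of_nonneg (by positivity)] at h4
    rw [real_inner_self_eq_norm_mul_norm, real_inner_self_eq_norm_mul_norm]
    linarith
  have h3 := key (f x) (g x)
  have h4 : |energyDensity lam f g x| ≤ |Mesh.hessInner f g x| +
      2 * lam * |inner ℝ (gradient f x) (gradient g x)| + lam ^ 2 * |f x * g x| := by
    refine (abs_add_le _ _).trans (add_le_add ((abs_add_le _ _).trans
      (add_le_add le_rfl ?_)) ?_)
    · rw [abs_mul, abs_of_nonneg (by positivity : (0 : ℝ) ≤ 2 * lam)]
    · rw [abs_mul, abs_of_nonneg (by positivity : (0 : ℝ) ≤ lam ^ 2)]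
  have h5 := mul_le_mul_of_nonneg_left h2 (by positivity : (0 : ℝ) ≤ 2 * lam)
  have h6 := mul_le_mul_of_nonneg_left h3 (by positivity : (0 : ℝ) ≤ lam ^ 2)
  simp only [energyDensity] at h4 ⊢
  linarith

theorem hessInner_self_nonneg (f : E d → ℝ) (x : E d) : 0 ≤ Mesh.hessInner f f x :=
  Finset.sum_nonneg fun _ _ => Finset.sum_nonneg fun _ _ => mul_self_nonneg _

theorem sq_le_energyDensity {lam : ℝ} (hlam : 0 ≤ lam) (f : E d → ℝ) (x : E d) :
    lam ^ 2 * f x ^ 2 ≤ energyDensity lam f f x := by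
  have h1 := hessInner_self_nonneg f x
  have h2 : 0 ≤ 2 * lam * inner ℝ (gradient f x) (gradient f x) :=
    mul_nonneg (by positivity) real_inner_self_nonneg
  rw [energyDensity, ← sq]
  linarith

theorem hessInner_le_energyDensity {lam : ℝ} (hlam : 0 ≤ lam) (f : E d → ℝ) (x : E d) :
    Mesh.hessInner f f x ≤ energyDensity lam f f x := by
  have h2 : 0 ≤ 2 * lam * inner ℝ (gradient f x) (gradient f x) :=
    mul_nonneg (by positivity) real_inner_self_nonneg
  have h3 : 0 ≤ lam ^ 2 * (f x * f x) := mul_nonneg (by positivity) (mul_self_nonneg _)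
  rw [energyDensity]
  linarith

theorem energyDensity_self_nonneg {lam : ℝ} (hlam : 0 ≤ lam) (f : E d → ℝ) (x : E d) :
    0 ≤ energyDensity lam f f x :=
  (hessInner_self_nonneg f x).trans (hessInner_le_energyDensity hlam f x)

theorem localEnergy_self_nonneg {lam : ℝ} (hlam : 0 ≤ lam) (T : Finset (E d)) (f : E d → ℝ) :
    0 ≤ localEnergy lam T f f :=
  integral_nonneg fun x => energyDensity_self_nonneg hlam f x

theorem localEnergy_comm (lam : ℝ) (T : Finset (E d)) (f g : E d → ℝ) :
    localEnergy lam T f g = localEnergy lam T g f := by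
  simp only [localEnergy, energyDensity_comm lam f g]

theorem eventuallyEq_of_mem_interior {T : Finset (E d)} {f f' : E d → ℝ}
    (h : EqOn f f' (hull T)) {x : E d} (hx : x ∈ interior (hull T)) : f =ᶠ[nhds x] f' :=
  Filter.eventuallyEq_of_mem (mem_interior_iff_mem_nhds.1 hx) h

/-- The boundary of a cell is a null set. In the interior, derivatives of a piecewise polynomial are
those of its piece, so integrals may be computed with the piece. -/
theorem setIntegral_hull_congr {T : Finset (E d)} {g g' : E d → ℝ}
    (h : ∀ x ∈ interior (hull T), g x = g' x) : ∫ x in hull T, g x = ∫ x in hull T, g' x := by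
  rw [← setIntegral_congr_set (Mesh.interior_hull_ae_eq T),
    ← setIntegral_congr_set (Mesh.interior_hull_ae_eq T)]
  exact setIntegral_congr_fun isOpen_interior.measurableSet h

theorem localEnergy_congr {lam : ℝ} {T : Finset (E d)} {f f' g g' : E d → ℝ}
    (hf : EqOn f f' (hull T)) (hg : EqOn g g' (hull T)) :
    localEnergy lam T f g = localEnergy lam T f' g' :=
  setIntegral_hull_congr fun _ hx => energyDensity_congr (eventuallyEq_of_mem_interior hf hx)
    (eventuallyEq_of_mem_interior hg hx)

theorem integrableOn_energyDensity (lam : ℝ) (T : Finset (E d)) {f g : E d → ℝ}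
    (hf : ContDiff ℝ (⊤ : ℕ∞) f) (hg : ContDiff ℝ (⊤ : ℕ∞) g) :
    IntegrableOn (energyDensity lam f g) (hull T) :=
  integrableOn_of_isCompact (Mesh.isCompact_hull T) (continuous_energyDensity lam hf hg)

namespace Mesh

variable {M : Mesh Ω}

theorem localEnergy_add_smul {k : ℕ} {u v w : E d → ℝ} (hu : u ∈ M.piecewisePoly k)
    (hv : v ∈ M.piecewisePoly k) (hw : w ∈ M.piecewisePoly k) {T : Finset (E d)}
    (hT : T ∈ M.cells) (lam c : ℝ) :
    localEnergy lam T (u + c • v) w = localEnergy lam T u w + c * localEnergy lam T v w := by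
  obtain ⟨f, hf, huf⟩ := exists_piece hu hT
  obtain ⟨g, hg, hvg⟩ := exists_piece hv hT
  obtain ⟨q, hq, hwq⟩ := exists_piece hw hT
  have h : EqOn (u + c • v) (f + c • g) (hull T) := fun x hx => by simp [huf hx, hvg hx]
  rw [localEnergy_congr h hwq, localEnergy_congr huf hwq, localEnergy_congr hvg hwq]
  simp only [localEnergy, energyDensity_add_smul lam hf.contDiff hg.contDiff hq.contDiff]
  rw [integral_add (integrableOn_energyDensity lam T hf.contDiff hq.contDiff)
    ((integrableOn_energyDensity lam T hg.contDiff hq.contDiff).const_mul c), integral_const_mul]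

theorem two_mul_abs_localEnergy_le {k : ℕ} {u v : E d → ℝ} (hu : u ∈ M.piecewisePoly k)
    (hv : v ∈ M.piecewisePoly k) {T : Finset (E d)} (hT : T ∈ M.cells) {lam : ℝ}
    (hlam : 0 ≤ lam) {s : ℝ} (hs : 0 < s) : 2 * |localEnergy lam T u v| ≤
      s * localEnergy lam T u u + s⁻¹ * localEnergy lam T v v := by
  obtain ⟨f, hf, huf⟩ := exists_piece hu hT
  obtain ⟨g, hg, hvg⟩ := exists_piece hv hT
  rw [localEnergy_congr huf hvg, localEnergy_congr huf huf, localEnergy_congr hvg hvg]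
  have h1 := integrableOn_energyDensity lam T hf.contDiff hf.contDiff
  have h2 := integrableOn_energyDensity lam T hg.contDiff hg.contDiff
  have h3 := integrableOn_energyDensity lam T hf.contDiff hg.contDiff
  simp only [localEnergy]
  rw [← integral_const_mul, ← integral_const_mul, ← integral_add (h1.const_mul s)
    (h2.const_mul s⁻¹)]
  refine (mul_le_mul_of_nonneg_left abs_integral_le_integral_abs zero_le_two).trans ?_
  rw [← integral_const_mul]
  exact integral_mono (h3.abs.const_mul 2) ((h1.const_mul s).add (h2.const_mul s⁻¹))
    fun x => two_mul_abs_energyDensity_le hlam f g x hs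

theorem inner_lam_eq_sum (hΩ : IsConvexPolytopalDomain Ω) {k : ℕ} {u v : E d → ℝ}
    (hu : u ∈ M.piecewisePoly k) (hv : v ∈ M.piecewisePoly k) (lam : ℝ) :
    M.inner_lam lam u v = ∑ T ∈ M.cells, localEnergy lam T u v := by
  rw [inner_lam, gradInner, l2, M.setIntegral_domain hΩ (integrable_gradInner hv hu),
    M.setIntegral_domain hΩ (integrable_l2 hv hu), Finset.mul_sum, Finset.mul_sum,
    ← Finset.sum_add_distrib, ← Finset.sum_add_distrib]
  refine Finset.sum_congr rfl fun T hT => ?_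
  obtain ⟨f, hf, huf⟩ := exists_piece hu hT
  obtain ⟨g, hg, hvg⟩ := exists_piece hv hT
  rw [localEnergy_congr huf hvg, localEnergy]
  have h1 : ∫ x in hull T, hessInner u v x = ∫ x in hull T, hessInner f g x :=
    setIntegral_hull_congr fun x hx => hessInner_congr (eventuallyEq_of_mem_interior huf hx)
      (eventuallyEq_of_mem_interior hvg hx)
  have h2 : ∫ x in hull T, inner ℝ (gradient u x) (gradient v x) =
      ∫ x in hull T, inner ℝ (gradient f x) (gradient g x) :=
    setIntegral_hull_congr fun x hx => by
      simp only [gradient, (eventuallyEq_of_mem_interior huf hx).fderiv_eq,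
        (eventuallyEq_of_mem_interior hvg hx).fderiv_eq]
  have h3 : ∫ x in hull T, u x * v x = ∫ x in hull T, f x * g x :=
    setIntegral_congr_fun (isCompact_hull T).measurableSet fun x hx => by
      simp only [huf hx, hvg hx]
  have i1 := integrableOn_of_isCompact (isCompact_hull T)
    (continuous_hessInner hf.contDiff hg.contDiff)
  have i2 := integrableOn_of_isCompact (isCompact_hull T)
    ((continuous_gradient hf.contDiff).inner (continuous_gradient hg.contDiff))
  have i3 := integrableOn_of_isCompact (isCompact_hull T) (hf.continuous.mul hg.continuous)
  rw [h1, h2, h3, ← integral_const_mul, ← integral_const_mul, ← integral_add i1 (i2.const_mul _)]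
  exact (integral_add (i1.add (i2.const_mul _)) (i3.const_mul _)).symm

theorem inner_lam_comm (lam : ℝ) (u v : E d → ℝ) : M.inner_lam lam u v = M.inner_lam lam v u := by
  simp only [inner_lam, gradInner, l2, hessInner_comm u v, mul_comm (u _), real_inner_comm]

end Mesh

/-! ### Scaled estimates for polynomials on a cell -/

/-- The scaling of the local energy relative to the sup norm. -/
def cellWeight (lam : ℝ) (T : Finset (E d)) : ℝ := hdiam T ^ d * ((hdiam T ^ 4)⁻¹ + lam ^ 2)

theorem cellWeight_nonneg (lam : ℝ) (T : Finset (E d)) : 0 ≤ cellWeight lam T := by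
  have : 0 ≤ hdiam T := Metric.diam_nonneg
  unfold cellWeight
  positivity

theorem norm_gradient_le {f : E d → ℝ} {x : E d} {B : ℝ} (hB : 0 ≤ B)
    (h : ∀ t, |dirDeriv [t] f x| ≤ B * ‖t‖) : ‖gradient f x‖ ≤ B := by
  rw [gradient, LinearIsometryEquiv.norm_map]
  exact ContinuousLinearMap.opNorm_le_bound _ hB h

theorem exists_localEnergy_le (k : ℕ) {ρ : ℝ} (hρ : 0 < ρ) (hd : 0 < d) :
    ∃ C : ℝ, 0 ≤ C ∧ ∀ (Ω : Set (E d)) (M : Mesh Ω), M.IsShapeRegular ρ → ∀ T ∈ M.cells,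
      ∀ f : E d → ℝ, IsPoly k f → ∀ B : ℝ, 0 ≤ B → (∀ y ∈ hull T, |f y| ≤ B) →
      ∀ lam : ℝ, 0 ≤ lam → localEnergy lam T f f ≤ C * (cellWeight lam T * B ^ 2) := by
  obtain ⟨C₁, hC₁, h₁⟩ := exists_inverse_estimate d k 1 hρ
  obtain ⟨C₂, hC₂, h₂⟩ := exists_inverse_estimate d k 2 hρ
  set W := volume.real (Metric.ball (0 : E d) 1)
  have hW : 0 ≤ W := measureReal_nonneg
  refine ⟨((d : ℝ) * (d * C₂ ^ 2) + C₁ ^ 2 + 1) * W, by positivity,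
    fun Ω M hM T hT f hf B hB hfB lam hlam => ?_⟩
  have hh := M.hdiam_pos hd hT
  obtain ⟨x₀, -, hb, hb'⟩ := hM.exists_ball hρ hT
  set h := hdiam T with hhdef
  set w := (h ^ 4)⁻¹ + lam ^ 2 with hw
  have hw0 : 0 ≤ w := by positivity
  have hT0 : T.Nonempty := Finset.card_pos.1 (by rw [(M.mem_cells.1 hT).2]; omega)
  have key : ∀ x ∈ hull T, ‖energyDensity lam f f x‖ ≤
      ((d : ℝ) * (d * C₂ ^ 2) + C₁ ^ 2 + 1) * (B ^ 2 * w) := by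
    intro x hx
    rw [Real.norm_eq_abs, abs_of_nonneg (energyDensity_self_nonneg hlam f x)]
    have e1 : Mesh.hessInner f f x ≤ (d : ℝ) * (d * C₂ ^ 2) * (B ^ 2 * (h ^ 4)⁻¹) := by
      rw [hessInner_eq hf.contDiff hf.contDiff]
      have : ∀ i j : Fin d, dirDeriv [EuclideanSpace.single i 1, EuclideanSpace.single j 1] f x *
          dirDeriv [EuclideanSpace.single i 1, EuclideanSpace.single j 1] f x ≤
          C₂ ^ 2 * (B ^ 2 * (h ^ 4)⁻¹) := by
        intro i j
        have h3 := h₂ _ x₀ h hh hb hb' f hf B hB hfB x hx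
          [EuclideanSpace.single i 1, EuclideanSpace.single j 1] rfl
        simp only [normProd_cons, normProd_nil, PiLp.norm_single, norm_one, mul_one] at h3
        rw [mul_comm, ← le_div_iff₀ (by positivity)] at h3
        have h4 := pow_le_pow_left₀ (abs_nonneg _) h3 2
        rw [sq_abs] at h4
        rw [← sq]
        refine h4.trans_eq ?_
        field_simp
      refine (Finset.sum_le_sum fun i _ => Finset.sum_le_sum fun j _ => this i j).trans_eq ?_
      simp only [Finset.sum_const, Finset.card_univ, Fintype.card_fin, nsmul_eq_mul]
      ring
    have e2 : inner ℝ (gradient f x) (gradient f x) ≤ C₁ ^ 2 * (B ^ 2 * (h ^ 2)⁻¹) := by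
      have h3 : ‖gradient f x‖ ≤ C₁ * B / h := by
        refine norm_gradient_le (by positivity) fun t => ?_
        have h4 := h₁ _ x₀ h hh hb hb' f hf B hB hfB x hx [t] rfl
        simp only [normProd_cons, normProd_nil, mul_one, pow_one] at h4
        rw [div_mul_eq_mul_div, le_div_iff₀ hh, mul_comm]
        exact h4
      rw [real_inner_self_eq_norm_sq]
      refine (pow_le_pow_left₀ (norm_nonneg _) h3 2).trans_eq ?_
      field_simp
    have e3 : f x * f x ≤ B ^ 2 := by
      rw [← sq]
      exact sq_le_sq' (abs_le.1 (hfB x hx)).1 (abs_le.1 (hfB x hx)).2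
    -- The gradient term scales like the geometric mean of the other two, which is why `cellWeight`
    -- needs no mixed term.
    have e4 : 2 * lam * (h ^ 2)⁻¹ ≤ w := by
      have := sq_nonneg ((h ^ 2)⁻¹ - lam)
      have h5 : (h ^ 4)⁻¹ = ((h ^ 2)⁻¹) ^ 2 := by field_simp
      rw [hw, h5]
      nlinarith
    have e5 : (h ^ 4)⁻¹ ≤ w := le_add_of_nonneg_right (by positivity)
    have e6 : lam ^ 2 ≤ w := le_add_of_nonneg_left (by positivity)
    rw [energyDensity]
    calc Mesh.hessInner f f x + 2 * lam * inner ℝ (gradient f x) (gradient f x) +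
          lam ^ 2 * (f x * f x)
        ≤ (d : ℝ) * (d * C₂ ^ 2) * (B ^ 2 * (h ^ 4)⁻¹) +
          2 * lam * (C₁ ^ 2 * (B ^ 2 * (h ^ 2)⁻¹)) + lam ^ 2 * B ^ 2 := by gcongr
      _ = (d : ℝ) * (d * C₂ ^ 2) * (B ^ 2 * (h ^ 4)⁻¹) + C₁ ^ 2 * (B ^ 2 * (2 * lam * (h ^ 2)⁻¹)) +
          B ^ 2 * lam ^ 2 := by ring
      _ ≤ (d : ℝ) * (d * C₂ ^ 2) * (B ^ 2 * w) + C₁ ^ 2 * (B ^ 2 * w) + B ^ 2 * w := by gcongr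
      _ = _ := by ring
  have h6 : |localEnergy lam T f f| ≤
      ((d : ℝ) * (d * C₂ ^ 2) + C₁ ^ 2 + 1) * (B ^ 2 * w) * volume.real (hull T) :=
    norm_setIntegral_le_of_norm_le_const (Mesh.isCompact_hull T).measure_lt_top key
  refine (le_abs_self _).trans (h6.trans ?_)
  have h7 := volume_hull_le hT0
  calc _ ≤ ((d : ℝ) * (d * C₂ ^ 2) + C₁ ^ 2 + 1) * (B ^ 2 * w) * (h ^ d * W) := by
        gcongr
    _ = _ := by
        rw [cellWeight]
        ring

theorem abs_bilin_le {D : E d →L[ℝ] E d →L[ℝ] ℝ} {B : ℝ}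
    (h : ∀ i j, |D (EuclideanSpace.single i 1) (EuclideanSpace.single j 1)| ≤ B) (s t : E d) :
    |D s t| ≤ d * (d * B) * (‖s‖ * ‖t‖) := by
  have hexp : ∀ s : E d, s = ∑ i, s i • EuclideanSpace.single i (1 : ℝ) := by
    intro s
    ext j
    simp [Finset.sum_apply, Pi.single_apply]
  have hcoord : ∀ (s : E d) (i : Fin d), |s i| ≤ ‖s‖ := fun s i => by
    simpa using PiLp.norm_apply_le s i
  have h1 : D s t = ∑ i, ∑ j, s i * (t j * D (EuclideanSpace.single i 1)
      (EuclideanSpace.single j 1)) := by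
    conv_lhs => rw [hexp s, hexp t]
    simp only [map_sum, map_smul, sum_apply, smul_apply, smul_eq_mul,
      Finset.mul_sum, mul_left_comm]
    exact Finset.sum_comm
  rw [h1]
  calc |∑ i, ∑ j, s i * (t j * D (EuclideanSpace.single i 1) (EuclideanSpace.single j 1))|
      ≤ ∑ i, ∑ j, |s i * (t j * D (EuclideanSpace.single i 1) (EuclideanSpace.single j 1))| :=
        (Finset.abs_sum_le_sum_abs _ _).trans
          (Finset.sum_le_sum fun i _ => Finset.abs_sum_le_sum_abs _ _)
    _ ≤ ∑ i : Fin d, ∑ j : Fin d, ‖s‖ * (‖t‖ * B) := by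
        refine Finset.sum_le_sum fun i _ => Finset.sum_le_sum fun j _ => ?_
        rw [abs_mul, abs_mul]
        have h2 := hcoord s i
        have h3 := hcoord t j
        have h4 := h i j
        gcongr
    _ = d * (d * B) * (‖s‖ * ‖t‖) := by
        simp only [Finset.sum_const, Finset.card_univ, Fintype.card_fin, nsmul_eq_mul]
        ring

theorem abs_dirDeriv_two_le {f : E d → ℝ} (hf : ContDiff ℝ (⊤ : ℕ∞) f) {B : ℝ}
    {x : E d} (h : ∀ i j, |dirDeriv [EuclideanSpace.single i 1, EuclideanSpace.single j 1] f x| ≤ B)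
    (s t : E d) : |dirDeriv [s, t] f x| ≤ d * (d * B) * (‖s‖ * ‖t‖) := by
  have hd : DifferentiableAt ℝ (fderiv ℝ f) x :=
    (hf.fderiv_right (m := 1) (by norm_cast)).differentiable (by simp) x
  have h1 : ∀ s t : E d, dirDeriv [s, t] f x = fderiv ℝ (fderiv ℝ f) x s t := by
    intro s t
    have h2 := ((ContinuousLinearMap.apply ℝ ℝ t).hasFDerivAt.comp x hd.hasFDerivAt).fderiv
    simp only [dirDeriv]
    rw [show (fun x => fderiv ℝ f x t) = (ContinuousLinearMap.apply ℝ ℝ t) ∘ fderiv ℝ f from rfl, h2]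
    rfl
  rw [h1]
  exact abs_bilin_le (fun i j => by rw [← h1]; exact h i j) s t

theorem IsPoly.dirDeriv_two_eq_zero {p : E d → ℝ} (hp : IsPoly 1 p) (s t x : E d) :
    FEM.dirDeriv [s, t] p x = 0 := by
  have h := hp.dirDeriv [t]
  have h1 : FEM.dirDeriv [t] p = fun _ => FEM.dirDeriv [t] p x := funext fun y => h.eq_const y x
  change fderiv ℝ (FEM.dirDeriv [t] p) x s = 0
  rw [h1]
  simp

/-- For the `λ²` part, the L² norm bounds `f`, and with it the affine function `p`, which inherits
the bound from the vertices. For the `h⁻⁴` part, `f - p` vanishes at the vertices and has the second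
derivatives of `f`, so `abs_le_of_vanish_vertices` applies. -/
theorem exists_interpolation_le (k : ℕ) {ρ : ℝ} (hρ : 0 < ρ) (hd : 0 < d) :
    ∃ C : ℝ, 0 ≤ C ∧ ∀ (Ω : Set (E d)) (M : Mesh Ω), M.IsShapeRegular ρ → ∀ T ∈ M.cells,
      ∀ f : E d → ℝ, IsPoly k f → ∀ p : E d → ℝ, IsPoly 1 p → (∀ x ∈ T, p x = f x) →
      ∀ lam : ℝ, 0 ≤ lam → ∀ y ∈ hull T,
        cellWeight lam T * (f y - p y) ^ 2 ≤ C * localEnergy lam T f f ∧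
        lam ^ 2 * (hdiam T ^ d * p y ^ 2) ≤ C * localEnergy lam T f f := by
  obtain ⟨C₀, hC₀, h₀⟩ := exists_sq_le_integral d k hρ
  refine ⟨4 * C₀ + ((d : ℝ) * d) ^ 2 * C₀, by positivity,
    fun Ω M hM T hT f hf p hp hpf lam hlam y hy => ?_⟩
  have hh := M.hdiam_pos hd hT
  obtain ⟨x₀, -, hb, hb'⟩ := hM.exists_ball hρ hT
  have hcpt := Mesh.isCompact_hull T
  set h := hdiam T with hhdef
  set A := localEnergy lam T f f with hA
  have hA0 : 0 ≤ A := localEnergy_self_nonneg hlam T f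
  have hI : lam ^ 2 * ∫ x in hull T, f x ^ 2 ≤ A := by
    rw [← integral_const_mul]
    refine integral_mono ?_ (integrableOn_energyDensity lam T hf.contDiff hf.contDiff)
      fun x => sq_le_energyDensity hlam f x
    exact (integrableOn_of_isCompact hcpt (hf.continuous.pow 2)).const_mul _
  set I := ∫ x in hull T, f x ^ 2 with hIdef
  have hI0 : 0 ≤ I := integral_nonneg fun x => sq_nonneg _
  set B := Real.sqrt (C₀ * I / h ^ d) with hBdef
  have hB2 : B ^ 2 = C₀ * I / h ^ d := Real.sq_sqrt (by positivity)
  have hfB : ∀ z ∈ hull T, |f z| ≤ B := by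
    intro z hz
    refine Real.abs_le_sqrt ?_
    rw [le_div_iff₀ (by positivity), mul_comm]
    exact h₀ _ x₀ h hcpt hh hb hb' f hf z hz
  have hpB : ∀ z ∈ hull T, |p z| ≤ B := abs_affine_le hp fun x hx => by
    rw [hpf x hx]
    exact hfB x (subset_hull T hx)
  have hB0 : 0 ≤ B := Real.sqrt_nonneg _
  have hlamB : lam ^ 2 * (h ^ d * B ^ 2) ≤ C₀ * A := by
    rw [hB2, mul_div_cancel₀ _ (by positivity : (h ^ d : ℝ) ≠ 0), mul_left_comm]
    gcongr
  have hder : ∀ i j : Fin d, ∀ z ∈ hull T,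
      |dirDeriv [EuclideanSpace.single i 1, EuclideanSpace.single j 1] f z| ≤
        Real.sqrt (C₀ * A / h ^ d) := by
    intro i j z hz
    refine Real.abs_le_sqrt ?_
    rw [le_div_iff₀ (by positivity), mul_comm]
    refine (h₀ _ x₀ h hcpt hh hb hb' _ ((hf.dirDeriv _).mono (Nat.sub_le _ _)) z hz).trans ?_
    gcongr
    refine integral_mono (integrableOn_of_isCompact hcpt
      ((contDiff_dirDeriv hf.contDiff _).continuous.pow 2))
      (integrableOn_energyDensity lam T hf.contDiff hf.contDiff) fun x =>
        le_trans ?_ (hessInner_le_energyDensity hlam f x)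
    rw [hessInner_eq hf.contDiff hf.contDiff]
    have h1 := Finset.single_le_sum (f := fun i : Fin d => ∑ j : Fin d,
      dirDeriv [EuclideanSpace.single i 1, EuclideanSpace.single j 1] f x *
        dirDeriv [EuclideanSpace.single i 1, EuclideanSpace.single j 1] f x)
      (fun i _ => Finset.sum_nonneg fun j _ => mul_self_nonneg _) (Finset.mem_univ i)
    have h2 := Finset.single_le_sum (f := fun j : Fin d =>
      dirDeriv [EuclideanSpace.single i 1, EuclideanSpace.single j 1] f x *
        dirDeriv [EuclideanSpace.single i 1, EuclideanSpace.single j 1] f x)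
      (fun j _ => mul_self_nonneg _) (Finset.mem_univ j)
    rw [sq]
    exact h2.trans h1
  set B' := Real.sqrt (C₀ * A / h ^ d) with hB'def
  have hB'2 : B' ^ 2 = C₀ * A / h ^ d := Real.sq_sqrt (by positivity)
  have hB'0 : 0 ≤ B' := Real.sqrt_nonneg _
  have hfp : ContDiff ℝ (⊤ : ℕ∞) (f + (-1 : ℝ) • p) := hf.contDiff.add (hp.smul (-1)).contDiff
  have hvan := abs_le_of_vanish_vertices (T := T) hfp (fun x hx => by simp [hpf x hx])
    (B := (d : ℝ) * (d * B')) (by positivity) (fun z hz s t => by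
      rw [dirDeriv_add hf.contDiff (hp.smul (-1)).contDiff, Pi.add_apply,
        (hp.smul (-1)).dirDeriv_two_eq_zero, add_zero]
      exact abs_dirDeriv_two_le hf.contDiff (fun i j => hder i j z hz) s t) y hy
  have hval : (f + (-1 : ℝ) • p) y = f y - p y := by simp; ring
  rw [hval] at hvan
  have e1 : (f y - p y) ^ 2 ≤ (d * (d * B') * h ^ 2) ^ 2 := by
    rw [← sq_abs]
    exact pow_le_pow_left₀ (abs_nonneg _) hvan 2
  have e2 : (f y - p y) ^ 2 ≤ (2 * B) ^ 2 := by
    rw [← sq_abs]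
    refine pow_le_pow_left₀ (abs_nonneg _) ((abs_sub _ _).trans ?_) 2
    linarith [hfB y hy, hpB y hy]
  have e3 : h ^ d * ((h ^ 4)⁻¹ * (f y - p y) ^ 2) ≤ ((d : ℝ) * d) ^ 2 * C₀ * A := by
    calc h ^ d * ((h ^ 4)⁻¹ * (f y - p y) ^ 2)
        ≤ h ^ d * ((h ^ 4)⁻¹ * (d * (d * B') * h ^ 2) ^ 2) := by gcongr
      _ = ((d : ℝ) * d) ^ 2 * (h ^ d * B' ^ 2) := by
          field_simp
      _ = _ := by
          rw [hB'2, mul_div_cancel₀ _ (by positivity : (h ^ d : ℝ) ≠ 0), mul_assoc]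
  have e4 : lam ^ 2 * (h ^ d * (f y - p y) ^ 2) ≤ 4 * C₀ * A := by
    calc lam ^ 2 * (h ^ d * (f y - p y) ^ 2) ≤ lam ^ 2 * (h ^ d * (2 * B) ^ 2) := by gcongr
      _ = 4 * (lam ^ 2 * (h ^ d * B ^ 2)) := by ring
      _ ≤ 4 * (C₀ * A) := by gcongr
      _ = _ := by ring
  constructor
  · calc cellWeight lam T * (f y - p y) ^ 2
        = h ^ d * ((h ^ 4)⁻¹ * (f y - p y) ^ 2) + lam ^ 2 * (h ^ d * (f y - p y) ^ 2) := by
          rw [cellWeight]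
          ring
      _ ≤ ((d : ℝ) * d) ^ 2 * C₀ * A + 4 * C₀ * A := add_le_add e3 e4
      _ = _ := by ring
  · have e5 : p y ^ 2 ≤ B ^ 2 := by
      rw [← sq_abs]
      exact pow_le_pow_left₀ (abs_nonneg _) (hpB y hy) 2
    calc lam ^ 2 * (h ^ d * p y ^ 2) ≤ lam ^ 2 * (h ^ d * B ^ 2) := by gcongr
      _ ≤ C₀ * A := hlamB
      _ ≤ (4 * C₀ + ((d : ℝ) * d) ^ 2 * C₀) * A := by
          gcongr
          nlinarith [mul_nonneg (sq_nonneg ((d : ℝ) * d)) hC₀]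

/-! ### The transfer operator -/

theorem Dof.ofFn_dir {a : Dof d} (h : a.order = 1) :
    List.ofFn a.dir = [a.dir ⟨0, by omega⟩] := by
  obtain ⟨j, p, r, m, t⟩ := a
  simp only at h
  subst h
  rfl

theorem Mesh.fderivWithin_eq_piece {M : Mesh Ω} {T : Finset (E d)} (hT : T ∈ M.cells)
    {v f : E d → ℝ} (hf : ContDiff ℝ (⊤ : ℕ∞) f) (hvf : EqOn v f (hull T)) {x : E d}
    (hx : x ∈ hull T) : fderivWithin ℝ v (hull T) x = fderiv ℝ f x := by
  rw [fderivWithin_congr hvf (hvf hx),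
    fderivWithin_eq_fderiv (M.uniqueDiffOn_hull hT x hx) (hf.differentiable (by simp) x)]

theorem RefDomain.average_sub {j : ℕ} (r : RefDomain j) (p : Fin (j + 1) → E d) {f g : E d → ℝ}
    (hf : Continuous f) (hg : Continuous g) :
    r.average p f - r.average p g = r.average p (f + (-1 : ℝ) • g) := by
  rw [r.average_add p hf (hg.const_smul (-1 : ℝ)), r.average_smul]
  ring

namespace DofSystem

variable {M : Mesh Ω} {k : ℕ} {L : NodeLayout d k} {κ : ℝ} (S : DofSystem M L κ)

theorem domain_subset (a : Fin S.N) {T : Finset (E d)} (ha : (S.dof a).cell ⊆ T) :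
    (S.dof a).domain ⊆ hull T := by
  refine (RefDomain.carrier_subset (S.dom_isValid a) _).trans ?_
  rw [← Dof.hull_cell]
  exact hull_mono ha

/-- Points carrying first order degrees of freedom are C¹ points, and `v` vanishes off `Ω`, so its
gradient there is normal. Hence `v` itself obeys the formula by which the transfer operator
prescribes boundary derivatives. -/
theorem fderiv_dir_eq (hd : d = 2 ∨ d = 3) (hΩ : IsConvexPolytopalDomain Ω) (v : M.Vh k)
    {a : Fin S.N} (h : (S.dof a).domain ⊆ frontier Ω) (h1 : (S.dof a).order = 1)
    {T : Finset (E d)} (hT : T ∈ M.cells) (ha : (S.dof a).cell ⊆ T) {f : E d → ℝ}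
    (hf : IsPoly k f) (hvf : EqOn (v : E d → ℝ) f (hull T)) {y : E d}
    (hy : y ∈ (S.dof a).domain) (t : E d) :
    fderiv ℝ f y t = fderiv ℝ f y (outerNormal Ω (S.dof a).domain) *
      inner ℝ (outerNormal Ω (S.dof a).domain) t := by
  set n := outerNormal Ω (S.dof a).domain with hn
  have hdisj : Disjoint Ω (S.dof a).domain := by
    rw [Set.disjoint_left]
    intro x hx hxD
    have := h hxD
    rw [frontier, hΩ.isOpen.interior_eq] at this
    exact this.2 hx
  obtain ⟨hn1, hn2⟩ : ‖n‖ = 1 ∧ ∀ x ∈ (S.dof a).domain, ∀ y ∈ Ω, inner ℝ (y - x) n ≤ 0 :=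
    outerNormal_spec hΩ (RefDomain.convex_carrier _ _) (RefDomain.carrier_nonempty _ _) hdisj
  have hval := S.valid a
  have hcard : (S.dof a).cell.card = (S.dof a).dim + 1 := by
    classical
    have hinj : Function.Injective (S.dof a).vtx := fun i j hij =>
      hval.2.1.injective (congrArg S.num hij)
    simp only [Dof.cell]
    convert Finset.card_image_of_injective Finset.univ hinj
    simp
  have hyc : y ∈ hull (S.dof a).cell := S.domain_subset a subset_rfl hy
  have hdim : 1 + (S.dof a).dim + 1 ≤ d := by
    have := hval.2.2.1
    unfold IsDofDim at this
    omega
  have hC := Mesh.isCmAt_of_mem hd le_rfl hdim v hval.1 hcard hyc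
  have hyT := S.domain_subset a ha hy
  have hg := Mesh.hasFDerivWithinAt_closure v.2.1 hC hT hf hvf hyT
  have h0 := fderiv_eq_zero_of_tangential hΩ (M.cells_subset_closure hT hyT)
    (fun hyΩ => Set.disjoint_left.1 hdisj hyΩ hy)
    (norm_ne_zero_iff.1 (by rw [hn1]; exact one_ne_zero)) (hn2 y hy)
    (τ := t - (inner ℝ n t : ℝ) • n) (by
      rw [inner_sub_left, real_inner_smul_left, real_inner_self_eq_norm_sq, hn1, one_pow, mul_one,
        real_inner_comm, sub_self]) v.2.1.2 hg
  rw [map_sub, map_smul, smul_eq_mul, sub_eq_zero] at h0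
  rw [h0, mul_comm]

theorem normProd_dir (a : Fin S.N) : normProd (List.ofFn (S.dof a).dir) = 1 := by
  rw [normProd_ofFn]
  exact Finset.prod_eq_one fun i _ => ((S.valid a).2.2.2.2 i).1

theorem order_le (hd : d ≤ 3) (a : Fin S.N) : (S.dof a).order ≤ 2 := by
  have := (S.valid a).2.2.1
  unfold IsDofDim at this
  omega

/-- The degree of freedom of `v` is the same on all cells of `omega`, so it can be written as the
average over them and compared with the transfer cell by cell. -/
theorem repr_sub_transfer (v : M.Vh k) (p : M.V0) (a : Fin S.N)
    (hsub : ∀ T ∈ S.omega a, (S.dof a).cell ⊆ T) :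
    S.basis.repr (v - S.transfer p) a = ((S.omega a).card : ℝ)⁻¹ *
      ∑ T ∈ S.omega a, ((S.dof a).evalOn T v - S.localValue p a T) := by
  have h1 : S.basis.repr (S.transfer p) a =
      ((S.omega a).card : ℝ)⁻¹ * ∑ T ∈ S.omega a, S.localValue p a T := by
    rw [transfer, S.basis.repr_sum_self]
  have h2 : ∑ T ∈ S.omega a, (S.dof a).evalOn T v = (S.omega a).card * S.basis.repr v a := by
    rw [Finset.sum_congr rfl fun T hT => S.evalOn_eq_repr (S.mem_omega.1 hT).1 (hsub T hT) v,
      Finset.sum_const, nsmul_eq_mul]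
  have h3 : ((S.omega a).card : ℝ) ≠ 0 :=
    Nat.cast_ne_zero.2 (Finset.card_pos.2 (S.omega_nonempty a)).ne'
  rw [map_sub, Finsupp.sub_apply, h1, Finset.sum_sub_distrib, h2, mul_sub, inv_mul_cancel_left₀ h3]

end DofSystem

/-- Both values are averages of the same derivative of the two polynomial pieces (in the boundary
case thanks to `fderiv_dir_eq`), so the inverse estimate applies to their difference. Orders are at
most two, hence three constants. -/
theorem exists_transfer_local_le {k : ℕ} (L : NodeLayout d k) {ρ : ℝ} (κ : ℝ) (hρ : 0 < ρ)
    (hd : d = 2 ∨ d = 3) (hk : 1 ≤ k) :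
    ∃ C : ℝ, 0 ≤ C ∧ ∀ (Ω : Set (E d)), IsConvexPolytopalDomain Ω → ∀ M : Mesh Ω,
      M.IsShapeRegular ρ → ∀ S : DofSystem M L κ, ∀ (v : M.Vh k) (p : M.V0) (a : Fin S.N),
      ∀ T ∈ M.cells, (S.dof a).cell ⊆ T → ∀ B : ℝ, 0 ≤ B →
      (∀ y ∈ hull T, |(v : E d → ℝ) y - (p : E d → ℝ) y| ≤ B) →
      hdiam T ^ (S.dof a).order * |(S.dof a).evalOn T v - S.localValue p a T| ≤ C * B := by
  have hinv := fun m => exists_inverse_estimate d k m hρ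
  choose C hC hinv using hinv
  refine ⟨C 0 + C 1 + C 2, add_nonneg (add_nonneg (hC 0) (hC 1)) (hC 2),
    fun Ω hΩ M hM S v p a T hT ha B hB hvp => ?_⟩
  have hh := M.hdiam_pos (by omega) hT
  obtain ⟨x₀, -, hb, hb'⟩ := hM.exists_ball hρ hT
  obtain ⟨f, hf, hvf⟩ := Mesh.exists_piece v.2.1 hT
  obtain ⟨q, hq, hpq⟩ := Mesh.exists_piece p.2 hT
  have hqk := hq.mono hk
  have he : IsPoly k (f + (-1 : ℝ) • q) := hf.add (hqk.smul (-1))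
  have heB : ∀ y ∈ hull T, |(f + (-1 : ℝ) • q) y| ≤ B := by
    intro y hy
    have := hvp y hy
    rw [hvf hy, hpq hy] at this
    simpa [sub_eq_add_neg] using this
  have hest : ∀ l : List (E d), l.length = (S.dof a).order → ∀ y ∈ hull T,
      |dirDeriv l f y - dirDeriv l q y| ≤
        (C 0 + C 1 + C 2) * B / hdiam T ^ (S.dof a).order * normProd l := by
    intro l hl y hy
    have h1 := hinv _ _ x₀ _ hh hb hb' _ he B hB heB y hy l hl
    rw [dirDeriv_add hf.contDiff (hqk.smul (-1)).contDiff, dirDeriv_smul hqk.contDiff,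
      Pi.add_apply, Pi.smul_apply, smul_eq_mul, neg_one_mul, ← sub_eq_add_neg] at h1
    rw [div_mul_eq_mul_div, le_div_iff₀ (by positivity), mul_comm]
    refine h1.trans ?_
    have hn := normProd_nonneg l
    gcongr
    have h2 := S.order_le (by omega) a
    have := hC 0
    have := hC 1
    have := hC 2
    interval_cases (S.dof a).order <;> linarith
  have hnn : 0 ≤ (C 0 + C 1 + C 2) * B / hdiam T ^ (S.dof a).order := by
    have := hC 0
    have := hC 1
    have := hC 2
    positivity
  rw [mul_comm, ← le_div_iff₀ (by positivity)]
  have hdomT := S.domain_subset a ha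
  rw [Dof.evalOn_eq (S.dom_isValid a) hT ha hf.contDiff hvf]
  unfold DofSystem.localValue
  split_ifs with h
  · obtain ⟨hD, h1⟩ := h
    set n := outerNormal Ω (S.dof a).domain with hn
    set t := (S.dof a).dir ⟨0, by omega⟩ with ht
    have hnt : ‖t‖ = 1 := ((S.valid a).2.2.2.2 _).1
    have hn1 : ‖n‖ = 1 := by
      refine (outerNormal_spec hΩ (RefDomain.convex_carrier _ _)
        (RefDomain.carrier_nonempty _ _) ?_).1
      rw [Set.disjoint_left]
      intro x hx hxD
      have := hD hxD
      rw [frontier, hΩ.isOpen.interior_eq] at this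
      exact this.2 hx
    have e1 : (S.dof a).dom.average (S.dof a).vtx (dirDeriv (List.ofFn (S.dof a).dir) f) =
        (S.dof a).dom.average (S.dof a).vtx fun y => fderiv ℝ f y n * inner ℝ n t := by
      rw [Dof.ofFn_dir h1]
      exact RefDomain.average_congr _ _ fun y hy =>
        S.fderiv_dir_eq hd hΩ v hD h1 hT ha hf hvf hy t
    have e2 : (S.dof a).dom.average (S.dof a).vtx
        (fun y => fderivWithin ℝ (p : E d → ℝ) (hull T) y n * inner ℝ n t) =
        (S.dof a).dom.average (S.dof a).vtx fun y => fderiv ℝ q y n * inner ℝ n t :=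
      RefDomain.average_congr _ _ fun y hy => by
        simp only [Mesh.fderivWithin_eq_piece hT hq.contDiff hpq (hdomT hy)]
    have hcf : Continuous fun y => fderiv ℝ f y n * (inner ℝ n t : ℝ) :=
      (contDiff_dirDeriv hf.contDiff [n]).continuous.mul continuous_const
    have hcq : Continuous fun y => fderiv ℝ q y n * (inner ℝ n t : ℝ) :=
      (contDiff_dirDeriv hq.contDiff [n]).continuous.mul continuous_const
    rw [e1, e2, RefDomain.average_sub _ _ hcf hcq]
    refine RefDomain.abs_average_le _ _ hnn fun y hy => ?_
    have e3 := hest [n] h1.symm y (hdomT hy)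
    simp only [normProd_cons, normProd_nil, hn1, mul_one] at e3
    have e4 : |(inner ℝ n t : ℝ)| ≤ 1 := by
      have := abs_real_inner_le_norm n t
      rwa [hn1, hnt, one_mul] at this
    have e5 : ((fun y => fderiv ℝ f y n * inner ℝ n t) +
        (-1 : ℝ) • fun y => fderiv ℝ q y n * inner ℝ n t) y =
        (dirDeriv [n] f y - dirDeriv [n] q y) * inner ℝ n t := by
      simp only [Pi.add_apply, Pi.smul_apply, smul_eq_mul, dirDeriv]
      ring
    rw [e5, abs_mul]
    exact (mul_le_of_le_one_right (abs_nonneg _) e4).trans e3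
  · rw [Dof.evalOn_eq (S.dom_isValid a) hT ha hq.contDiff hpq, RefDomain.average_sub _ _
      (contDiff_dirDeriv hf.contDiff _).continuous (contDiff_dirDeriv hq.contDiff _).continuous]
    refine RefDomain.abs_average_le _ _ hnn fun y hy => ?_
    have e3 := hest (List.ofFn (S.dof a).dir) (by simp) y (hdomT hy)
    rw [S.normProd_dir, mul_one] at e3
    simpa [sub_eq_add_neg] using e3

/-! ### The symmetric Gauss-Seidel smoother -/

-- Symmetry gives `A = B + Bᵀ - D`, and substituting this into the definition collapses the smoother
-- to `(B⁻¹)ᵀ * D * B⁻¹`. Its inverse `B * D' * Bᵀ` is a weighted sum of squares of the entries of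
-- `Bᵀ *ᵥ c`.
open Matrix in
theorem dotProduct_inv_symGaussSeidel {N : ℕ} {A : Matrix (Fin N) (Fin N) ℝ}
    (hA : ∀ i j, A i j = A j i) (hd : ∀ i, A i i ≠ 0) (c : Fin N → ℝ) :
    c ⬝ᵥ ((symGaussSeidel A)⁻¹ *ᵥ c) =
      ∑ i, (∑ j, if i ≤ j then c j * A j i else 0) ^ 2 / A i i := by
  set B : Matrix (Fin N) (Fin N) ℝ := Matrix.of fun i j => if j ≤ i then A i j else 0 with hB
  set D : Matrix (Fin N) (Fin N) ℝ := Matrix.diagonal fun i => A i i with hD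
  set D' : Matrix (Fin N) (Fin N) ℝ := Matrix.diagonal fun i => (A i i)⁻¹ with hD'
  have hdet : IsUnit B.det := by
    have hlow : B.BlockTriangular OrderDual.toDual := by
      intro i j hij
      have : ¬ j ≤ i := not_le.2 (OrderDual.toDual_lt_toDual.1 hij)
      simp [hB, this]
    rw [Matrix.det_of_isLowerTriangular B hlow, isUnit_iff_ne_zero]
    exact Finset.prod_ne_zero_iff.2 fun i _ => by simpa [hB] using hd i
  have hAB : A = B + Bᵀ - D := by
    ext i j
    simp only [hB, hD, Matrix.sub_apply, Matrix.add_apply, Matrix.of_apply, Matrix.transpose_apply,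
      Matrix.diagonal_apply]
    rcases lt_trichotomy i j with h | h | h
    · rw [if_neg (not_le.2 h), if_pos h.le, if_neg h.ne, hA i j]
      ring
    · subst h
      simp
    · rw [if_pos h.le, if_neg (not_le.2 h), if_neg h.ne']
      ring
  have hBR : B * B⁻¹ = 1 := Matrix.mul_nonsing_inv B hdet
  have hRB : B⁻¹ * B = 1 := Matrix.nonsing_inv_mul B hdet
  have hRBt : (B⁻¹)ᵀ * Bᵀ = 1 := by rw [← Matrix.transpose_mul, hBR, Matrix.transpose_one]
  have hDD : D * D' = 1 := by
    rw [hD, hD', Matrix.diagonal_mul_diagonal, ← Matrix.diagonal_one]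
    congr 1
    funext i
    exact mul_inv_cancel₀ (hd i)
  have hsym : symGaussSeidel A = (B⁻¹)ᵀ * D * B⁻¹ := by
    have hgs : gaussSeidel A = B⁻¹ := rfl
    have h1 : (B⁻¹)ᵀ * A * B⁻¹ = (B⁻¹)ᵀ * (B * B⁻¹) + ((B⁻¹)ᵀ * Bᵀ) * B⁻¹ - (B⁻¹)ᵀ * D * B⁻¹ := by
      conv_lhs => rw [hAB]
      noncomm_ring
    rw [symGaussSeidel, hgs, h1, hBR, hRBt]
    noncomm_ring
  have hinv : (symGaussSeidel A)⁻¹ = B * D' * Bᵀ := by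
    refine Matrix.inv_eq_right_inv ?_
    rw [hsym]
    calc (B⁻¹)ᵀ * D * B⁻¹ * (B * D' * Bᵀ) = (B⁻¹)ᵀ * (D * ((B⁻¹ * B) * D')) * Bᵀ := by
          noncomm_ring
      _ = 1 := by rw [hRB, one_mul, hDD, mul_one, hRBt]
  rw [hinv, ← Matrix.mulVec_mulVec, ← Matrix.mulVec_mulVec, Matrix.dotProduct_mulVec,
    ← Matrix.mulVec_transpose, dotProduct]
  refine Finset.sum_congr rfl fun i _ => ?_
  have h2 : (Bᵀ *ᵥ c) i = ∑ j, if i ≤ j then c j * A j i else 0 := by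
    rw [Matrix.mulVec, dotProduct]
    refine Finset.sum_congr rfl fun j _ => ?_
    simp only [hB, Matrix.transpose_apply, Matrix.of_apply]
    split_ifs
    · ring
    · ring
  rw [hD', Matrix.mulVec_diagonal, h2]
  ring

theorem sq_le_mul_of_forall {x A X : ℝ} (hA : 0 < A) (hX : 0 ≤ X)
    (h : ∀ s, 0 < s → 2 * |x| ≤ s * A + s⁻¹ * X) : x ^ 2 ≤ A * X := by
  rcases eq_or_ne x 0 with rfl | hx
  · rw [zero_pow two_ne_zero]
    positivity
  have hx' := abs_pos.2 hx
  -- With this weight the first term on the right equals `|x|` and cancels half of the left side.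
  have h1 := h (|x| / A) (by positivity)
  rw [div_mul_cancel₀ _ hA.ne', inv_div] at h1
  have h2 : |x| ≤ A / |x| * X := by linarith
  rw [div_mul_eq_mul_div, le_div_iff₀ hx'] at h2
  rw [← sq_abs, sq]
  exact h2

namespace Mesh

variable {M : Mesh Ω}

theorem inner_lam_add_smul (hΩ : IsConvexPolytopalDomain Ω) {k : ℕ} (u v w : M.Vh k)
    (lam c : ℝ) : M.inner_lam lam ((u + c • v : M.Vh k) : E d → ℝ) w =
      M.inner_lam lam u w + c * M.inner_lam lam v w := by
  rw [inner_lam_eq_sum hΩ (u + c • v).2.1 w.2.1, inner_lam_eq_sum hΩ u.2.1 w.2.1,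
    inner_lam_eq_sum hΩ v.2.1 w.2.1, Finset.mul_sum, ← Finset.sum_add_distrib]
  exact Finset.sum_congr rfl fun T hT => localEnergy_add_smul u.2.1 v.2.1 w.2.1 hT lam c

theorem inner_lam_sum (hΩ : IsConvexPolytopalDomain Ω) {k N : ℕ} (c : Fin N → ℝ)
    (φ : Fin N → M.Vh k) (w : M.Vh k) (lam : ℝ) :
    M.inner_lam lam ((∑ j, c j • φ j : M.Vh k) : E d → ℝ) w =
      ∑ j, c j * M.inner_lam lam (φ j) w := by
  have h0 : M.inner_lam lam ((0 : M.Vh k) : E d → ℝ) w = 0 := by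
    have := inner_lam_add_smul hΩ (0 : M.Vh k) 0 w lam 1
    rw [smul_zero, add_zero] at this
    linarith
  let g : M.Vh k →ₗ[ℝ] ℝ :=
    { toFun := fun v => M.inner_lam lam v w
      map_add' := fun u v => by
        have := inner_lam_add_smul hΩ u v w lam 1
        rwa [one_smul, one_mul] at this
      map_smul' := fun a v => by
        have := inner_lam_add_smul hΩ 0 v w lam a
        rwa [zero_add, h0, zero_add] at this }
  have := map_sum g (fun j => c j • φ j) Finset.univ
  simp only [map_smul] at this
  exact this

/-- The mass term alone is definite because `λ > 0`. -/
theorem inner_lam_self_pos {k : ℕ} {v : M.Vh k} (hv : v ≠ 0)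
    {lam : ℝ} (hlam : 0 < lam) : 0 < M.inner_lam lam v v := by
  have h1 : lam ^ 2 * l2 Ω v v ≤ M.inner_lam lam v v := by
    have h2 : 0 ≤ ∑ T ∈ M.cells, ∫ x in hull T, hessInner (v : E d → ℝ) v x :=
      Finset.sum_nonneg fun T _ => integral_nonneg fun x => hessInner_self_nonneg _ x
    have h3 : 0 ≤ gradInner Ω (v : E d → ℝ) v := integral_nonneg fun x => real_inner_self_nonneg
    have h4 := mul_nonneg (by positivity : (0 : ℝ) ≤ 2 * lam) h3
    rw [inner_lam]
    linarith
  have h2 : 0 ≤ l2 Ω (v : E d → ℝ) v := integral_nonneg fun x => mul_self_nonneg _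
  have h3 : l2 Ω (v : E d → ℝ) v ≠ 0 := fun h =>
    hv (Subtype.ext (eq_zero_of_l2_self v.2.1 h))
  have h4 : 0 < l2 Ω (v : E d → ℝ) v := lt_of_le_of_ne h2 h3.symm
  exact lt_of_lt_of_le (by positivity) h1

end Mesh

namespace DofSystem

variable {M : Mesh Ω} {k : ℕ} {L : NodeLayout d k} {κ : ℝ} (S : DofSystem M L κ)

/-- The part `∑_{j ≥ i} c_j φ_j` of the expansion of `v` in the nodal basis. -/
def tail (v : M.Vh k) (i : Fin S.N) : M.Vh k :=
  ∑ j, (if i ≤ j then S.basis.repr v j else 0) • S.basis j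

theorem repr_tail (v : M.Vh k) (i j : Fin S.N) :
    S.basis.repr (S.tail v i) j = if i ≤ j then S.basis.repr v j else 0 := by
  rw [tail, S.basis.repr_sum_self]

theorem normSqRbar_eq (hΩ : IsConvexPolytopalDomain Ω) {lam : ℝ} (hlam : 0 < lam) (v : M.Vh k) :
    S.normSqRbar lam v = ∑ i, M.inner_lam lam (S.tail v i) (S.basis i) ^ 2 /
      M.inner_lam lam (S.basis i) (S.basis i) := by
  rw [normSqRbar, dotProduct_inv_symGaussSeidel]
  · refine Finset.sum_congr rfl fun i _ => ?_
    rw [tail, Mesh.inner_lam_sum hΩ]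
    congr 2
    refine Finset.sum_congr rfl fun j _ => ?_
    have h : S.stiffness lam j i = M.inner_lam lam (S.basis j) (S.basis i) :=
      Mesh.inner_lam_comm lam (S.basis i : E d → ℝ) (S.basis j)
    rw [ite_mul, zero_mul]
    exact if_congr Iff.rfl (by rw [h]) rfl
  · exact fun i j => Mesh.inner_lam_comm _ _ _
  · exact fun i => (Mesh.inner_lam_self_pos (S.basis.ne_zero i) hlam).ne'

-- A Cauchy–Schwarz inequality confined to the cells on which the basis function lives.
open Classical in
theorem sq_inner_lam_basis_le {ρ : ℝ} (hκ : 0 < κ) (hρ : 0 < ρ) (hd : d = 2 ∨ d = 3)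
    (hΩ : IsConvexPolytopalDomain Ω) (hM : M.IsShapeRegular ρ) {lam : ℝ} (hlam : 0 < lam)
    (u : M.Vh k) (i : Fin S.N) :
    M.inner_lam lam u (S.basis i) ^ 2 / M.inner_lam lam (S.basis i) (S.basis i) ≤
      ∑ T ∈ M.cells with (S.dof i).cell ⊆ T, localEnergy lam T u u := by
  have hpos := Mesh.inner_lam_self_pos (S.basis.ne_zero i) hlam
  rw [div_le_iff₀ hpos, mul_comm]
  have hzero : ∀ w : M.Vh k, ∀ T ∈ M.cells, ¬ (S.dof i).cell ⊆ T →
      localEnergy lam T w (S.basis i) = 0 := by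
    intro w T hT hi
    have h0 := S.basis_eq_zero_of_not_subset hκ hρ hd hΩ hM hT hi
    obtain ⟨f, hf, hwf⟩ := Mesh.exists_piece w.2.1 hT
    have hz : EqOn (S.basis i : E d → ℝ) ((0 : ℝ) • f) (hull T) := fun y hy => by
      simp [h0 y hy]
    rw [localEnergy_congr (fun _ _ => rfl) hz, localEnergy_comm]
    have h1 := Mesh.localEnergy_add_smul (M := M) (k := k) (zero_mem _) (zero_mem _) w.2.1 hT lam 1
    rw [smul_zero, add_zero] at h1
    rw [zero_smul]
    linarith
  have hsum : ∀ w : M.Vh k, M.inner_lam lam w (S.basis i) =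
      ∑ T ∈ M.cells with (S.dof i).cell ⊆ T, localEnergy lam T w (S.basis i) := by
    intro w
    rw [Mesh.inner_lam_eq_sum hΩ w.2.1 (S.basis i).2.1, Finset.sum_filter]
    refine Finset.sum_congr rfl fun T hT => ?_
    split_ifs with h
    · rfl
    · exact hzero w T hT h
  refine sq_le_mul_of_forall hpos
    (Finset.sum_nonneg fun T _ => localEnergy_self_nonneg hlam.le T _) fun s hs => ?_
  rw [hsum u, hsum (S.basis i), Finset.mul_sum, Finset.mul_sum, ← Finset.sum_add_distrib]
  refine (mul_le_mul_of_nonneg_left (Finset.abs_sum_le_sum_abs _ _) zero_le_two).trans ?_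
  rw [Finset.mul_sum]
  refine Finset.sum_le_sum fun T hT => ?_
  rw [localEnergy_comm]
  exact Mesh.two_mul_abs_localEnergy_le (S.basis i).2.1 u.2.1 (Finset.mem_filter.1 hT).1 hlam.le hs

end DofSystem

/-- The smoother norm is bounded by the degrees of freedom. -/
theorem exists_normSqRbar_le {k : ℕ} (L : NodeLayout d k) {κ ρ : ℝ} (hκ : 0 < κ) (hρ : 0 < ρ)
    (hd : d = 2 ∨ d = 3) :
    ∃ C : ℝ, 0 ≤ C ∧ ∀ (Ω : Set (E d)), IsConvexPolytopalDomain Ω → ∀ M : Mesh Ω,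
      M.IsShapeRegular ρ → ∀ S : DofSystem M L κ, ∀ lam : ℝ, 0 < lam → ∀ (v : M.Vh k)
      (ε : Finset (E d) → ℝ), (∀ T ∈ M.cells, 0 ≤ ε T) → (∀ T ∈ M.cells, S.DofBound T v (ε T)) →
      S.normSqRbar lam v ≤ C * ∑ T ∈ M.cells, cellWeight lam T * ε T ^ 2 := by
  classical
  obtain ⟨C₁, hC₁, h₁⟩ := exists_sup_le_dofs L hκ hρ hd
  obtain ⟨C₂, hC₂, h₂⟩ := exists_localEnergy_le (d := d) k hρ (by omega)
  set n : ℝ := ((Module.finrank ℝ (PolyLe d k) : ℕ) : ℝ)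
  refine ⟨n * (C₂ * C₁ ^ 2), by positivity, fun Ω hΩ M hM S lam hlam v ε hε hv => ?_⟩
  have hloc : ∀ i, ∀ T ∈ M.cells, localEnergy lam T (S.tail v i) (S.tail v i) ≤
      C₂ * C₁ ^ 2 * (cellWeight lam T * ε T ^ 2) := by
    intro i T hT
    -- Taking a tail only replaces degrees of freedom by zero, so the bound for `v` is inherited
    -- whatever the ordering of the basis.
    have hb : S.DofBound T (S.tail v i) (ε T) := by
      intro b hb
      rw [S.repr_tail]
      split_ifs
      · exact hv T hT b hb
      · rw [abs_zero, mul_zero]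
        exact hε T hT
    have hsup := h₁ Ω hΩ M hM S T hT _ _ (hε T hT) hb
    obtain ⟨f, hf, huf⟩ := Mesh.exists_piece (S.tail v i).2.1 hT
    rw [localEnergy_congr huf huf]
    refine (h₂ Ω M hM T hT f hf (C₁ * ε T) (mul_nonneg hC₁ (hε T hT)) (fun y hy => ?_) lam
      hlam.le).trans_eq ?_
    · rw [← huf hy]
      exact hsup y hy
    · ring
  rw [S.normSqRbar_eq hΩ hlam]
  calc ∑ i, M.inner_lam lam (S.tail v i) (S.basis i) ^ 2 /
        M.inner_lam lam (S.basis i) (S.basis i)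
      ≤ ∑ i, ∑ T ∈ M.cells with (S.dof i).cell ⊆ T,
          C₂ * C₁ ^ 2 * (cellWeight lam T * ε T ^ 2) := by
        refine Finset.sum_le_sum fun i _ =>
          (S.sq_inner_lam_basis_le hκ hρ hd hΩ hM hlam _ i).trans ?_
        exact Finset.sum_le_sum fun T hT => hloc i T (Finset.mem_filter.1 hT).1
    -- After exchanging the sums each cell is charged once per degree of freedom attached to it, at
    -- most `n` times.
    _ = ∑ T ∈ M.cells, ∑ i ∈ S.dofsOf T, C₂ * C₁ ^ 2 * (cellWeight lam T * ε T ^ 2) := by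
        simp only [Finset.sum_filter, DofSystem.dofsOf]
        exact Finset.sum_comm
    _ ≤ ∑ T ∈ M.cells, n * (C₂ * C₁ ^ 2 * (cellWeight lam T * ε T ^ 2)) := by
        refine Finset.sum_le_sum fun T hT => ?_
        rw [Finset.sum_const, nsmul_eq_mul]
        have := cellWeight_nonneg lam T
        gcongr
        exact Nat.cast_le.2 (S.card_dofsOf_le hT)
    _ = _ := by
        rw [Finset.mul_sum]
        exact Finset.sum_congr rfl fun T _ => by ring

/-! ### Stability of the fine part -/

theorem cellWeight_pos {M : Mesh Ω} (hd : 0 < d) {T : Finset (E d)} (hT : T ∈ M.cells) (lam : ℝ) :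
    0 < cellWeight lam T := by
  have := M.hdiam_pos hd hT
  unfold cellWeight
  positivity

theorem cellWeight_le {lam C : ℝ} {T T' : Finset (E d)} (hC : 1 ≤ C) (hT : 0 < hdiam T)
    (hT' : 0 < hdiam T') (h : hdiam T ≤ C * hdiam T') (h' : hdiam T' ≤ C * hdiam T) :
    cellWeight lam T ≤ C ^ (d + 4) * cellWeight lam T' := by
  have h1 : (hdiam T ^ 4)⁻¹ ≤ C ^ 4 * (hdiam T' ^ 4)⁻¹ := by
    rw [← div_eq_mul_inv, inv_le_comm₀ (by positivity) (by positivity), inv_div,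
      div_le_iff₀ (by positivity), mul_comm, ← mul_pow]
    exact pow_le_pow_left₀ hT'.le h' 4
  have h2 : lam ^ 2 ≤ C ^ 4 * lam ^ 2 := le_mul_of_one_le_left (sq_nonneg _) (one_le_pow₀ hC)
  calc cellWeight lam T ≤ (C * hdiam T') ^ d * (C ^ 4 * (hdiam T' ^ 4)⁻¹ + C ^ 4 * lam ^ 2) := by
        unfold cellWeight
        gcongr
    _ = _ := by
        rw [cellWeight]
        ring

theorem Mesh.mem_neighbors_symm {M : Mesh Ω} {T T' : Finset (E d)} (hT : T ∈ M.cells)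
    (h : T' ∈ M.neighbors T) : T ∈ M.neighbors T' := by
  obtain ⟨-, x, hx, hx'⟩ := Mesh.mem_neighbors.1 h
  exact Mesh.mem_neighbors.2 ⟨hT, x, hx', hx⟩

/-- Being neighbors is symmetric, so after exchanging the sums each cell is counted as often as it
has neighbors. -/
theorem Mesh.sum_neighbors_le {M : Mesh Ω} {n : ℝ}
    (hn : ∀ T ∈ M.cells, ((M.neighbors T).card : ℝ) ≤ n) {g : Finset (E d) → ℝ}
    (hg : ∀ T ∈ M.cells, 0 ≤ g T) :
    ∑ T ∈ M.cells, ∑ T' ∈ M.neighbors T, g T' ≤ n * ∑ T ∈ M.cells, g T := by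
  rw [Finset.sum_comm' (t' := M.cells) (s' := fun T' => M.neighbors T') (fun T T' =>
    ⟨fun h => ⟨Mesh.mem_neighbors_symm h.1 h.2, (Mesh.mem_neighbors.1 h.2).1⟩,
      fun h => ⟨(Mesh.mem_neighbors.1 h.1).1, Mesh.mem_neighbors_symm h.2 h.1⟩⟩), Finset.mul_sum]
  refine Finset.sum_le_sum fun T hT => ?_
  rw [Finset.sum_const, nsmul_eq_mul]
  exact mul_le_mul_of_nonneg_right (hn T hT) (hg T hT)

/-- The fine part of the decomposition has degrees of freedom bounded by the interpolation error on
the neighboring cells. -/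
theorem exists_dofBound_transfer {k : ℕ} (L : NodeLayout d k) {κ ρ : ℝ} (hκ : 0 < κ) (hρ : 0 < ρ)
    (hd : d = 2 ∨ d = 3) (hk : 1 ≤ k) :
    ∃ C : ℝ, 0 ≤ C ∧ ∀ (Ω : Set (E d)), IsConvexPolytopalDomain Ω → ∀ M : Mesh Ω,
      M.IsShapeRegular ρ → ∀ S : DofSystem M L κ, ∀ (v : M.Vh k) (p : M.V0)
      (e : Finset (E d) → ℝ), (∀ T ∈ M.cells, 0 ≤ e T) →
      (∀ T ∈ M.cells, ∀ y ∈ hull T, |(v : E d → ℝ) y - (p : E d → ℝ) y| ≤ e T) →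
      ∀ T ∈ M.cells, S.DofBound T (v - S.transfer p) (C * ∑ T' ∈ M.neighbors T, e T') := by
  obtain ⟨C₁, hC₁, h₁⟩ := exists_transfer_local_le L κ hρ hd hk
  obtain ⟨C₂, hC₂, h₂⟩ := Mesh.exists_hdiam_comparable hρ (show 2 ≤ d by omega)
  refine ⟨C₂ ^ 2 * C₁, by positivity, fun Ω hΩ M hM S v p e he hvp T hT a ha => ?_⟩
  have hsub : ∀ T' ∈ S.omega a, (S.dof a).cell ⊆ T' := fun T' hT' =>
    S.cell_subset_of_mem_omega hκ hρ hd hΩ hM hT'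
  set X := C₂ ^ 2 * C₁ * ∑ T' ∈ M.neighbors T, e T' with hX
  have key : ∀ T' ∈ S.omega a, hdiam T ^ (S.dof a).order *
      |(S.dof a).evalOn T' v - S.localValue p a T'| ≤ X := by
    intro T' hT'
    have hT'c := (S.mem_omega.1 hT').1
    have hx : (S.dof a).vtx 0 ∈ (S.dof a).cell := by
      rw [← Finset.mem_coe, Dof.coe_cell]
      exact mem_range_self 0
    have h3 := h₂ Ω hΩ M hM _ T (Mesh.mem_cellsAt.2 ⟨hT, ha hx⟩) T'
      (Mesh.mem_cellsAt.2 ⟨hT'c, hsub T' hT' hx⟩)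
    have h4 := h₁ Ω hΩ M hM S v p a T' hT'c (hsub T' hT') (e T') (he T' hT'c) (hvp T' hT'c)
    have hh : 0 ≤ hdiam T := Metric.diam_nonneg
    have hh' : 0 ≤ hdiam T' := Metric.diam_nonneg
    have h5 : hdiam T ^ (S.dof a).order ≤ C₂ ^ 2 * hdiam T' ^ (S.dof a).order := by
      refine (pow_le_pow_left₀ hh h3 _).trans ?_
      rw [mul_pow]
      exact mul_le_mul_of_nonneg_right (pow_le_pow_right₀ hC₂ (S.order_le (by omega) a))
        (by positivity)
    have h6 : e T' ≤ ∑ T' ∈ M.neighbors T, e T' :=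
      Finset.single_le_sum (f := e) (fun T'' h => he T'' (Mesh.mem_neighbors.1 h).1)
        (Mesh.mem_neighbors.2 ⟨hT'c, _, ha hx, hsub T' hT' hx⟩)
    calc hdiam T ^ (S.dof a).order * |(S.dof a).evalOn T' v - S.localValue p a T'|
        ≤ C₂ ^ 2 * hdiam T' ^ (S.dof a).order *
          |(S.dof a).evalOn T' v - S.localValue p a T'| := by gcongr
      _ = C₂ ^ 2 * (hdiam T' ^ (S.dof a).order *
          |(S.dof a).evalOn T' v - S.localValue p a T'|) := by ring
      _ ≤ C₂ ^ 2 * (C₁ * ∑ T' ∈ M.neighbors T, e T') := by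
        exact mul_le_mul_of_nonneg_left (h4.trans (mul_le_mul_of_nonneg_left h6 hC₁))
          (by positivity)
      _ = X := by rw [hX, mul_assoc]
  have hcard : (0 : ℝ) < (S.omega a).card :=
    Nat.cast_pos.2 (Finset.card_pos.2 (S.omega_nonempty a))
  have hh : 0 ≤ hdiam T ^ (S.dof a).order := pow_nonneg Metric.diam_nonneg _
  rw [S.repr_sub_transfer v p a hsub, abs_mul, abs_of_nonneg (by positivity), mul_left_comm,
    inv_mul_le_iff₀ hcard]
  refine (mul_le_mul_of_nonneg_left (Finset.abs_sum_le_sum_abs _ _) hh).trans ?_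
  rw [Finset.mul_sum]
  refine (Finset.sum_le_sum key).trans_eq ?_
  rw [Finset.sum_const, nsmul_eq_mul]

/-- `e T` is defined so that its weighted square equals a multiple of the local energy. In both
halves of the estimate the weighted sum over the cells then becomes the full energy. -/
theorem exists_cell_error (k : ℕ) {ρ : ℝ} (hρ : 0 < ρ) (hd : 0 < d) :
    ∃ C : ℝ, 0 ≤ C ∧ ∀ (Ω : Set (E d)) (M : Mesh Ω), M.IsShapeRegular ρ → ∀ (v : M.Vh k)
      (p : M.V0), M.IsNodalInterpolant v p → ∀ lam : ℝ, 0 < lam →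
      ∃ e : Finset (E d) → ℝ, (∀ T, 0 ≤ e T) ∧ (∀ T ∈ M.cells, ∀ y ∈ hull T,
        |(v : E d → ℝ) y - (p : E d → ℝ) y| ≤ e T) ∧
        ∀ T ∈ M.cells, cellWeight lam T * e T ^ 2 = C * localEnergy lam T v v ∧
          ∀ y ∈ hull T, lam ^ 2 * (hdiam T ^ d * (p : E d → ℝ) y ^ 2) ≤
            C * localEnergy lam T v v := by
  obtain ⟨C, hC, h⟩ := exists_interpolation_le (d := d) k hρ hd
  refine ⟨C, hC, fun Ω M hM v p hvp lam hlam =>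
    ⟨fun T => Real.sqrt (C * localEnergy lam T v v / cellWeight lam T), fun T => Real.sqrt_nonneg _,
      fun T hT y hy => ?_, fun T hT => ⟨?_, fun y hy => ?_⟩⟩⟩
  · obtain ⟨f, hf, hvf⟩ := Mesh.exists_piece v.2.1 hT
    obtain ⟨q, hq, hpq⟩ := Mesh.exists_piece p.2 hT
    change |(v : E d → ℝ) y - (p : E d → ℝ) y| ≤
      Real.sqrt (C * localEnergy lam T (v : E d → ℝ) v / cellWeight lam T)
    rw [hvf hy, hpq hy, localEnergy_congr hvf hvf]
    refine Real.abs_le_sqrt ?_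
    rw [le_div_iff₀ (cellWeight_pos hd hT lam), mul_comm]
    refine (h Ω M hM T hT f hf q hq (fun x hx => ?_) lam hlam.le y hy).1
    rw [← hvf (subset_hull T hx), ← hpq (subset_hull T hx)]
    exact hvp x (M.mem_nodes_of_mem_cell hT hx)
  · have h1 := cellWeight_pos hd hT lam
    have h2 := localEnergy_self_nonneg hlam.le T (v : E d → ℝ)
    rw [Real.sq_sqrt (by positivity), mul_div_cancel₀ _ h1.ne']
  · obtain ⟨f, hf, hvf⟩ := Mesh.exists_piece v.2.1 hT
    obtain ⟨q, hq, hpq⟩ := Mesh.exists_piece p.2 hT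
    rw [hpq hy, localEnergy_congr hvf hvf]
    refine (h Ω M hM T hT f hf q hq (fun x hx => ?_) lam hlam.le y hy).2
    rw [← hvf (subset_hull T hx), ← hpq (subset_hull T hx)]
    exact hvp x (M.mem_nodes_of_mem_cell hT hx)

/-- The smoother norm is bounded by degrees of freedom, these by errors on neighboring cells, and
those by the energy. Comparable diameters carry the weights from a cell to its neighbors, and the
bounded number of neighbors controls the overlap. -/
theorem exists_normSqRbar_transfer_le {k : ℕ} (L : NodeLayout d k) {κ ρ : ℝ} (hκ : 0 < κ)
    (hρ : 0 < ρ) (hd : d = 2 ∨ d = 3) (hk : 1 ≤ k) :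
    ∃ C : ℝ, 0 ≤ C ∧ ∀ (Ω : Set (E d)), IsConvexPolytopalDomain Ω → ∀ M : Mesh Ω,
      M.IsShapeRegular ρ → ∀ S : DofSystem M L κ, ∀ (v : M.Vh k) (p : M.V0),
      M.IsNodalInterpolant v p → ∀ lam : ℝ, 0 < lam →
      S.normSqRbar lam (v - S.transfer p) ≤ C * M.inner_lam lam v v := by
  have hd0 : 0 < d := by omega
  obtain ⟨C₁, hC₁, h₁⟩ := exists_normSqRbar_le L hκ hρ hd
  obtain ⟨C₂, hC₂, h₂⟩ := exists_dofBound_transfer L hκ hρ hd hk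
  obtain ⟨C₃, hC₃, h₃⟩ := exists_cell_error (d := d) k hρ hd0
  obtain ⟨C₄, hC₄, h₄⟩ := Mesh.exists_hdiam_comparable hρ (show 2 ≤ d by omega)
  set n : ℝ := (d + 1) * (ρ + 1) ^ d with hn
  refine ⟨C₁ * (C₂ ^ 2 * n * C₄ ^ (d + 4) * n * C₃), by positivity,
    fun Ω hΩ M hM S v p hvp lam hlam => ?_⟩
  obtain ⟨e, he, hve, hwe⟩ := h₃ Ω M hM v p hvp lam hlam
  have hcard : ∀ T ∈ M.cells, ((M.neighbors T).card : ℝ) ≤ n := fun T hT =>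
    hM.card_neighbors_le hρ hd0 hT
  have hb := h₂ Ω hΩ M hM S v p e (fun T _ => he T) hve
  refine (h₁ Ω hΩ M hM S lam hlam _ _ (fun T _ =>
    mul_nonneg hC₂ (Finset.sum_nonneg fun T' _ => he T')) hb).trans ?_
  rw [mul_assoc C₁]
  refine mul_le_mul_of_nonneg_left ?_ hC₁
  have hloc : ∀ T ∈ M.cells, cellWeight lam T * (C₂ * ∑ T' ∈ M.neighbors T, e T') ^ 2 ≤
      C₂ ^ 2 * n * C₄ ^ (d + 4) * ∑ T' ∈ M.neighbors T, cellWeight lam T' * e T' ^ 2 := by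
    intro T hT
    have hw := cellWeight_nonneg lam T
    have h5 : (∑ T' ∈ M.neighbors T, e T') ^ 2 ≤ n * ∑ T' ∈ M.neighbors T, e T' ^ 2 :=
      sq_sum_le_card_mul_sum_sq.trans (mul_le_mul_of_nonneg_right (hcard T hT)
        (Finset.sum_nonneg fun T' _ => sq_nonneg _))
    calc cellWeight lam T * (C₂ * ∑ T' ∈ M.neighbors T, e T') ^ 2
        = C₂ ^ 2 * (cellWeight lam T * (∑ T' ∈ M.neighbors T, e T') ^ 2) := by ring
      _ ≤ C₂ ^ 2 * (cellWeight lam T * (n * ∑ T' ∈ M.neighbors T, e T' ^ 2)) := by gcongr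
      _ = C₂ ^ 2 * n * ∑ T' ∈ M.neighbors T, cellWeight lam T * e T' ^ 2 := by
        rw [← Finset.mul_sum]
        ring
      _ ≤ C₂ ^ 2 * n * ∑ T' ∈ M.neighbors T, C₄ ^ (d + 4) * (cellWeight lam T' * e T' ^ 2) := by
        refine mul_le_mul_of_nonneg_left (Finset.sum_le_sum fun T' hT' => ?_) (by positivity)
        obtain ⟨hT'c, x, hx, hx'⟩ := Mesh.mem_neighbors.1 hT'
        have hm := Mesh.mem_cellsAt.2 ⟨hT, hx⟩
        have hm' := Mesh.mem_cellsAt.2 ⟨hT'c, hx'⟩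
        rw [← mul_assoc]
        refine mul_le_mul_of_nonneg_right ?_ (sq_nonneg _)
        exact cellWeight_le hC₄ (M.hdiam_pos hd0 hT) (M.hdiam_pos hd0 hT'c)
          (h₄ Ω hΩ M hM x T hm T' hm') (h₄ Ω hΩ M hM x T' hm' T hm)
      _ = _ := by
        rw [← Finset.mul_sum]
        ring
  refine (Finset.sum_le_sum hloc).trans ?_
  rw [← Finset.mul_sum]
  have h6 := Mesh.sum_neighbors_le hcard (g := fun T => cellWeight lam T * e T ^ 2)
    fun T _ => mul_nonneg (cellWeight_nonneg lam T) (sq_nonneg _)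
  have h7 : ∑ T ∈ M.cells, cellWeight lam T * e T ^ 2 = C₃ * M.inner_lam lam v v := by
    rw [Mesh.inner_lam_eq_sum hΩ v.2.1 v.2.1, Finset.mul_sum]
    exact Finset.sum_congr rfl fun T hT => (hwe T hT).1
  calc C₂ ^ 2 * n * C₄ ^ (d + 4) *
        ∑ T ∈ M.cells, ∑ T' ∈ M.neighbors T, cellWeight lam T' * e T' ^ 2
      ≤ C₂ ^ 2 * n * C₄ ^ (d + 4) * (n * ∑ T ∈ M.cells, cellWeight lam T * e T ^ 2) := by
        gcongr
    _ = _ := by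
        rw [h7]
        ring

/-! ### Stability of the coarse part -/

theorem inner_gradient_left (f : E d → ℝ) (x t : E d) :
    inner ℝ (gradient f x) t = fderiv ℝ f x t :=
  InnerProductSpace.toDual_symm_apply

theorem gradient_eq_sum (f : E d → ℝ) (x : E d) :
    gradient f x = ∑ i, fderiv ℝ f x (EuclideanSpace.single i 1) • EuclideanSpace.single i (1 : ℝ) := by
  have hexp : ∀ s : E d, s = ∑ i, s i • EuclideanSpace.single i (1 : ℝ) := by
    intro s
    ext j
    simp [Finset.sum_apply, Pi.single_apply]
  conv_lhs => rw [hexp (gradient f x)]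
  refine Finset.sum_congr rfl fun i _ => ?_
  have h : ∀ u : E d, inner ℝ u (EuclideanSpace.single i (1 : ℝ)) = u i := fun u => by
    simp [EuclideanSpace.inner_single_right]
  rw [← inner_gradient_left, h]

/-- Subtracting the barycentric identities at the origin shows that the linear parts reproduce
vectors and sum to zero, so the constant part of `q` drops out. -/
theorem IsBary.fderiv_affine {T : Finset (E d)} {α : E d → E d →L[ℝ] ℝ} {b : E d → ℝ}
    (hα : IsBary T α b) {q : E d → ℝ} (hq : IsPoly 1 q) (y t : E d) :
    fderiv ℝ q y t = ∑ x ∈ T, q x * α x t := by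
  obtain ⟨A, c, hA⟩ := hq.exists_affine
  have h1 : fderiv ℝ q y = A := by
    rw [show q = fun x => A x + c from funext hA]
    exact (A.hasFDerivAt.add_const c).fderiv
  have h2 : t = ∑ x ∈ T, α x t • x := by
    have e1 := hα.sum_smul t
    have e2 := hα.sum_smul 0
    simp only [map_zero, zero_add] at e2
    simp only [add_smul, Finset.sum_add_distrib, e2, add_zero] at e1
    exact e1.symm
  have h3 : ∑ x ∈ T, α x t = 0 := by
    have e1 := hα.sum_one t
    have e2 := hα.sum_one 0
    simp only [map_zero, zero_add] at e2
    simp only [Finset.sum_add_distrib, e2] at e1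
    linarith
  rw [h1]
  conv_lhs => rw [h2, map_sum]
  simp only [hA, add_mul, Finset.sum_add_distrib, ← Finset.mul_sum, h3, mul_zero, add_zero,
    map_smul, smul_eq_mul]
  exact Finset.sum_congr rfl fun x _ => mul_comm _ _

namespace Mesh

variable {M : Mesh Ω}

/-- Continuity of the first derivatives at the vertices makes the nodal gradient independent of the
cell; it is needed to interpolate `w ∇v`. -/
theorem exists_nodal_fderiv {k : ℕ} (hd : d = 2 ∨ d = 3) (v : M.Vh k) :
    ∃ G : E d → E d →L[ℝ] ℝ, ∀ x ∈ M.nodes, ∀ T ∈ M.cells, x ∈ T → ∀ f, IsPoly k f →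
      EqOn (v : E d → ℝ) f (hull T) → fderiv ℝ f x = G x := by
  have h : ∀ x ∈ M.nodes, ∃ g : E d →L[ℝ] ℝ, ∀ T ∈ M.cells, x ∈ T → ∀ f, IsPoly k f →
      EqOn (v : E d → ℝ) f (hull T) → fderiv ℝ f x = g := by
    intro x hx
    obtain ⟨T, hT, hxT⟩ := M.exists_cell_of_mem_nodes hx
    obtain ⟨f, hf, hvf⟩ := exists_piece v.2.1 hT
    have hC : M.IsCmAt 1 v x := isCmAt_of_mem hd le_rfl (j := 0) (by omega) v (σ := {x}) hx (by simp)
      (by simp [hull])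
    exact ⟨fderiv ℝ f x, fun T' hT' hxT' f' hf' hvf' =>
      fderiv_eq_of_isCmAt hC hT' hT hf' hf hvf' hvf (subset_hull _ hxT') (subset_hull _ hxT)⟩
  choose! G hG using h
  exact ⟨G, hG⟩

theorem integrable_fderiv_apply {k : ℕ} {u : E d → ℝ} (hu : u ∈ M.piecewisePoly k) (t : E d) :
    IntegrableOn (fun x => fderiv ℝ u x t) Ω := by
  have : IsFiniteMeasure (volume.restrict Ω) := ⟨by simpa using M.measure_domain_lt_top⟩
  obtain ⟨C, hC⟩ := exists_bound hu
  refine Integrable.of_bound (C := C * ‖t‖) (measurable_fderiv_apply_const ℝ u t).aestronglyMeasurable ?_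
  filter_upwards [hC] with x hx
  rw [← inner_gradient_left]
  exact (norm_inner_le_norm _ _).trans (mul_le_mul_of_nonneg_right hx.2 (norm_nonneg _))

/-- Up to a divergence, `∇p · ∇w` is controlled by the interpolation error of `p`. -/
theorem exists_flux {k : ℕ} (hd : d = 2 ∨ d = 3) (hΩ : IsConvexPolytopalDomain Ω) (v : M.Vh k)
    (p w : M.V0) : ∃ g : E d → ℝ, IntegrableOn g Ω ∧ gradInner Ω p w = ∫ x in Ω, g x ∧
      ∀ T ∈ M.cells, ∀ f q r, IsPoly k f → IsPoly 1 q → IsPoly 1 r →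
        EqOn (v : E d → ℝ) f (hull T) → EqOn (p : E d → ℝ) q (hull T) →
        EqOn (w : E d → ℝ) r (hull T) → ∀ α b, IsBary T α b → ∀ y ∈ interior (hull T),
        g y = ∑ x ∈ T, r x * α x (gradient q x - gradient f x) := by
  obtain ⟨G, hG⟩ := exists_nodal_fderiv hd v
  -- `U i` interpolates `w ∂_i v`. It lies in `V0` because `w` vanishes off `Ω`, so each `∂_i U_i`
  -- integrates to zero and may be subtracted from `∇p · ∇w`.
  have hU := fun i : Fin d => M.exists_interpolant hΩ
    (fun x => (w : E d → ℝ) x * G x (EuclideanSpace.single i 1)) fun x hx => by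
      rw [w.2.2 x hx, zero_mul]
  choose U hU using hU
  have hint := fun i : Fin d => integrable_fderiv_apply (U i).2 (EuclideanSpace.single i 1)
  have hsum := integrable_finsetSum Finset.univ fun i _ => hint i
  refine ⟨fun x => inner ℝ (gradient (p : E d → ℝ) x) (gradient (w : E d → ℝ) x) -
    ∑ i, fderiv ℝ (U i : E d → ℝ) x (EuclideanSpace.single i 1),
    (integrable_gradInner w.2 p.2).sub hsum, ?_, ?_⟩
  · rw [integral_sub (integrable_gradInner w.2 p.2) hsum, integral_finsetSum _ fun i _ => hint i,
      Finset.sum_eq_zero fun i _ => M.integral_fderiv_eq_zero hΩ (U i).2 _, sub_zero]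
    rfl
  · intro T hT f q r hf hq hr hvf hpq hwr α b hα y hy
    have hUq := fun i : Fin d => exists_piece (U i).2 hT
    choose V hV hUV using hUq
    have e1 : inner ℝ (gradient (p : E d → ℝ) y) (gradient (w : E d → ℝ) y) =
        ∑ x ∈ T, r x * α x (gradient q x) := by
      rw [real_inner_comm, inner_gradient_left, (eventuallyEq_of_mem_interior hwr hy).fderiv_eq,
        hα.fderiv_affine hr]
      refine Finset.sum_congr rfl fun x _ => ?_
      congr 2
      simp only [gradient, (eventuallyEq_of_mem_interior hpq hy).fderiv_eq]
      congr 1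
      ext t
      rw [hα.fderiv_affine hq, hα.fderiv_affine hq]
    have e2 : ∀ i, fderiv ℝ (U i : E d → ℝ) y (EuclideanSpace.single i 1) = ∑ x ∈ T, r x *
        (fderiv ℝ f x (EuclideanSpace.single i 1) * α x (EuclideanSpace.single i 1)) := by
      intro i
      rw [(eventuallyEq_of_mem_interior (hUV i) hy).fderiv_eq, hα.fderiv_affine (hV i)]
      refine Finset.sum_congr rfl fun x hx => ?_
      have hxn := M.mem_nodes_of_mem_cell hT hx
      rw [← hUV i (subset_hull T hx), hU i x hxn, hG x hxn T hT hx f hf hvf,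
        hwr (subset_hull T hx), mul_assoc]
    simp only [e1, e2]
    rw [Finset.sum_comm, ← Finset.sum_sub_distrib]
    refine Finset.sum_congr rfl fun x _ => ?_
    rw [← Finset.mul_sum, ← mul_sub, map_sub]
    congr 2
    conv_rhs => rw [gradient_eq_sum f x, map_sum]
    simp only [map_smul, smul_eq_mul]

end Mesh

/-- On a cell the flux integrand is at most `d + 1` times the product of max |w| over the vertices,
the slope `ρ / h` of the barycentric coordinates and the inverse estimate `C₁ * e T / h`. Bounding
max |w| by the L² norm of `w` on the cell leaves a product to be split by Young's inequality. -/
theorem exists_gradInner_le (k : ℕ) {ρ : ℝ} (hρ : 0 < ρ) (hd : d = 2 ∨ d = 3) (hk : 1 ≤ k) :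
    ∃ C : ℝ, 0 ≤ C ∧ ∀ (Ω : Set (E d)), IsConvexPolytopalDomain Ω → ∀ M : Mesh Ω,
      M.IsShapeRegular ρ → ∀ (v : M.Vh k) (p w : M.V0) (e : Finset (E d) → ℝ), (∀ T, 0 ≤ e T) →
      (∀ T ∈ M.cells, ∀ y ∈ hull T, |(v : E d → ℝ) y - (p : E d → ℝ) y| ≤ e T) →
      ∀ lam : ℝ, 2 * |Mesh.gradInner Ω (p : E d → ℝ) w| ≤
        C * (∑ T ∈ M.cells, cellWeight lam T * e T ^ 2) + Mesh.l2 Ω (w : E d → ℝ) w := by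
  have hd0 : 0 < d := by omega
  obtain ⟨C₁, hC₁, h₁⟩ := exists_inverse_estimate d k 1 hρ
  obtain ⟨C₂, hC₂, h₂⟩ := exists_sq_le_integral d 1 hρ
  set W := volume.real (Metric.ball (0 : E d) 1)
  have hW : 0 ≤ W := measureReal_nonneg
  set K := ((d : ℝ) + 1) * ρ * C₁ * W with hK
  have hK0 : 0 ≤ K := by positivity
  refine ⟨K ^ 2 * C₂, by positivity, fun Ω hΩ M hM v p w e he hvp lam => ?_⟩
  obtain ⟨g, hg, hpw, hgT⟩ := Mesh.exists_flux hd hΩ v p w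
  have hloc : ∀ T ∈ M.cells, 2 * |∫ x in hull T, g x| ≤
      K ^ 2 * C₂ * (cellWeight lam T * e T ^ 2) +
        ∫ x in hull T, (w : E d → ℝ) x * (w : E d → ℝ) x := by
    intro T hT
    have hh := M.hdiam_pos hd0 hT
    obtain ⟨x₀, -, hb, hb'⟩ := hM.exists_ball hρ hT
    obtain ⟨f, hf, hvf⟩ := Mesh.exists_piece v.2.1 hT
    obtain ⟨q, hq, hpq⟩ := Mesh.exists_piece p.2 hT
    obtain ⟨r, hr, hwr⟩ := Mesh.exists_piece w.2 hT
    obtain ⟨α, b, hα⟩ := M.exists_bary hT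
    have hT0 : T.Nonempty := Finset.card_pos.1 (by rw [(M.mem_cells.1 hT).2]; omega)
    have hqk := hq.mono hk
    set h := hdiam T with hhdef
    have hI : ∫ x in hull T, (w : E d → ℝ) x * (w : E d → ℝ) x = ∫ x in hull T, r x ^ 2 :=
      setIntegral_congr_fun (Mesh.isCompact_hull T).measurableSet fun x hx => by
        simp only [hwr hx, sq]
    rw [hI]
    set I := ∫ x in hull T, r x ^ 2 with hIdef
    have hI0 : 0 ≤ I := integral_nonneg fun x => sq_nonneg _
    set B := Real.sqrt (C₂ * I / h ^ d) with hB
    have hB0 : 0 ≤ B := Real.sqrt_nonneg _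
    have hB2 : B ^ 2 = C₂ * I / h ^ d := Real.sq_sqrt (by positivity)
    have hrB : ∀ x ∈ T, |r x| ≤ B := by
      intro x hx
      refine Real.abs_le_sqrt ?_
      rw [le_div_iff₀ (by positivity), mul_comm]
      exact h₂ _ x₀ h (Mesh.isCompact_hull T) hh hb hb' r hr x (subset_hull T hx)
    have hgrad : ∀ x ∈ T, ‖gradient q x - gradient f x‖ ≤ C₁ * e T / h := by
      intro x hx
      have hcq : ContDiff ℝ (⊤ : ℕ∞) q := hq.contDiff
      have h3 : gradient q x - gradient f x = gradient (q + (-1 : ℝ) • f) x := by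
        simp only [gradient]
        rw [fderiv_add (hcq.differentiable (by simp) x)
          ((hf.smul (-1)).contDiff.differentiable (by simp) x),
          fderiv_const_smul (hf.contDiff.differentiable (by simp) x), neg_one_smul, ← sub_eq_add_neg,
          map_sub]
      rw [h3]
      have hTe := he T
      refine norm_gradient_le (by positivity) fun t => ?_
      have h4 := h₁ _ x₀ h hh hb hb' _ (hqk.add (hf.smul (-1))) (e T) (he T) (fun y hy => by
        have h5 := hvp T hT y hy
        rw [hvf hy, hpq hy, abs_sub_comm] at h5
        simpa [sub_eq_add_neg] using h5) x (subset_hull T hx) [t] rfl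
      simp only [normProd_cons, normProd_nil, mul_one, pow_one] at h4
      rw [div_mul_eq_mul_div, le_div_iff₀ hh, mul_comm]
      exact h4
    have hgB : ∀ y ∈ interior (hull T), ‖g y‖ ≤ (d + 1) * (B * (ρ / h * (C₁ * e T / h))) := by
      intro y hy
      rw [hgT T hT f q r hf hq hr hvf hpq hwr α b hα y hy, Real.norm_eq_abs]
      refine (Finset.abs_sum_le_sum_abs _ _).trans ((Finset.sum_le_sum
        (g := fun _ => B * (ρ / h * (C₁ * e T / h))) fun x hx => ?_).trans_eq ?_)
      · rw [abs_mul]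
        refine mul_le_mul (hrB x hx) ((hM.norm_bary_le hρ hd0 hT hα hx _).trans ?_)
          (abs_nonneg _) hB0
        exact mul_le_mul_of_nonneg_left (hgrad x hx) (by positivity)
      · rw [Finset.sum_const, (M.mem_cells.1 hT).2, nsmul_eq_mul]
        push_cast
        ring
    have hTe := he T
    have hint : |∫ x in hull T, g x| ≤ (d + 1) * (B * (ρ / h * (C₁ * e T / h))) * (h ^ d * W) := by
      rw [← setIntegral_congr_set (Mesh.interior_hull_ae_eq T)]
      have hfin : volume (interior (hull T)) < ⊤ :=
        (measure_mono interior_subset).trans_lt (Mesh.isCompact_hull T).measure_lt_top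
      refine (norm_setIntegral_le_of_norm_le_const hfin hgB).trans ?_
      refine mul_le_mul_of_nonneg_left ?_ (by positivity)
      exact (measureReal_mono interior_subset
        (Mesh.isCompact_hull T).measure_lt_top.ne).trans (volume_hull_le hT0)
    have hy2 : |∫ x in hull T, g x| ≤ K * (e T / h ^ 2) * (h ^ d * B) := by
      refine hint.trans_eq ?_
      rw [hK]
      field_simp
    have hB3 : (h ^ d * B) ^ 2 = C₂ * I * h ^ d := by
      rw [mul_pow, hB2]
      field_simp
    have hw : h ^ d * (e T / h ^ 2) ^ 2 ≤ cellWeight lam T * e T ^ 2 := by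
      have h6 : h ^ d * (e T / h ^ 2) ^ 2 = h ^ d * (h ^ 4)⁻¹ * e T ^ 2 := by
        field_simp
      rw [h6, cellWeight]
      gcongr
      exact le_add_of_nonneg_right (sq_nonneg _)
    rcases eq_or_lt_of_le hC₂ with hC | hC
    · have hBz : B = 0 := by rw [hB, ← hC]; simp
      rw [hBz, mul_zero, mul_zero] at hy2
      have h7 := cellWeight_nonneg lam T
      have h8 : 0 ≤ K ^ 2 * C₂ * (cellWeight lam T * e T ^ 2) := by positivity
      linarith
    · have h7 : |∫ x in hull T, g x| ^ 2 ≤ K ^ 2 * C₂ * (cellWeight lam T * e T ^ 2) * I := by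
        calc |∫ x in hull T, g x| ^ 2 ≤ (K * (e T / h ^ 2) * (h ^ d * B)) ^ 2 :=
              pow_le_pow_left₀ (abs_nonneg _) hy2 2
          _ = K ^ 2 * C₂ * (h ^ d * (e T / h ^ 2) ^ 2) * I := by
              rw [mul_pow (K * _), hB3]
              ring
          _ ≤ _ := by gcongr
      have h8 := cellWeight_nonneg lam T
      set X := K ^ 2 * C₂ * (cellWeight lam T * e T ^ 2) with hX
      have hX0 : 0 ≤ X := by positivity
      -- The square of the integral is at most `X * I`, so twice its absolute value is at most `X +
      -- I`.
      refine abs_le_of_sq_le_sq' ?_ (by positivity) |>.2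
      nlinarith [sq_nonneg (X - I)]
  rw [hpw, M.setIntegral_domain hΩ hg, Mesh.l2,
    M.setIntegral_domain hΩ (Mesh.integrable_l2 w.2 w.2), Finset.mul_sum, ← Finset.sum_add_distrib]
  refine (mul_le_mul_of_nonneg_left (Finset.abs_sum_le_sum_abs _ _) zero_le_two).trans ?_
  rw [Finset.mul_sum]
  exact Finset.sum_le_sum hloc

/-- Testing the definition of `z = Δ_h p` with `z` itself gives ‖z‖² = -(∇p, ∇z). The factor 2 in
`exists_gradInner_le` lets ‖z‖² on its right side be absorbed. -/
theorem exists_normSqR0_le (k : ℕ) {ρ : ℝ} (hρ : 0 < ρ) (hd : d = 2 ∨ d = 3) (hk : 1 ≤ k) :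
    ∃ C : ℝ, 0 ≤ C ∧ ∀ (Ω : Set (E d)), IsConvexPolytopalDomain Ω → ∀ M : Mesh Ω,
      M.IsShapeRegular ρ → ∀ (v : M.Vh k) (p : M.V0), M.IsNodalInterpolant v p →
      ∀ lam : ℝ, 0 < lam → M.normSqR0 lam p ≤ C * M.inner_lam lam v v := by
  have hd0 : 0 < d := by omega
  obtain ⟨C₁, hC₁, h₁⟩ := exists_gradInner_le k hρ hd hk
  obtain ⟨C₂, hC₂, h₂⟩ := exists_cell_error (d := d) k hρ hd0
  set W := volume.real (Metric.ball (0 : E d) 1)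
  have hW : 0 ≤ W := measureReal_nonneg
  refine ⟨2 * (C₂ * W) + 2 * (C₁ * C₂), by positivity, fun Ω hΩ M hM v p hvp lam hlam => ?_⟩
  obtain ⟨e, he, hve, hwe⟩ := h₂ Ω M hM v p hvp lam hlam
  have hA := Mesh.inner_lam_eq_sum hΩ v.2.1 v.2.1 lam
  have hsum : ∑ T ∈ M.cells, cellWeight lam T * e T ^ 2 = C₂ * M.inner_lam lam v v := by
    rw [hA, Finset.mul_sum]
    exact Finset.sum_congr rfl fun T hT => (hwe T hT).1
  have hp : lam ^ 2 * Mesh.l2 Ω (p : E d → ℝ) p ≤ C₂ * W * M.inner_lam lam v v := by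
    rw [Mesh.l2, M.setIntegral_domain hΩ (Mesh.integrable_l2 p.2 p.2), hA, Finset.mul_sum,
      Finset.mul_sum]
    refine Finset.sum_le_sum fun T hT => ?_
    have hh := M.hdiam_pos hd0 hT
    have hE := localEnergy_self_nonneg hlam.le T (v : E d → ℝ)
    have hT0 : T.Nonempty := Finset.card_pos.1 (by rw [(M.mem_cells.1 hT).2]; omega)
    have hb : ∀ y ∈ hull T, ‖lam ^ 2 * ((p : E d → ℝ) y * (p : E d → ℝ) y)‖ ≤
        C₂ * localEnergy lam T v v / hdiam T ^ d := by
      intro y hy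
      rw [Real.norm_eq_abs, abs_of_nonneg (mul_nonneg (sq_nonneg _) (mul_self_nonneg _)),
        le_div_iff₀ (by positivity)]
      refine le_trans (le_of_eq ?_) ((hwe T hT).2 y hy)
      ring
    rw [← integral_const_mul]
    refine (le_abs_self _).trans ((norm_setIntegral_le_of_norm_le_const
      (Mesh.isCompact_hull T).measure_lt_top hb).trans ?_)
    calc C₂ * localEnergy lam T v v / hdiam T ^ d * volume.real (hull T)
        ≤ C₂ * localEnergy lam T v v / hdiam T ^ d * (hdiam T ^ d * W) := by
          gcongr
          exact volume_hull_le hT0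
      _ = _ := by
          field_simp
  set z := M.laplacian p with hz
  have hzz : Mesh.l2 Ω (z : E d → ℝ) z ≤ C₁ * C₂ * M.inner_lam lam v v := by
    have h3 := h₁ Ω hΩ M hM v p z e he hve lam
    rw [hsum] at h3
    have h4 := M.laplacian_spec p z
    have h5 : Mesh.l2 Ω ((-z : M.V0) : E d → ℝ) z = -Mesh.l2 Ω (z : E d → ℝ) z := by
      simp only [Mesh.l2, Submodule.coe_neg, Pi.neg_apply, neg_mul, integral_neg]
    rw [← hz, h5] at h4
    have h6 := neg_abs_le (Mesh.gradInner Ω (p : E d → ℝ) z)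
    rw [← h4] at h6 h3
    linarith
  have hsplit : M.normSqR0 lam p ≤
      2 * (lam ^ 2 * Mesh.l2 Ω (p : E d → ℝ) p) + 2 * Mesh.l2 Ω (z : E d → ℝ) z := by
    have i1 := Mesh.integrable_l2 (lam • p - z : M.V0).2 (lam • p - z : M.V0).2
    have i2 := Mesh.integrable_l2 p.2 p.2
    have i3 := Mesh.integrable_l2 z.2 z.2
    rw [Mesh.normSqR0, Mesh.l2, Mesh.l2, Mesh.l2, ← integral_const_mul, ← integral_const_mul,
      ← integral_const_mul, ← integral_add ((i2.const_mul _).const_mul _) (i3.const_mul _)]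
    refine integral_mono i1 (((i2.const_mul _).const_mul _).add (i3.const_mul _)) fun x => ?_
    simp only [Submodule.coe_sub, Submodule.coe_smul, Pi.sub_apply, Pi.smul_apply, smul_eq_mul]
    nlinarith [sq_nonneg (lam * (p : E d → ℝ) x + (z : E d → ℝ) x)]
  linarith

/-- Stability of the decomposition `v = (v - Π_0 I_h v) + Π_0 I_h v`. -/
theorem exists_stable_decomposition {k : ℕ} (L : NodeLayout d k) {κ ρ : ℝ} (hκ : 0 < κ)
    (hρ : 0 < ρ) (hd : d = 2 ∨ d = 3) (hk : 1 ≤ k) :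
    ∃ C : ℝ, 0 ≤ C ∧ ∀ (Ω : Set (E d)), IsConvexPolytopalDomain Ω → ∀ M : Mesh Ω,
      M.IsShapeRegular ρ → ∀ S : DofSystem M L κ, ∀ lam : ℝ, 0 < lam → ∀ v : M.Vh k,
      ∃ v0 : M.V0, M.IsNodalInterpolant v v0 ∧
        S.normSqRbar lam (v - S.transfer v0) + M.normSqR0 lam v0 ≤ C * M.inner_lam lam v v := by
  obtain ⟨C₁, hC₁, h₁⟩ := exists_normSqRbar_transfer_le L hκ hρ hd hk
  obtain ⟨C₂, hC₂, h₂⟩ := exists_normSqR0_le (d := d) k hρ hd hk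
  refine ⟨C₁ + C₂, by positivity, fun Ω hΩ M hM S lam hlam v => ?_⟩
  obtain ⟨v0, hv0⟩ := M.exists_interpolant hΩ v v.2.1.2
  refine ⟨v0, hv0, ?_⟩
  rw [add_mul]
  exact add_le_add (h₁ Ω hΩ M hM S v v0 hv0 lam hlam) (h₂ Ω hΩ M hM v v0 hv0 lam hlam)

end FEM

end

/-! ### The stable decomposition theorem -/

theorem mainTheorem3 (d k : ℕ) (hdk : (d = 2 ∧ 3 ≤ k) ∨ (d = 3 ∧ 5 ≤ k))
    (Ω : Set (FEM.E d)) (hΩ : FEM.IsConvexPolytopalDomain Ω)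
    (L : FEM.NodeLayout d k) (κ ρ : ℝ) (hκ : 0 < κ) (hρ : 0 < ρ) :
    ∃ c₀ : ℝ, 0 < c₀ ∧
      ∀ M : FEM.Mesh Ω, M.IsShapeRegular ρ → ∀ S : FEM.DofSystem M L κ, ∀ lam : ℝ, 0 < lam →
        ∀ v : M.Vh k, ∃ (vh : M.Vh k) (v0 : M.V0),
          M.IsNodalInterpolant v v0 ∧
          v = vh + S.transfer v0 ∧
          S.normSqRbar lam vh + M.normSqR0 lam v0 ≤ c₀ ^ 2 * M.inner_lam lam v v := by
  have hd : d = 2 ∨ d = 3 := by omega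
  obtain ⟨C, hC, h⟩ := FEM.exists_stable_decomposition L hκ hρ hd (by omega)
  -- The added one keeps the constant positive even if `C = 0`.
  refine ⟨Real.sqrt (C + 1), by positivity, fun M hM S lam hlam v => ?_⟩
  obtain ⟨v0, hv0, hle⟩ := h Ω hΩ M hM S lam hlam v
  have h0 : 0 ≤ M.inner_lam lam v v := by
    rw [FEM.Mesh.inner_lam_eq_sum hΩ v.2.1 v.2.1]
    exact Finset.sum_nonneg fun T _ => FEM.localEnergy_self_nonneg hlam.le T _
  refine ⟨v - S.transfer v0, v0, hv0, (sub_add_cancel _ _).symm, ?_⟩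
  rw [Real.sq_sqrt (by positivity)]
  linarith
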